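/- Let $n\ge 1$, $q=e^{h/2}\in\mathbb{C}[[h]]$, $\bar q=q^{-1}$, and let $C_n=(c_{ij})$ be the Cartan matrix of $\mathfrak{sl}_{n+1}$ ($c_{ii}=2$, $c_{ij}=-1$ if $|i-j|=1$, $c_{ij}=0$ otherwise). Let $U_h(\mathfrak{sl}_{n+1})$ be the $h$-adically complete $\mathbb{C}[[h]]$-algebra topologically generated by $x_i,H_i,y_i$ ($1\le i\le n$) subject to $$[H_i,H_j]=0,\quad [H_i,x_j]=c_{ij}x_j,\quad [H_i,y_j]=-c_{ij}y_j,\quad [x_i,y_j]=\delta_{ij}\frac{e^{hH_i/2}-e^{-hH_i/2}}{q-\bar q},$$ to the $q$-Serre relations $x_i^2x_j-(q+\bar q)x_ix_jx_i+x_jx_i^2=0$ and $y_i^2y_j-(q+\bar q)y_iy_jy_i+y_jy_i^2=0$ for $|i-j|=1$, and to $[x_i,x_j]=[y_i,y_j]=0$ for $|i-j|>1$. All tensor products below are over $\mathbb{C}[[h]]$ and $h$-adically completed. Put $k_i=e^{hH_i/4}$, $\bar k_i=k_i^{-1}$; for $a\le b$ put $k_{a,b}=k_ak_{a+1}\cdots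 k_b$, $\bar k_{a,b}=\bar k_a\bar k_{a+1}\cdots\bar k_b$, and let $x_{a,a}=x_a$, $x_{a,b}=q^{1/2}x_ax_{a+1,b}-\bar q^{1/2}x_{a+1,b}x_a$ for $a<b$, with $y_{a,b}$ defined by the same formulas in the $y_i$. Then $U_h(\mathfrak{sl}_{n+1})$ carries a Hopf algebra structure over $\mathbb{C}[[h]]$ with coproduct $\Delta$, counit $\varepsilon$ and antipode $S$ satisfying $$\Delta(x_i)=x_i\otimes k_i+\bar k_i\otimes x_i,\quad \Delta(y_i)=y_i\otimes k_i+\bar k_i\otimes y_i,\quad \Delta(H_i)=H_i\otimes1+1\otimes H_i,$$ $$S(x_i)=-qx_i,\quad S(y_i)=-\bar q y_i,\quad S(H_i)=-H_i,\qquad \varepsilon(x_i)=\varepsilon(y_i)=\varepsilon(H_i)=0,$$ for which the element $$R=\exp\Big(\frac h4\sum_{i,j=1}^n\kappa_{ij}\,H_i\otimes H_j\Big)\ \prod_{1\le a\le b\le n}^{\prec}\mathrm{Exp}_q\Big((-1)^{b-a}\lambda_q\;k_{a,b}x_{a,b}\otimes \bar k_{a,b}y_{a,b}\Big)$$ is a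 universal $R$-matrix: $R$ is invertible, and (i) $(\tau\circ\Delta)(u)=R\,\Delta(u)\,R^{-1}$ for all $u\in U_h(\mathfrak{sl}_{n+1})$, where $\tau(u\otimes v)=v\otimes u$; (ii) $(\Delta\otimes\mathrm{id})(R)=R_{13}R_{23}$; (iii) $(\mathrm{id}\otimes\Delta)(R)=R_{13}R_{12}$. Here $(\kappa_{ij})=2C_n^{-1}$, $\lambda_q=\bar q(q-\bar q)$, $\mathrm{Exp}_q(z)=\sum_{m\ge0}\frac{q^{m(m-1)/2}}{[m]!}z^m$ with $[m]=\frac{q^m-\bar q^m}{q-\bar q}$ and $[m]!=[1][2]\cdots[m]$, and the product is taken from left to right in the lexicographic order $(1,1),(1,2),\dots,(1,n),(2,2),\dots,(2,n),\dots,(n,n)$ of the pairs $(a,b)$. -/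

import Mathlib

open scoped TensorProduct

noncomputable section

namespace QuantumSl

/-- The base ring `ℂ⟦h⟧`. -/
abbrev Kh : Type := PowerSeries ℂ

/-- The indeterminate `h`. -/
abbrev hh : Kh := PowerSeries.X

/-! ### `h`-adic completion of (noncommutative) `ℂ⟦h⟧`-algebras -/

section Completion

variable (A : Type) [Ring A] [Algebra Kh A]

/-- The two-sided ideal `h ^ N A`. -/
def hIdeal (N : ℕ) : Ideal A where
  carrier := {a | ∃ b : A, a = hh ^ N • b}
  add_mem' := by
    rintro _ _ ⟨b, rfl⟩ ⟨c, rfl⟩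
    exact ⟨b + c, (smul_add _ _ _).symm⟩
  zero_mem' := ⟨0, (smul_zero _).symm⟩
  smul_mem' := by
    rintro c _ ⟨b, rfl⟩
    exact ⟨c * b, by simp⟩

instance (N : ℕ) : (hIdeal A N).IsTwoSided where
  mul_mem_of_left := by
    rintro _ c ⟨b, rfl⟩
    exact ⟨b * c, by simp⟩

variable {A}

theorem hPow_smul_quot_eq_zero {N m : ℕ} (hm : N ≤ m) (a : A ⧸ hIdeal A N) :
    hh ^ m • a = 0 := by
  obtain ⟨a, rfl⟩ := Ideal.Quotient.mk_surjective a
  obtain ⟨d, rfl⟩ := Nat.exists_eq_add_of_le hm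
  rw [← Ideal.Quotient.mkₐ_eq_mk Kh, ← map_smul, Ideal.Quotient.mkₐ_eq_mk,
    Ideal.Quotient.eq_zero_iff_mem]
  exact ⟨hh ^ d • a, by rw [smul_smul, pow_add]⟩

theorem hIdeal_le {M N : ℕ} (hMN : M ≤ N) : hIdeal A N ≤ hIdeal A M := by
  rintro _ ⟨b, rfl⟩
  obtain ⟨d, rfl⟩ := Nat.exists_eq_add_of_le hMN
  exact ⟨hh ^ d • b, by rw [smul_smul, pow_add]⟩

variable (A)

/-- The transition map `A / h ^ N A → A / h ^ M A` for `M ≤ N`. -/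
def hTrans {M N : ℕ} (hMN : M ≤ N) : A ⧸ hIdeal A N →ₐ[Kh] A ⧸ hIdeal A M :=
  Ideal.Quotient.factorₐ Kh (hIdeal_le hMN)

/-- The inverse limit of the algebras `A / h ^ N A`, inside their product. -/
def hComplSubalgebra : Subalgebra Kh (∀ N : ℕ, A ⧸ hIdeal A N) where
  carrier := {a | ∀ (M N : ℕ) (hMN : M ≤ N), hTrans A hMN (a N) = a M}
  mul_mem' := by
    intro a b ha hb M N hMN
    simp [ha M N hMN, hb M N hMN]
  add_mem' := by
    intro a b ha hb M N hMN
    simp [ha M N hMN, hb M N hMN]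
  algebraMap_mem' := by
    intro r M N hMN
    simp

/-- The `h`-adic completion of `A`. -/
def HCompl : Type := ↥(hComplSubalgebra A)

instance : Ring (HCompl A) := inferInstanceAs (Ring ↥(hComplSubalgebra A))

instance : Algebra Kh (HCompl A) := inferInstanceAs (Algebra Kh ↥(hComplSubalgebra A))

namespace HCompl

/-- The projection from the completion of `A` to `A / h ^ N A`. -/
def proj (N : ℕ) : HCompl A →ₐ[Kh] A ⧸ hIdeal A N :=
  (Pi.evalAlgHom Kh (fun N : ℕ => A ⧸ hIdeal A N) N).comp (hComplSubalgebra A).val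

variable {A}

theorem trans_proj {M N : ℕ} (hMN : M ≤ N) (a : HCompl A) :
    hTrans A hMN (proj A N a) = proj A M a := a.2 M N hMN

@[ext]
theorem ext {a b : HCompl A} (hab : ∀ N, proj A N a = proj A N b) : a = b :=
  Subtype.ext (funext hab)

/-- A compatible family of elements, as an element of the completion. -/
def mk (a : ∀ N : ℕ, A ⧸ hIdeal A N)
    (ha : ∀ (M N : ℕ) (hMN : M ≤ N), hTrans A hMN (a N) = a M) : HCompl A := ⟨a, ha⟩

@[simp]
theorem proj_mk (a : ∀ N : ℕ, A ⧸ hIdeal A N)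
    (ha : ∀ (M N : ℕ) (hMN : M ≤ N), hTrans A hMN (a N) = a M) (N : ℕ) :
    proj A N (mk a ha) = a N := rfl

/-- The algebra map to the completion determined by a compatible family of algebra maps. -/
def liftHom {B : Type} [Ring B] [Algebra Kh B] (f : ∀ N : ℕ, B →ₐ[Kh] A ⧸ hIdeal A N)
    (hf : ∀ (M N : ℕ) (hMN : M ≤ N) (b : B), hTrans A hMN (f N b) = f M b) :
    B →ₐ[Kh] HCompl A where
  toFun b := mk (fun N => f N b) (fun M N hMN => hf M N hMN b)
  map_one' := by ext N; simp
  map_mul' _ _ := by ext N; simp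
  map_zero' := by ext N; simp
  map_add' _ _ := by ext N; simp
  commutes' r := by ext N; simp

@[simp]
theorem proj_liftHom {B : Type} [Ring B] [Algebra Kh B] (f : ∀ N : ℕ, B →ₐ[Kh] A ⧸ hIdeal A N)
    (hf : ∀ (M N : ℕ) (hMN : M ≤ N) (b : B), hTrans A hMN (f N b) = f M b) (N : ℕ) (b : B) :
    proj A N (liftHom f hf b) = f N b := rfl

variable (A)

/-- The canonical map from `A` to its completion. -/
def of : A →ₐ[Kh] HCompl A :=
  liftHom (fun N => Ideal.Quotient.mkₐ Kh (hIdeal A N)) (fun _ _ _ _ => rfl)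

variable {A} {B : Type} [Ring B] [Algebra Kh B]

theorem exists_proj_eq (N : ℕ) (a : HCompl A) :
    ∃ b : A, proj A N a = Ideal.Quotient.mkₐ Kh (hIdeal A N) b := by
  obtain ⟨b, hb⟩ := Ideal.Quotient.mk_surjective (proj A N a)
  exact ⟨b, hb.symm⟩

theorem linear_vanish (f : A →ₗ[Kh] HCompl B) (N : ℕ) (a : A) (ha : a ∈ hIdeal A N) :
    proj B N (f a) = 0 := by
  obtain ⟨b, rfl⟩ := ha
  rw [map_smul, map_smul]
  exact hPow_smul_quot_eq_zero le_rfl _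

/-- The map `A / h ^ N A → B / h ^ N B` induced by a linear map from `A` to the completion
of `B`. -/
def quotLin (f : A →ₗ[Kh] HCompl B) (N : ℕ) : A ⧸ hIdeal A N →ₗ[Kh] B ⧸ hIdeal B N :=
  (((hIdeal A N).restrictScalars Kh).liftQ ((proj B N).toLinearMap ∘ₗ f)
    (fun a ha => linear_vanish f N a ha)) ∘ₗ
    (Submodule.Quotient.restrictScalarsEquiv Kh (hIdeal A N)).symm.toLinearMap

@[simp]
theorem quotLin_mk (f : A →ₗ[Kh] HCompl B) (N : ℕ) (a : A) :
    quotLin f N (Ideal.Quotient.mkₐ Kh (hIdeal A N) a) = proj B N (f a) := rfl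

theorem trans_quotLin (f : A →ₗ[Kh] HCompl B) {M N : ℕ} (hMN : M ≤ N) (a : HCompl A) :
    hTrans B hMN (quotLin f N (proj A N a)) = quotLin f M (proj A M a) := by
  obtain ⟨b, hb⟩ := exists_proj_eq N a
  have hb' : proj A M a = Ideal.Quotient.mkₐ Kh (hIdeal A M) b := by
    rw [← trans_proj hMN, hb]; rfl
  rw [hb, hb', quotLin_mk, quotLin_mk, trans_proj]

/-- The (unique, `h`-adically continuous) extension to the completion of a linear map with
values in a completion. -/
def extendLin (f : A →ₗ[Kh] HCompl B) : HCompl A →ₗ[Kh] HCompl B where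
  toFun a := mk (fun N => quotLin f N (proj A N a)) (fun _ _ hMN => trans_quotLin f hMN a)
  map_add' _ _ := by ext N; simp
  map_smul' _ _ := by ext N; simp

@[simp]
theorem proj_extendLin (f : A →ₗ[Kh] HCompl B) (N : ℕ) (a : HCompl A) :
    proj B N (extendLin f a) = quotLin f N (proj A N a) := rfl

/-- The (unique, `h`-adically continuous) extension to the completion of an algebra map with
values in a completion. -/
def extend (f : A →ₐ[Kh] HCompl B) : HCompl A →ₐ[Kh] HCompl B :=
  AlgHom.ofLinearMap (extendLin f.toLinearMap)
    (by
      ext N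
      rw [proj_extendLin, map_one (proj A N), ← map_one (Ideal.Quotient.mkₐ Kh (hIdeal A N)),
        quotLin_mk]
      simp)
    (by
      intro a b
      ext N
      obtain ⟨a', ha⟩ := exists_proj_eq N a
      obtain ⟨b', hb⟩ := exists_proj_eq N b
      rw [map_mul (proj B N), proj_extendLin, proj_extendLin, proj_extendLin,
        map_mul (proj A N), ha, hb, ← map_mul (Ideal.Quotient.mkₐ Kh (hIdeal A N)),
        quotLin_mk, quotLin_mk, quotLin_mk]
      simp)

theorem extend_of (f : A →ₐ[Kh] HCompl B) (a : A) : extend f (of A a) = f a := by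
  ext N
  exact quotLin_mk f.toLinearMap N a

/-- Functoriality of the completion for algebra maps. -/
def map (f : A →ₐ[Kh] B) : HCompl A →ₐ[Kh] HCompl B := extend ((of B).comp f)

/-- Functoriality of the completion for linear maps. -/
def mapLin (f : A →ₗ[Kh] B) : HCompl A →ₗ[Kh] HCompl B := extendLin ((of B).toLinearMap ∘ₗ f)

theorem commute_map_of (f : A →ₐ[Kh] B) (c : B) (hc : ∀ a, Commute (f a) c) (z : HCompl A) :
    Commute (map f z) (of B c) := by
  have key : ∀ N, ∃ a, proj B N (map f z) = Ideal.Quotient.mkₐ Kh (hIdeal B N) (f a) := by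
    intro N
    obtain ⟨a, ha⟩ := exists_proj_eq N z
    refine ⟨a, ?_⟩
    have h1 : proj B N (map f z) = quotLin ((of B).comp f).toLinearMap N (proj A N z) := rfl
    rw [h1, ha]
    rfl
  refine HCompl.ext fun N => ?_
  obtain ⟨a, ha⟩ := key N
  have h2 : proj B N (of B c) = Ideal.Quotient.mkₐ Kh (hIdeal B N) c := rfl
  rw [map_mul, map_mul, ha, h2, ← map_mul, ← map_mul, (hc a).eq]

/-- The `h`-adically convergent series `∑ m, c m * h ^ m * z ^ m`. -/
def hSeries (c : ℕ → Kh) (z : HCompl A) : HCompl A :=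
  mk (fun N => ∑ m ∈ Finset.range N, (c m * hh ^ m) • proj A N z ^ m) (by
    intro M N hMN
    rw [map_sum]
    simp only [map_smul, map_pow, trans_proj]
    refine (Finset.sum_subset (Finset.range_mono hMN) ?_).symm
    intro m _ hm
    rw [mul_smul, hPow_smul_quot_eq_zero (by simpa using hm), smul_zero])

/-- `exp (c h z)` for a complex number `c`. -/
def hExp (c : ℂ) (z : HCompl A) : HCompl A :=
  hSeries (fun m => PowerSeries.C (c ^ m / (m.factorial : ℂ))) z

end HCompl

end Completion

/-! ### Scalars depending on `q = exp (h / 2)` -/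

/-- `q ^ c = exp (c h / 2)`. -/
def qPow (c : ℂ) : Kh := PowerSeries.rescale (c / 2) (PowerSeries.exp ℂ)

/-- `f / h`, for a power series `f` without constant term. -/
def hDiv (f : Kh) : Kh := PowerSeries.mk fun m => PowerSeries.coeff (m + 1) f

theorem hh_mul_hDiv (f : Kh) (hf : PowerSeries.constantCoeff f = 0) : hh * hDiv f = f := by
  ext m
  cases m with
  | zero => simp [hf]
  | succ m => simp [hDiv, PowerSeries.coeff_succ_X_mul]

theorem constantCoeff_qPow_sub (c d : ℂ) :
    PowerSeries.constantCoeff (qPow c - qPow d) = 0 := by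
  rw [← PowerSeries.coeff_zero_eq_constantCoeff_apply]
  simp only [qPow, map_sub, PowerSeries.coeff_rescale, pow_zero, one_mul, sub_self]

/-- `(q - q⁻¹) / h`, a unit of `ℂ⟦h⟧`. -/
def qDiff : Kh := hDiv (qPow 1 - qPow (-1))

theorem hh_mul_qDiff : hh * qDiff = qPow 1 - qPow (-1) :=
  hh_mul_hDiv _ (constantCoeff_qPow_sub _ _)

theorem qDiff_mul_inv : qDiff * qDiff⁻¹ = 1 := by
  refine PowerSeries.mul_inv_cancel _ ?_
  rw [← PowerSeries.coeff_zero_eq_constantCoeff_apply, qDiff, hDiv, PowerSeries.coeff_mk]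
  simp [qPow, PowerSeries.coeff_rescale, PowerSeries.coeff_exp]
  norm_num

/-- The quantum integer `[m] = (q ^ m - q ^ (-m)) / (q - q⁻¹)`. -/
def qInt (m : ℕ) : Kh := hDiv (qPow m - qPow (-m)) * qDiff⁻¹

theorem qInt_mul (m : ℕ) : qInt m * (qPow 1 - qPow (-1)) = qPow m - qPow (-m) := by
  rw [← hh_mul_qDiff, qInt]
  calc hDiv (qPow m - qPow (-m)) * qDiff⁻¹ * (hh * qDiff)
      = (hh * hDiv (qPow m - qPow (-m))) * (qDiff * qDiff⁻¹) := by ring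
    _ = qPow m - qPow (-m) := by
      rw [qDiff_mul_inv, mul_one, hh_mul_hDiv _ (constantCoeff_qPow_sub _ _)]

/-- The quantum factorial `[m]! = [1] [2] ⋯ [m]`. -/
def qFactorial (m : ℕ) : Kh := ∏ i ∈ Finset.range m, qInt (i + 1)

/-- `λ_q / h`, where `λ_q = q⁻¹ (q - q⁻¹)`. -/
def lamDiv : Kh := qPow (-1) * qDiff

theorem hh_mul_lamDiv : hh * lamDiv = qPow (-1) * (qPow 1 - qPow (-1)) := by
  rw [← hh_mul_qDiff, lamDiv]; ring

namespace HCompl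

variable {A : Type} [Ring A] [Algebra Kh A]

/-- `Exp_q (h z)`, where `Exp_q (x) = ∑ m, q ^ (m (m - 1) / 2) / [m]! * x ^ m`. -/
def hQExp (z : HCompl A) : HCompl A :=
  hSeries (fun m => qPow ((m : ℂ) * ((m : ℂ) - 1) / 2) * (qFactorial m)⁻¹) z

/-- `(exp (h z / 2) - exp (- h z / 2)) / (q - q⁻¹)`, computed by dividing both the numerator
and the denominator by `h`; `qBracket_spec` is the identity that characterizes it. -/
def qBracket (z : HCompl A) : HCompl A :=
  qDiff⁻¹ • (z * hSeries (fun m => PowerSeries.C (PowerSeries.coeff m qDiff)) z)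

theorem qBracket_spec (z : HCompl A) :
    (qPow 1 - qPow (-1)) • qBracket z = hExp (1 / 2) z - hExp (-1 / 2) z := by
  have h1 : (qPow 1 - qPow (-1)) • qBracket z =
      hh • (z * hSeries (fun m => PowerSeries.C (PowerSeries.coeff m qDiff)) z) := by
    rw [qBracket, smul_smul, ← hh_mul_qDiff, mul_assoc, qDiff_mul_inv, mul_one]
  rw [h1]
  ext N
  simp only [map_smul, map_mul, map_sub, hSeries, hExp, proj_mk]
  rw [← Finset.sum_sub_distrib, Finset.mul_sum, Finset.smul_sum]
  cases N with
  | zero => simp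
  | succ N =>
    rw [Finset.sum_range_succ, Finset.sum_range_succ']
    have hlast : ∀ (c : Kh) (w u : A ⧸ hIdeal A (N + 1)),
        hh • (w * ((c * hh ^ N) • u)) = 0 := by
      intro c w u
      rw [mul_smul_comm, smul_smul,
        show hh * (c * hh ^ N) = c * hh ^ (N + 1) by ring, mul_smul,
        hPow_smul_quot_eq_zero le_rfl, smul_zero]
    rw [hlast, add_zero]
    simp only [pow_zero, Nat.factorial_zero, sub_self, add_zero]
    refine Finset.sum_congr rfl fun m _ => ?_
    rw [mul_smul_comm, smul_smul, ← pow_succ', ← sub_smul, ← sub_mul, ← map_sub]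
    congr 1
    rw [show PowerSeries.coeff m qDiff =
      (1 / 2 : ℂ) ^ (m + 1) / ((m + 1).factorial : ℂ)
        - (-1 / 2 : ℂ) ^ (m + 1) / ((m + 1).factorial : ℂ) by
      simp [qDiff, hDiv, qPow, PowerSeries.coeff_rescale, PowerSeries.coeff_exp, div_eq_mul_inv]]
    ring

end HCompl

/-! ### Complete Hopf algebras over `ℂ⟦h⟧` and universal `R`-matrices

Tensor products are completed in the `h`-adic topology. -/

section Hopf

variable (A : Type) [Ring A] [Algebra Kh A]

/-- The completed tensor square. -/
abbrev T2 : Type := HCompl (A ⊗[Kh] A)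

/-- The completed tensor cube. -/
abbrev T3 : Type := HCompl ((A ⊗[Kh] A) ⊗[Kh] A)

/-- `a ⊗ b ↦ a ⊗ b ⊗ 1`. -/
def leg12 : A ⊗[Kh] A →ₐ[Kh] (A ⊗[Kh] A) ⊗[Kh] A := Algebra.TensorProduct.includeLeft

/-- `a ⊗ b ↦ a ⊗ 1 ⊗ b`. -/
def leg13 : A ⊗[Kh] A →ₐ[Kh] (A ⊗[Kh] A) ⊗[Kh] A :=
  Algebra.TensorProduct.map Algebra.TensorProduct.includeLeft (AlgHom.id Kh A)

/-- `a ⊗ b ↦ 1 ⊗ a ⊗ b`. -/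
def leg23 : A ⊗[Kh] A →ₐ[Kh] (A ⊗[Kh] A) ⊗[Kh] A :=
  Algebra.TensorProduct.map Algebra.TensorProduct.includeRight (AlgHom.id Kh A)

variable {A}

/-- The twist `a ⊗ b ↦ b ⊗ a` on the completed tensor square. -/
def twist : T2 A →ₐ[Kh] T2 A :=
  HCompl.map (Algebra.TensorProduct.comm Kh A A).toAlgHom

/-- `a ⊗ b`, as an element of the completed tensor square. -/
def tmul (a b : A) : T2 A := HCompl.of (A ⊗[Kh] A) (a ⊗ₜ[Kh] b)

/-- `D ⊗ id : A ⊗ A → A ⊗ A ⊗ A`, for an algebra map `D : A → A ⊗ A`. -/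
def mapId (D : A →ₐ[Kh] T2 A) : T2 A →ₐ[Kh] T3 A :=
  HCompl.extend (Algebra.TensorProduct.lift ((HCompl.map (leg12 A)).comp D)
    ((HCompl.of _).comp Algebra.TensorProduct.includeRight) (by
      intro a b
      refine HCompl.commute_map_of _ _ (fun t => ?_) _
      simp [leg12, Commute, SemiconjBy]))

/-- `id ⊗ D : A ⊗ A → A ⊗ A ⊗ A`, for an algebra map `D : A → A ⊗ A`. -/
def idMap (D : A →ₐ[Kh] T2 A) : T2 A →ₐ[Kh] T3 A :=
  HCompl.extend (Algebra.TensorProduct.lift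
    ((HCompl.of _).comp ((leg12 A).comp Algebra.TensorProduct.includeLeft))
    ((HCompl.map (leg23 A)).comp D) (by
      intro a b
      refine (HCompl.commute_map_of _ _ (fun t => ?_) _).symm
      induction t with
      | zero => simp
      | add s t hs ht => rw [map_add]; exact hs.add_left ht
      | tmul s t => simp [leg12, leg23, Commute, SemiconjBy]))

variable (A)

/-- A Hopf algebra structure on the (complete) `ℂ⟦h⟧`-algebra `A`, where tensor products are
completed `h`-adically; maps that are linear over `ℂ⟦h⟧` are automatically continuous. The
antipode is an algebra anti-homomorphism. -/
structure HopfStructure where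
  comul : A →ₐ[Kh] T2 A
  counit : A →ₐ[Kh] Kh
  antipode : A →ₐ[Kh] Aᵐᵒᵖ
  coassoc : ∀ a, idMap comul (comul a) = mapId comul (comul a)
  counit_left : ∀ a, HCompl.map (Algebra.TensorProduct.map counit (AlgHom.id Kh A)) (comul a) =
    HCompl.of (Kh ⊗[Kh] A) (1 ⊗ₜ[Kh] a)
  counit_right : ∀ a, HCompl.map (Algebra.TensorProduct.map (AlgHom.id Kh A) counit) (comul a) =
    HCompl.of (A ⊗[Kh] Kh) (a ⊗ₜ[Kh] 1)
  antipode_left : ∀ a,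
    HCompl.mapLin (LinearMap.mul' Kh A ∘ₗ TensorProduct.map
      ((MulOpposite.opLinearEquiv Kh).symm.toLinearMap ∘ₗ antipode.toLinearMap) LinearMap.id)
      (comul a) = HCompl.of A (algebraMap Kh A (counit a))
  antipode_right : ∀ a,
    HCompl.mapLin (LinearMap.mul' Kh A ∘ₗ TensorProduct.map LinearMap.id
      ((MulOpposite.opLinearEquiv Kh).symm.toLinearMap ∘ₗ antipode.toLinearMap))
      (comul a) = HCompl.of A (algebraMap Kh A (counit a))

variable {A}

/-- `R` is a universal `R`-matrix for the Hopf algebra `A`. -/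
structure IsUniversalRMatrix (S : HopfStructure A) (R : T2 A) : Prop where
  twist_comul : ∃ u : (T2 A)ˣ, (u : T2 A) = R ∧
    ∀ a, twist (S.comul a) = R * S.comul a * ((u⁻¹ : (T2 A)ˣ) : T2 A)
  comul_id : mapId S.comul R = HCompl.map (leg13 A) R * HCompl.map (leg23 A) R
  id_comul : idMap S.comul R = HCompl.map (leg13 A) R * HCompl.map (leg12 A) R

end Hopf

/-! ### The quantized universal enveloping algebra of `sl (n + 1)` -/

/-- Names of the generators. -/
inductive Gen (n : ℕ) : Type
  | x (i : Fin n)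
  | H (i : Fin n)
  | y (i : Fin n)

/-- The `h`-adically completed free algebra on the generators. -/
abbrev FreeCompl (n : ℕ) : Type := HCompl (FreeAlgebra Kh (Gen n))

/-- A generator in the completed free algebra. -/
def gen {n : ℕ} (g : Gen n) : FreeCompl n := HCompl.of _ (FreeAlgebra.ι Kh g)

open Gen in
/-- The defining relations. `CartanMatrix.A n` is the `n × n` Cartan matrix of `sl (n + 1)`. -/
inductive Rel (n : ℕ) : FreeCompl n → FreeCompl n → Prop
  | HH (i j : Fin n) : Rel n (gen (H i) * gen (H j)) (gen (H j) * gen (H i))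
  | Hx (i j : Fin n) : Rel n (gen (H i) * gen (x j) - gen (x j) * gen (H i))
      ((CartanMatrix.A n i j) • gen (x j))
  | Hy (i j : Fin n) : Rel n (gen (H i) * gen (y j) - gen (y j) * gen (H i))
      (-(CartanMatrix.A n i j) • gen (y j))
  | xy (i j : Fin n) : Rel n (gen (x i) * gen (y j) - gen (y j) * gen (x i))
      (if i = j then HCompl.qBracket (gen (H i)) else 0)
  | serre_x (i j : Fin n) (hij : (i : ℕ) + 1 = j ∨ (j : ℕ) + 1 = i) : Rel n
      (gen (x i) ^ 2 * gen (x j) - (qPow 1 + qPow (-1)) • (gen (x i) * gen (x j) * gen (x i))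
        + gen (x j) * gen (x i) ^ 2) 0
  | serre_y (i j : Fin n) (hij : (i : ℕ) + 1 = j ∨ (j : ℕ) + 1 = i) : Rel n
      (gen (y i) ^ 2 * gen (y j) - (qPow 1 + qPow (-1)) • (gen (y i) * gen (y j) * gen (y i))
        + gen (y j) * gen (y i) ^ 2) 0
  | comm_x (i j : Fin n) (hij : (i : ℕ) + 1 < j ∨ (j : ℕ) + 1 < i) : Rel n
      (gen (x i) * gen (x j)) (gen (x j) * gen (x i))
  | comm_y (i j : Fin n) (hij : (i : ℕ) + 1 < j ∨ (j : ℕ) + 1 < i) : Rel n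
      (gen (y i) * gen (y j)) (gen (y j) * gen (y i))

/-- The quotient of the completed free algebra by the two-sided ideal of the relations. -/
def PreU (n : ℕ) : Type := RingQuot (Rel n)

instance (n : ℕ) : Ring (PreU n) := inferInstanceAs (Ring (RingQuot (Rel n)))

instance (n : ℕ) : Algebra Kh (PreU n) := inferInstanceAs (Algebra Kh (RingQuot (Rel n)))

/-- The quantized universal enveloping algebra `U_h(sl (n + 1))`: the `h`-adically complete
`ℂ⟦h⟧`-algebra generated (topologically) by the `x i`, `H i`, `y i` subject to the relations
`Rel n`. Completing the quotient `PreU n` of the complete algebra `FreeCompl n` amounts to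
dividing `FreeCompl n` by the `h`-adic closure of the ideal of the relations. -/
abbrev Uh (n : ℕ) : Type := HCompl (PreU n)

/-- The canonical map from the completed free algebra to `U_h(sl (n + 1))`. -/
def toUh (n : ℕ) : FreeCompl n →ₐ[Kh] Uh n :=
  (HCompl.of (PreU n)).comp (RingQuot.mkAlgHom Kh (Rel n))

namespace Uh

variable {n : ℕ}

/-- The generator `x i`. -/
def x (i : Fin n) : Uh n := toUh n (gen (Gen.x i))

/-- The generator `H i`. -/
def H (i : Fin n) : Uh n := toUh n (gen (Gen.H i))

/-- The generator `y i`. -/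
def y (i : Fin n) : Uh n := toUh n (gen (Gen.y i))

/-- `k i = exp (h H_i / 4)`. -/
def k (i : Fin n) : Uh n := HCompl.hExp (1 / 4) (H i)

/-- `kbar i = exp (- h H_i / 4)`, the inverse of `k i`. -/
def kbar (i : Fin n) : Uh n := HCompl.hExp (-1 / 4) (H i)

/-- For a family `g` of elements: `g_{i,i} = g_i` and
`g_{i,j} = q ^ (1 / 2) g_i g_{i+1,j} - q ^ (- 1 / 2) g_{i+1,j} g_i`, where `j = i + d`. -/
def rootVec (g : Fin n → Uh n) : (i d : ℕ) → i + d < n → Uh n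
  | i, 0, hi => g ⟨i, hi⟩
  | i, d + 1, hi =>
      qPow (1 / 2) • (g ⟨i, by omega⟩ * rootVec g (i + 1) d (by omega))
        - qPow (-1 / 2) • (rootVec g (i + 1) d (by omega) * g ⟨i, by omega⟩)

/-- The product `g_i g_{i+1} ⋯ g_j`, where `j = i + d`. -/
def segProd (g : Fin n → Uh n) (i d : ℕ) (hi : i + d < n) : Uh n :=
  (List.ofFn fun t : Fin (d + 1) => g ⟨i + t, by omega⟩).prod

/-- The matrix `κ = 2 C⁻¹`, where `C` is the Cartan matrix of `sl (n + 1)`. -/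
def kappa (n : ℕ) : Matrix (Fin n) (Fin n) ℂ :=
  (2 : ℂ) • ((CartanMatrix.A n).map (Int.cast : ℤ → ℂ))⁻¹

/-- The factor `Exp_q ((-1) ^ (b - a) λ_q k_{a,b} x_{a,b} ⊗ kbar_{a,b} y_{a,b})`, where
`b = a + d`. -/
def rFactor (a d : ℕ) (had : a + d < n) : T2 (Uh n) :=
  HCompl.hQExp (((-1) ^ d * lamDiv) •
    tmul (segProd k a d had * rootVec x a d had) (segProd kbar a d had * rootVec y a d had))

variable (n)

/-- `exp ((h / 4) ∑ κ_{ij} H_i ⊗ H_j)` times the ordered product of the factors `rFactor`, the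
indices `a ≤ b` being taken in the order `11, 12, …, 1n, 22, 23, …, 2n, …, nn`. -/
def rMatrix : T2 (Uh n) :=
  HCompl.hExp (1 / 4) (∑ i : Fin n, ∑ j : Fin n, PowerSeries.C (kappa n i j) • tmul (H i) (H j)) *
  (List.ofFn fun a : Fin n => (List.ofFn fun d : Fin (n - a) =>
    rFactor (n := n) a d (by omega)).prod).prod

end Uh

end QuantumSl

end

/-!
Throughout, `q = exp (h / 2)`.

**Hopf structure.** `U_h(sl (n + 1))` is the completion of a quotient of a completed free algebra,
so homomorphisms to complete algebras are given by elements that satisfy the defining relations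
(`Uh.lift`), and they are determined by their values on the generators (`Uh.algHom_ext`). The
coproduct respects the Serre relations because the sum of two Serre families `α` and `ε` with `α i *
ε j = q ^ (c i j) • ε j * α i` is again a Serre family (`IsSerre.add`). The axioms of a Hopf algebra
are verified on the generators.

**Factorization of `R`.** Put `E i = k i * x i` and `F i = - kbar i * y i`. Then the factor of `R`
that belongs to the pair `(a, b)` is the `q`-exponential of `- λ_q e_{a,b} ⊗ f_{a,b}`
(`Uh.rFactor_eq`), where the root vectors of the families `E` and `F` are normalized by `e_{a,b} =
e_a e_{a+1,b} - q⁻¹ e_{a+1,b} e_a`. For fixed `a`, the elements `e_{a,b} ⊗ f_{a,b}` commute up to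
powers of `q²`, and the multiplication rule for `q`-exponentials (`HCompl.hQExp_add`) turns the
product over `b` into the `q`-exponential of the row sum `∑ b, e_{a,b} ⊗ f_{a,b}`
(`expRow_eq_prod`). Therefore `R = K Θ`, where `K` is the Cartan factor and `Θ` is an ordered
product of only `n` `q`-exponentials, one for each row (`Uh.rMatrix_eq`). The product `Θ(e, φ)`
makes sense for arbitrary commuting Serre families `e` and `φ` in a complete algebra, and it is in
this generality that it is studied.

**Hexagon identities.** Since `Δ(E i) = E i ⊗ k i ^ 2 + 1 ⊗ E i`, they reduce to the identity `Θ(α +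
ε, φ) = Θ(α, φ) Θ(ε, φ)` for families that satisfy the cross relations above (`theta_add`); the
factors `k i ^ 2` are removed by conjugation with `K` (`Uh.cartanPart_mul_kk_F` and
`Uh.cartanPart_mul_kbkb_E`). To prove it, the root vectors of `α + ε` are expanded
(`seg_add_family`). This shows that row `s` of `α + ε` is row `s` of `α` plus a sum `W`, and `W` is
what becomes of row `s` of `ε` when it is moved to the left through all rows of `α` after row `s`
(`theta_mul_rowSum`). Since `W` and row `s` of `α` commute up to `q²` (`triSum_mul_rowSum`), the
`q`-exponential of their sum factors.

**Opposite coproduct.** Both sides of `(τ ∘ Δ)(u) = R Δ(u) R⁻¹` are homomorphisms in `u`, so it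
suffices to take `u = E i`, `F i`, `H i`. The essential point is that `Θ` intertwines `1 ⊗ E i + E i
⊗ k i ^ 2` and `1 ⊗ E i + E i ⊗ kbar i ^ 2` (`theta_mul_opposite`), after which conjugation by `K`
gives the opposite coproduct of `E i`. When `1 ⊗ E i + E i ⊗ k i ^ 2` is moved through the rows of
`Θ`, only the rows `i + 1` and `i` change it, and what they do is governed by a commutation rule for
`q`-exponentials (`HCompl.hQExp_mul_sub`). The same statement, with the tensor factors exchanged,
treats `F i`.

**Root vectors.** All these computations rest on the commutation relations between the root vectors
of two segments (`IsSerre.seg_bracket`, `IsSerre.seg_row`, `IsSerre.seg_column`,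
`IsSerre.seg_nested`, `IsSerre.seg_far` and `IsSerre.seg_crossing`), which follow from the Serre
relations; the key case is `interior_commute`. In products of two row sums, the contributions of the
index pairs `(t, t')` and `(t', t)` cancel.
-/

open scoped TensorProduct

noncomputable section

namespace QuantumSl

/-! ### Convergent series in `h`-adic completions -/

namespace HCompl

section

variable {A B : Type} [Ring A] [Algebra Kh A] [Ring B] [Algebra Kh B]

theorem proj_hPow_smul {N m : ℕ} (hm : N ≤ m) (a : HCompl A) : proj A N (hh ^ m • a) = 0 := by
  rw [map_smul]; exact hPow_smul_quot_eq_zero hm _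

theorem quot_zero_eq_zero (a : A ⧸ hIdeal A 0) : a = 0 := by
  simpa using hPow_smul_quot_eq_zero (Nat.zero_le 0) a

/-- The `h`-adically convergent series `∑ m, h ^ m f_m`. -/
def evalH (f : ℕ → HCompl A) : HCompl A :=
  mk (fun N => ∑ m ∈ Finset.range N, hh ^ m • proj A N (f m)) (by
    intro M N hMN
    rw [map_sum]
    simp only [map_smul, trans_proj]
    refine (Finset.sum_subset (Finset.range_mono hMN) ?_).symm
    intro m _ hm
    rw [hPow_smul_quot_eq_zero (by simpa using hm)])

theorem proj_evalH (f : ℕ → HCompl A) (N : ℕ) :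
    proj A N (evalH f) = ∑ m ∈ Finset.range N, hh ^ m • proj A N (f m) := rfl

theorem hSeries_eq (c : ℕ → Kh) (z : HCompl A) :
    hSeries c z = evalH fun m => c m • z ^ m := by
  ext N
  simp only [proj_evalH, hSeries, proj_mk, map_smul, map_pow, smul_smul, mul_comm]

theorem evalH_add (f g : ℕ → HCompl A) : evalH f + evalH g = evalH fun m => f m + g m := by
  ext N
  simp only [proj_evalH, map_add, smul_add, Finset.sum_add_distrib]

theorem mul_evalH (a : HCompl A) (f : ℕ → HCompl A) :
    a * evalH f = evalH fun m => a * f m := by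
  ext N
  simp only [proj_evalH, map_mul, Finset.mul_sum, mul_smul_comm]

theorem evalH_mul_right (a : HCompl A) (f : ℕ → HCompl A) :
    evalH f * a = evalH fun m => f m * a := by
  ext N
  simp only [proj_evalH, map_mul, Finset.sum_mul, smul_mul_assoc]

theorem smul_evalH (a : Kh) (f : ℕ → HCompl A) :
    a • evalH f = evalH fun m => a • f m := by
  ext N
  simp only [proj_evalH, map_smul, Finset.smul_sum, smul_comm a]

theorem evalH_mul (f g : ℕ → HCompl A) :
    evalH f * evalH g =
      evalH fun m => ∑ ij ∈ Finset.HasAntidiagonal.antidiagonal m, f ij.1 * g ij.2 := by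
  ext N
  simp only [proj_evalH, map_mul, map_sum, Finset.smul_sum]
  rw [Finset.sum_mul_sum, ← Finset.sum_product', Finset.sum_sigma']
  symm
  refine Finset.sum_of_injOn (fun x => (x.2.1, x.2.2)) ?_ ?_ ?_ ?_
  · rintro ⟨m, i, j⟩ h ⟨m', i', j'⟩ h' hx
    simp only [Finset.coe_sigma, Set.mem_sigma_iff, Finset.mem_coe, Finset.mem_range,
      Finset.HasAntidiagonal.mem_antidiagonal, Prod.mk.injEq] at h h' hx
    obtain ⟨rfl, rfl⟩ := hx
    obtain ⟨-, rfl⟩ := h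
    obtain ⟨-, rfl⟩ := h'
    rfl
  · rintro ⟨m, i, j⟩ h
    simp only [Finset.coe_sigma, Set.mem_sigma_iff, Finset.mem_coe, Finset.mem_range,
      Finset.HasAntidiagonal.mem_antidiagonal, Finset.mem_product] at h ⊢
    omega
  · rintro ⟨i, j⟩ h h'
    have : N ≤ i + j := by
      by_contra hlt
      exact h' ⟨⟨i + j, i, j⟩, by simpa using by omega, rfl⟩
    rw [smul_mul_smul_comm, ← pow_add, hPow_smul_quot_eq_zero this]
  · rintro ⟨m, i, j⟩ h
    simp only [Finset.mem_sigma, Finset.mem_range, Finset.HasAntidiagonal.mem_antidiagonal] at h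
    rw [smul_mul_smul_comm, ← pow_add, h.2]

theorem evalH_eq_head_add (f : ℕ → HCompl A) :
    evalH f = f 0 + hh • evalH fun m => f (m + 1) := by
  ext N
  cases N with
  | zero => rw [quot_zero_eq_zero (proj A 0 _), quot_zero_eq_zero (proj A 0 _)]
  | succ N =>
    rw [proj_evalH, Finset.sum_range_succ', map_add, map_smul, proj_evalH, Finset.sum_range_succ,
      smul_add, smul_smul, ← pow_succ', hPow_smul_quot_eq_zero le_rfl, add_zero, Finset.smul_sum,
      pow_zero, one_smul, add_comm (proj A _ (f 0))]
    simp only [smul_smul, ← pow_succ']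

theorem evalH_eq_sum_add (f : ℕ → HCompl A) (N : ℕ) :
    evalH f = ∑ m ∈ Finset.range N, hh ^ m • f m + hh ^ N • evalH fun m => f (m + N) := by
  induction N with
  | zero => simp
  | succ N ih =>
    rw [ih, Finset.sum_range_succ, evalH_eq_head_add, zero_add, smul_add, smul_smul, ← pow_succ,
      ← add_assoc]
    simp only [add_right_comm, add_assoc]

/-- An element whose truncation at order `N` vanishes is `h ^ N` times a convergent series with
coefficients in `A`. -/
theorem exists_eq_hPow_smul_evalH (N : ℕ) (w : HCompl A) (hw : proj A N w = 0) :
    ∃ f : ℕ → A, w = hh ^ N • evalH fun m => of A (f m) := by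
  choose a ha using fun M => exists_proj_eq (N + M) w
  have h0 : a 0 ∈ hIdeal A N := by
    have := ha 0
    rw [add_zero, hw] at this
    exact Ideal.Quotient.eq_zero_iff_mem.1 this.symm
  have hs : ∀ M, a (M + 1) - a M ∈ hIdeal A (N + M) := by
    intro M
    have h1 : proj A (N + M) w = Ideal.Quotient.mkₐ Kh (hIdeal A (N + M)) (a (M + 1)) := by
      rw [← trans_proj (show N + M ≤ N + (M + 1) by omega), ha]; rfl
    rw [← Ideal.Quotient.eq_zero_iff_mem]
    have : Ideal.Quotient.mkₐ Kh (hIdeal A (N + M)) (a (M + 1) - a M) = 0 := by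
      rw [map_sub, ← h1, ha M, sub_self]
    exact this
  obtain ⟨b0, hb0⟩ := h0
  choose b hb using hs
  have hsum : ∀ M, a M = hh ^ N • (b0 + ∑ m ∈ Finset.range M, hh ^ m • b m) := by
    intro M
    induction M with
    | zero => simpa using hb0
    | succ M ih =>
      rw [Finset.sum_range_succ, ← add_assoc, smul_add, ← ih, smul_smul, ← pow_add, ← hb]
      abel
  refine ⟨fun m => if m = 0 then b0 + b 0 else b m, ?_⟩
  ext K
  have h1 : proj A K w = Ideal.Quotient.mkₐ Kh (hIdeal A K) (a K) := by
    rw [← trans_proj (show K ≤ N + K by omega), ha]; rfl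
  have h2 : ∀ x : A, proj A K (of A x) = Ideal.Quotient.mkₐ Kh (hIdeal A K) x := fun _ => rfl
  rw [h1, hsum, map_smul, map_smul, proj_evalH]
  simp only [h2, ← map_smul, ← map_sum]
  cases K with
  | zero => rw [quot_zero_eq_zero (Ideal.Quotient.mkₐ Kh _ _), quot_zero_eq_zero
      (Ideal.Quotient.mkₐ Kh _ _)]
  | succ K =>
    congr 2
    rw [Finset.sum_range_succ', Finset.sum_range_succ']
    simp only [Nat.add_eq_zero_iff, one_ne_zero, and_false, if_false, if_true, pow_zero, one_smul]
    abel

/-- Every element of the completion is a convergent series with coefficients in the algebra; this is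
what makes linear maps on completions determined by their values on the algebra. -/
theorem eq_evalH_of (w : HCompl A) : ∃ f : ℕ → A, w = evalH fun m => of A (f m) := by
  obtain ⟨f, hf⟩ := exists_eq_hPow_smul_evalH 0 w (quot_zero_eq_zero _)
  exact ⟨f, by simpa using hf⟩

/-- Linear maps between completions are `h`-adically continuous. -/
theorem map_evalH (φ : HCompl A →ₗ[Kh] HCompl B) (f : ℕ → HCompl A) :
    φ (evalH f) = evalH fun m => φ (f m) := by
  ext N
  rw [evalH_eq_sum_add f N, map_add, map_add, map_smul, proj_hPow_smul le_rfl, add_zero,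
    proj_evalH, map_sum, map_sum]
  simp only [map_smul]

theorem algHom_evalH (φ : HCompl A →ₐ[Kh] HCompl B) (f : ℕ → HCompl A) :
    φ (evalH f) = evalH fun m => φ (f m) := map_evalH φ.toLinearMap f

theorem linearMap_ext {φ ψ : HCompl A →ₗ[Kh] HCompl B} (h : ∀ a, φ (of A a) = ψ (of A a)) :
    φ = ψ := by
  ext1 w
  obtain ⟨f, rfl⟩ := eq_evalH_of w
  simp only [map_evalH, h]

theorem extendLin_of (f : A →ₗ[Kh] HCompl B) (a : A) : extendLin f (of A a) = f a := by
  ext N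
  exact quotLin_mk f N a

theorem map_of (f : A →ₐ[Kh] B) (a : A) : map f (of A a) = of B (f a) := extend_of _ _

theorem mapLin_of (f : A →ₗ[Kh] B) (a : A) : mapLin f (of A a) = of B (f a) := extendLin_of _ _

end

end HCompl

/-! ### Complete algebras -/

/-- The algebra `C` is separated and complete for the `h`-adic topology. -/
structure IsHComplete (C : Type) [Ring C] [Algebra Kh C] : Prop where
  eq_zero : ∀ c : C, (∀ N : ℕ, ∃ b : C, c = hh ^ N • b) → c = 0
  exists_sum : ∀ f : ℕ → C, ∃ c : C, ∀ N : ℕ, ∃ b : C,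
    c = ∑ m ∈ Finset.range N, hh ^ m • f m + hh ^ N • b

namespace IsHComplete

variable {A C : Type} [Ring A] [Algebra Kh A] [Ring C] [Algebra Kh C]

theorem hCompl : IsHComplete (HCompl A) where
  eq_zero c hc := by
    ext N
    obtain ⟨b, rfl⟩ := hc N
    rw [HCompl.proj_hPow_smul le_rfl, map_zero]
  exists_sum f := ⟨HCompl.evalH f, fun N => ⟨_, HCompl.evalH_eq_sum_add f N⟩⟩

theorem op (hC : IsHComplete C) : IsHComplete Cᵐᵒᵖ where
  eq_zero c hc := by
    refine MulOpposite.unop_injective (hC.eq_zero _ fun N => ?_)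
    obtain ⟨b, rfl⟩ := hc N
    exact ⟨b.unop, rfl⟩
  exists_sum f := by
    obtain ⟨c, hc⟩ := hC.exists_sum fun m => (f m).unop
    refine ⟨MulOpposite.op c, fun N => ?_⟩
    obtain ⟨b, hb⟩ := hc N
    refine ⟨MulOpposite.op b, MulOpposite.unop_injective ?_⟩
    simpa using hb

theorem base : IsHComplete Kh where
  eq_zero c hc := by
    ext m
    obtain ⟨b, rfl⟩ := hc (m + 1)
    rw [smul_eq_mul, PowerSeries.coeff_X_pow_mul', if_neg (by omega), map_zero]
  exists_sum f := by
    -- the coefficients of `∑ m, h ^ m f_m` are finite sums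
    refine ⟨PowerSeries.mk fun k => ∑ m ∈ Finset.range (k + 1), PowerSeries.coeff (k - m) (f m),
      fun N => ?_⟩
    have : (PowerSeries.X : Kh) ^ N ∣
        PowerSeries.mk (fun k => ∑ m ∈ Finset.range (k + 1), PowerSeries.coeff (k - m) (f m))
          - ∑ m ∈ Finset.range N, hh ^ m • f m := by
      rw [PowerSeries.X_pow_dvd_iff]
      intro k hk
      rw [map_sub, map_sum, PowerSeries.coeff_mk, sub_eq_zero]
      simp only [smul_eq_mul, PowerSeries.coeff_X_pow_mul']
      rw [← Finset.sum_filter]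
      refine Finset.sum_congr ?_ fun _ _ => rfl
      ext m
      simp only [Finset.mem_range, Finset.mem_filter]
      omega
    obtain ⟨b, hb⟩ := this
    exact ⟨b, by rw [smul_eq_mul, ← hb]; ring⟩

theorem bijective_of (hC : IsHComplete C) : Function.Bijective (HCompl.of C) := by
  constructor
  · rw [injective_iff_map_eq_zero]
    intro c hc
    refine hC.eq_zero c fun N => ?_
    have : HCompl.proj C N (HCompl.of C c) = 0 := by rw [hc, map_zero]
    exact Ideal.Quotient.eq_zero_iff_mem.1 this
  · intro w
    obtain ⟨f, rfl⟩ := HCompl.eq_evalH_of w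
    obtain ⟨c, hc⟩ := hC.exists_sum f
    refine ⟨c, ?_⟩
    ext N
    obtain ⟨b, hb⟩ := hc N
    rw [hb, HCompl.evalH_eq_sum_add _ N, map_add, map_add, map_add, map_smul,
      HCompl.proj_hPow_smul le_rfl, HCompl.proj_hPow_smul le_rfl, map_sum]
    simp only [map_smul]

/-- A complete algebra is its own completion. -/
def equiv (hC : IsHComplete C) : C ≃ₐ[Kh] HCompl C :=
  AlgEquiv.ofBijective (HCompl.of C) hC.bijective_of

theorem equiv_symm_of (hC : IsHComplete C) (c : C) : hC.equiv.symm (HCompl.of C c) = c :=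
  hC.equiv.symm_apply_apply c

end IsHComplete

/-! ### Scalars -/

theorem qPow_add (a b : ℂ) : qPow (a + b) = qPow a * qPow b := by
  rw [qPow, qPow, qPow, PowerSeries.exp_mul_exp_eq_exp_add, add_div]

theorem qPow_zero : qPow 0 = 1 := by
  ext m
  cases m <;> simp [qPow]

theorem qPow_mul_qPow_neg (a : ℂ) : qPow a * qPow (-a) = 1 := by
  rw [← qPow_add, add_neg_cancel, qPow_zero]

theorem constantCoeff_qPow (a : ℂ) : PowerSeries.constantCoeff (qPow a) = 1 := by
  rw [← PowerSeries.coeff_zero_eq_constantCoeff_apply]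
  simp [qPow, PowerSeries.coeff_rescale]

theorem qPow_nat_mul (m : ℕ) (a : ℂ) : qPow (m * a) = qPow a ^ m := by
  induction m with
  | zero => simp [qPow_zero]
  | succ m ih => rw [pow_succ, ← ih, ← qPow_add]; congr 1; push_cast; ring

/-- The unsymmetric quantum integer `1 + q⁻² + ⋯ + q ^ (- 2 (m - 1)) = q ^ (1 - m) [m]`. -/
def qNum (m : ℕ) : Kh := ∑ i ∈ Finset.range m, qPow (-2) ^ i

theorem qNum_succ (m : ℕ) : qNum (m + 1) = qNum m + qPow (-2) ^ m :=
  Finset.sum_range_succ _ _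

theorem qNum_succ' (m : ℕ) : qNum (m + 1) = 1 + qPow (-2) * qNum m := by
  rw [qNum, Finset.sum_range_succ', qNum, Finset.mul_sum, pow_zero, add_comm]
  simp only [pow_succ']

theorem qNum_add (i j : ℕ) : qNum (i + j) = qNum i + qPow (-2) ^ i * qNum j := by
  induction j with
  | zero => simp [qNum]
  | succ j ih => rw [← add_assoc, qNum_succ, ih, qNum_succ, pow_add]; ring

theorem constantCoeff_qNum (m : ℕ) : PowerSeries.constantCoeff (qNum m) = m := by
  simp [qNum, constantCoeff_qPow]

theorem isUnit_qNum_succ (m : ℕ) : IsUnit (qNum (m + 1)) := by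
  rw [PowerSeries.isUnit_iff_constantCoeff, constantCoeff_qNum, isUnit_iff_ne_zero]
  exact Nat.cast_ne_zero.2 (Nat.succ_ne_zero m)

theorem qPow_one_sub_ne_zero : qPow 1 - qPow (-1) ≠ 0 := by
  rw [← hh_mul_qDiff]
  refine mul_ne_zero PowerSeries.X_ne_zero fun h => ?_
  have := qDiff_mul_inv
  rw [h, zero_mul] at this
  exact zero_ne_one this

theorem qInt_succ (m : ℕ) : qInt (m + 1) = qPow m * qNum (m + 1) := by
  refine mul_right_cancel₀ qPow_one_sub_ne_zero ?_
  rw [qInt_mul]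
  have h1 : qNum (m + 1) * (qPow (-2) - 1) = qPow (-2) ^ (m + 1) - 1 := geom_sum_mul _ _
  have h2 : qPow 1 - qPow (-1) = - (qPow 1 * (qPow (-2) - 1)) := by
    rw [mul_sub, ← qPow_add]; norm_num
  calc qPow (m + 1 : ℕ) - qPow (-(m + 1 : ℕ))
      = -(qPow m * qPow 1 * (qPow (-2) ^ (m + 1) - 1)) := by
        rw [← qPow_add, ← qPow_nat_mul, mul_sub, ← qPow_add, mul_one, neg_sub]
        push_cast
        ring_nf
    _ = _ := by rw [← h1, h2]; ring

/-- The coefficients of `Exp_q`. -/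
def qCoeff (m : ℕ) : Kh := qPow ((m : ℂ) * ((m : ℂ) - 1) / 2) * (qFactorial m)⁻¹

theorem qCoeff_zero : qCoeff 0 = 1 := by
  simp [qCoeff, qFactorial, qPow_zero]

/-- The recursion for the coefficients of `Exp_q`, which characterizes `Exp_q` as a `q`-exponential.
-/
theorem qNum_mul_qCoeff (m : ℕ) : qNum (m + 1) * qCoeff (m + 1) = qCoeff m := by
  have h0 : PowerSeries.constantCoeff (qInt (m + 1)) ≠ 0 := by
    rw [qInt_succ, map_mul, constantCoeff_qPow, constantCoeff_qNum, one_mul]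
    exact Nat.cast_ne_zero.2 (Nat.succ_ne_zero m)
  have h1 : qPow (((m + 1 : ℕ) : ℂ) * (((m + 1 : ℕ) : ℂ) - 1) / 2)
      = qPow m * qPow ((m : ℂ) * ((m : ℂ) - 1) / 2) := by
    rw [← qPow_add]; congr 1; push_cast; ring
  have h2 := PowerSeries.inv_mul_cancel _ h0
  rw [qCoeff, h1, qFactorial, Finset.prod_range_succ, PowerSeries.mul_inv_rev, ← qFactorial, qCoeff]
  calc _ = ((qInt (m + 1))⁻¹ * (qPow m * qNum (m + 1))) *
        (qPow ((m : ℂ) * ((m : ℂ) - 1) / 2) * (qFactorial m)⁻¹) := by ring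
    _ = _ := by rw [← qInt_succ, h2, one_mul]

theorem coeff_qDiff (m : ℕ) : PowerSeries.coeff m qDiff =
    (1 / 2 : ℂ) ^ (m + 1) / ((m + 1).factorial : ℂ)
      - (-1 / 2 : ℂ) ^ (m + 1) / ((m + 1).factorial : ℂ) := by
  simp [qDiff, hDiv, qPow, PowerSeries.coeff_rescale, PowerSeries.coeff_exp, div_eq_mul_inv]

/-! ### Exponentials, `q`-exponentials and quantum brackets -/

namespace HCompl

variable {A B : Type} [Ring A] [Algebra Kh A] [Ring B] [Algebra Kh B]

theorem map_hSeries (φ : HCompl A →ₐ[Kh] HCompl B) (c : ℕ → Kh) (z : HCompl A) :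
    φ (hSeries c z) = hSeries c (φ z) := by
  simp only [hSeries_eq, algHom_evalH, map_smul, map_pow]

theorem map_hExp (φ : HCompl A →ₐ[Kh] HCompl B) (c : ℂ) (z : HCompl A) :
    φ (hExp c z) = hExp c (φ z) := map_hSeries _ _ _

theorem map_hQExp (φ : HCompl A →ₐ[Kh] HCompl B) (z : HCompl A) :
    φ (hQExp z) = hQExp (φ z) := map_hSeries _ _ _

theorem map_qBracket (φ : HCompl A →ₐ[Kh] HCompl B) (z : HCompl A) :
    φ (qBracket z) = qBracket (φ z) := by
  simp only [qBracket, map_smul, map_mul, map_hSeries]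

theorem hSeries_semiconj (c : ℕ → Kh) {x a b : HCompl A} (h : SemiconjBy x a b) :
    SemiconjBy x (hSeries c a) (hSeries c b) := by
  rw [SemiconjBy, hSeries_eq, hSeries_eq, mul_evalH, evalH_mul_right]
  congr 1
  ext1 m
  rw [mul_smul_comm, smul_mul_assoc, (h.pow_right m).eq]

theorem hExp_semiconj (c : ℂ) {x a b : HCompl A} (h : SemiconjBy x a b) :
    SemiconjBy x (hExp c a) (hExp c b) := hSeries_semiconj _ h

theorem hExp_commute (c : ℂ) {x a : HCompl A} (h : Commute x a) :
    Commute x (hExp c a) := hSeries_semiconj _ h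

theorem hQExp_semiconj {x a b : HCompl A} (h : SemiconjBy x a b) :
    SemiconjBy x (hQExp a) (hQExp b) := hSeries_semiconj _ h

/-- A series with constant term `1` is inverted formally, over the noncommutative ring of power
series with coefficients `c m • z ^ m`, and the inverse is then evaluated. -/
theorem isUnit_hSeries (c : ℕ → Kh) (h0 : c 0 = 1) (z : HCompl A) : IsUnit (hSeries c z) := by
  set F : PowerSeries (HCompl A) := PowerSeries.mk fun m => c m • z ^ m with hF
  have hF0 : PowerSeries.constantCoeff F = ((1 : (HCompl A)ˣ) : HCompl A) := by
    rw [← PowerSeries.coeff_zero_eq_constantCoeff_apply, hF, PowerSeries.coeff_mk]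
    simp [h0]
  have hev : ∀ G K : PowerSeries (HCompl A), G * K = 1 →
      evalH (fun m => PowerSeries.coeff m G) * evalH (fun m => PowerSeries.coeff m K) = 1 := by
    intro G K h
    rw [evalH_mul]
    simp only [← PowerSeries.coeff_mul, h]
    rw [evalH_eq_head_add]
    have : (fun m => PowerSeries.coeff (m + 1) (1 : PowerSeries (HCompl A))) =
      fun _ => (0 : HCompl A) * 0 := by
      ext1 m
      simp [PowerSeries.coeff_one]
    rw [this, ← mul_evalH]
    simp
  have hz : hSeries c z = evalH fun m => PowerSeries.coeff m F := by
    rw [hSeries_eq, hF]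
    simp only [PowerSeries.coeff_mk]
  rw [hz]
  exact ⟨⟨_, _, hev _ _ (PowerSeries.mul_invOfUnit F 1 hF0),
    hev _ _ (PowerSeries.invOfUnit_mul F 1 hF0)⟩, rfl⟩

theorem isUnit_hQExp (z : HCompl A) : IsUnit (hQExp z) :=
  isUnit_hSeries _ qCoeff_zero z

theorem hExp_coeff_add {a b : HCompl A} (h : Commute a b) (c : ℂ) (m : ℕ) :
    (PowerSeries.C (c ^ m / (m.factorial : ℂ)) : Kh) • (a + b) ^ m =
      ∑ ij ∈ Finset.HasAntidiagonal.antidiagonal m,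
        ((PowerSeries.C (c ^ ij.1 / (ij.1.factorial : ℂ)) : Kh) • a ^ ij.1) *
        ((PowerSeries.C (c ^ ij.2 / (ij.2.factorial : ℂ)) : Kh) • b ^ ij.2) := by
  rw [h.add_pow', Finset.smul_sum]
  refine Finset.sum_congr rfl fun ij hij => ?_
  rw [Finset.HasAntidiagonal.mem_antidiagonal] at hij
  rw [smul_mul_smul_comm, ← map_mul, ← Nat.cast_smul_eq_nsmul Kh, smul_smul]
  congr 1
  rw [← map_natCast (PowerSeries.C (R := ℂ)), ← map_mul, ← hij,
    Nat.cast_choose ℂ (Nat.le_add_right ij.1 ij.2), Nat.add_sub_cancel_left, pow_add]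
  congr 1
  have h1 := Nat.cast_ne_zero (R := ℂ) |>.2 (Nat.factorial_ne_zero (ij.1 + ij.2))
  have h2 := Nat.cast_ne_zero (R := ℂ) |>.2 (Nat.factorial_ne_zero ij.1)
  have h3 := Nat.cast_ne_zero (R := ℂ) |>.2 (Nat.factorial_ne_zero ij.2)
  field_simp

theorem hExp_add {a b : HCompl A} (h : Commute a b) (c : ℂ) :
    hExp c (a + b) = hExp c a * hExp c b := by
  rw [hExp, hExp, hExp, hSeries_eq, hSeries_eq, hSeries_eq, evalH_mul]
  congr 1
  ext1 m
  exact hExp_coeff_add h c m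

theorem hExp_C_smul (c d : ℂ) (z : HCompl A) :
    hExp c ((PowerSeries.C d : Kh) • z) = hExp (c * d) z := by
  rw [hExp, hExp, hSeries_eq, hSeries_eq]
  congr 1
  ext1 m
  rw [smul_pow, smul_smul, ← map_pow, ← map_mul, mul_pow, div_mul_eq_mul_div]

theorem hExp_zero (c : ℂ) : hExp c (0 : HCompl A) = 1 := by
  rw [hExp, hSeries_eq, evalH_eq_head_add]
  have : (fun m => (PowerSeries.C (c ^ (m + 1) / ((m + 1).factorial : ℂ)) : Kh) •
      (0 : HCompl A) ^ (m + 1)) = fun _ => (0 : HCompl A) * 0 := by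
    ext1 m; simp
  rw [this, ← mul_evalH]
  simp

theorem hExp_eq_one_smul (c : ℂ) (z : HCompl A) :
    hExp c z = hExp 1 ((PowerSeries.C c : Kh) • z) := by rw [hExp_C_smul, one_mul]

theorem hExp_mul_hExp (c d : ℂ) (z : HCompl A) : hExp c z * hExp d z = hExp (c + d) z := by
  rw [hExp_eq_one_smul c, hExp_eq_one_smul d, hExp_eq_one_smul (c + d), map_add, add_smul, hExp_add]
  exact ((Commute.refl z).smul_left _).smul_right _

theorem hExp_zero_left (z : HCompl A) : hExp 0 z = 1 := by
  rw [hExp_eq_one_smul, map_zero, zero_smul, hExp_zero]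

theorem hExp_mul_hExp_neg (c : ℂ) (z : HCompl A) : hExp c z * hExp (-c) z = 1 := by
  rw [hExp_mul_hExp, add_neg_cancel, hExp_zero_left]

theorem isUnit_hExp (c : ℂ) (z : HCompl A) : IsUnit (hExp c z) :=
  isUnit_hSeries _ (by simp) z

theorem evalH_C_smul_one (s : ℕ → ℂ) :
    (evalH fun m => (PowerSeries.C (s m) : Kh) • (1 : HCompl A)) = PowerSeries.mk s • 1 := by
  ext N
  have : (PowerSeries.X : Kh) ^ N ∣
      PowerSeries.mk s - ∑ m ∈ Finset.range N, hh ^ m • PowerSeries.C (s m) := by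
    rw [PowerSeries.X_pow_dvd_iff]
    intro k hk
    rw [map_sub, map_sum, PowerSeries.coeff_mk, sub_eq_zero]
    simp only [smul_eq_mul, PowerSeries.coeff_X_pow_mul', PowerSeries.coeff_C]
    rw [Finset.sum_eq_single_of_mem k (by simpa using hk)]
    · simp
    · intro m _ hm
      split_ifs <;> first | rfl | omega
  obtain ⟨b, hb⟩ := this
  rw [sub_eq_iff_eq_add'] at hb
  rw [hb, add_smul, map_add, mul_smul, proj_hPow_smul le_rfl, add_zero, proj_evalH, Finset.sum_smul,
    map_sum]
  simp only [smul_assoc, map_smul]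

theorem hExp_C_smul_one (c d : ℂ) :
    hExp c ((PowerSeries.C d : Kh) • (1 : HCompl A)) = qPow (2 * c * d) • 1 := by
  rw [hExp_C_smul, hExp, hSeries_eq]
  simp only [one_pow]
  rw [evalH_C_smul_one]
  congr 1
  ext m
  rw [PowerSeries.coeff_mk, qPow, PowerSeries.coeff_rescale, PowerSeries.coeff_exp]
  rw [show 2 * c * d / 2 = c * d by ring]
  simp [div_eq_mul_inv]

/-- If `[a, x] = d x` then `exp (c h a)` and `x` commute up to the scalar `q ^ (2 c d)`. -/
theorem hExp_mul_of_commutator (c d : ℂ) {a x : HCompl A}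
    (h : a * x - x * a = (PowerSeries.C d : Kh) • x) :
    hExp c a * x = qPow (2 * c * d) • (x * hExp c a) := by
  have h1 : SemiconjBy x (a + (PowerSeries.C d : Kh) • (1 : HCompl A)) a := by
    rw [SemiconjBy, mul_add, mul_smul_comm, mul_one, ← h]
    abel
  have h2 := (hExp_semiconj c h1).eq
  rw [hExp_add (((Commute.one_right a).smul_right _)), hExp_C_smul_one, mul_smul_comm, mul_one,
    mul_smul_comm] at h2
  exact h2.symm

theorem qBracket_eq (z : HCompl A) : qBracket z = qDiff⁻¹ • evalH fun m =>
    (PowerSeries.C (PowerSeries.coeff m qDiff) : Kh) • z ^ (m + 1) := by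
  rw [qBracket, hSeries_eq, mul_evalH]
  simp only [mul_smul_comm, ← pow_succ']

/-- A linear map that is compatible with the powers of one element, such as an anti-homomorphism,
commutes with the formation of quantum brackets of that element. -/
theorem map_qBracket_of_pow (ψ : HCompl A →ₗ[Kh] HCompl B) {z : HCompl A} {w : HCompl B}
    (h : ∀ m, ψ (z ^ m) = w ^ m) : ψ (qBracket z) = qBracket w := by
  rw [qBracket_eq, qBracket_eq, map_smul, map_evalH]
  simp only [map_smul, h]

theorem qBracket_neg (z : HCompl A) : qBracket (-z) = -qBracket z := by
  have hz : -z = (PowerSeries.C (-1) : Kh) • z := by rw [map_neg, map_one, neg_one_smul]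
  rw [qBracket_eq, qBracket_eq, ← smul_neg, ← neg_one_smul Kh (evalH _), smul_evalH (-1), hz]
  congr 1
  congr 1
  ext1 m
  rw [smul_pow, smul_smul, smul_smul, ← map_pow, ← map_mul, ← map_one (PowerSeries.C (R := ℂ)),
    ← map_neg, ← map_mul, coeff_qDiff, show (-1 / 2 : ℂ) = (-1) * (1 / 2) by ring, mul_pow]
  have h : ((-1 : ℂ) ^ (m + 1)) * (-1 : ℂ) ^ (m + 1) = 1 := by
    rw [← mul_pow]; norm_num
  congr 2
  linear_combination (-(1 / 2 : ℂ) ^ (m + 1) / ((m + 1).factorial : ℂ)) * h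

theorem qBracket_zero : qBracket (0 : HCompl A) = 0 := by
  rw [qBracket, zero_mul, smul_zero]

/-- The coproduct rule for quantum brackets. The denominator `q - q⁻¹` is a multiple of `h` and
cannot be cancelled, because completions may have `h`-torsion; so the identity is proved coefficient
by coefficient. -/
theorem qBracket_add {a b : HCompl A} (h : Commute a b) :
    qBracket (a + b) = qBracket a * hExp (1 / 2) b + hExp (-1 / 2) a * qBracket b := by
  rw [qBracket_eq, qBracket_eq, qBracket_eq, smul_mul_assoc, mul_smul_comm, ← smul_add, hExp, hExp,
    hSeries_eq, hSeries_eq, evalH_mul, evalH_mul, evalH_add]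
  congr 2
  ext1 m
  have hd : ∀ (k : ℕ) (z : HCompl A),
      (PowerSeries.C (PowerSeries.coeff k qDiff) : Kh) • z ^ (k + 1) =
      (PowerSeries.C ((1 / 2) ^ (k + 1) / ((k + 1).factorial : ℂ)) : Kh) • z ^ (k + 1)
      - (PowerSeries.C ((-1 / 2) ^ (k + 1) / ((k + 1).factorial : ℂ)) : Kh) • z ^ (k + 1) := by
    intro k z
    rw [← sub_smul, ← map_sub, ← coeff_qDiff]
  -- with `e c k z` the term of degree `k` of `exp (c h z)`, telescope the coefficient of degree
  -- `m + 1` in `exp (h (a + b) / 2) - exp (- h (a + b) / 2)`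
  set e : ℂ → ℕ → HCompl A → HCompl A :=
    fun c k z => (PowerSeries.C (c ^ k / (k.factorial : ℂ)) : Kh) • z ^ k with he
  have he0 : ∀ c z, e c 0 z = 1 := by intro c z; simp [he]
  have hsplit : ∑ ij ∈ Finset.HasAntidiagonal.antidiagonal (m + 1),
        (e (1 / 2) ij.1 a * e (1 / 2) ij.2 b - e (-1 / 2) ij.1 a * e (-1 / 2) ij.2 b) =
      ∑ ij ∈ Finset.HasAntidiagonal.antidiagonal (m + 1),
        (e (1 / 2) ij.1 a - e (-1 / 2) ij.1 a) * e (1 / 2) ij.2 b +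
      ∑ ij ∈ Finset.HasAntidiagonal.antidiagonal (m + 1),
        e (-1 / 2) ij.1 a * (e (1 / 2) ij.2 b - e (-1 / 2) ij.2 b) := by
    rw [← Finset.sum_add_distrib]
    refine Finset.sum_congr rfl fun ij _ => ?_
    rw [sub_mul, mul_sub]
    abel
  rw [hd, hExp_coeff_add h, hExp_coeff_add h, ← Finset.sum_sub_distrib]
  refine hsplit.trans ?_
  rw [Finset.Nat.sum_antidiagonal_succ, Finset.Nat.sum_antidiagonal_succ', he0, he0, he0, he0,
    sub_self, zero_mul, mul_zero, zero_add, zero_add]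
  simp only [hd]
  rfl

theorem hQExp_eq (z : HCompl A) : hQExp z = evalH fun m => qCoeff m • z ^ m := hSeries_eq _ _

/-- The `q`-binomial theorem, as a multiplication rule for `q`-exponentials. -/
theorem hQExp_add {a b : HCompl A} (h : b * a = qPow (-2) • (a * b)) :
    hQExp (a + b) = hQExp a * hQExp b := by
  have hpow : ∀ m, b * a ^ m = qPow (-2) ^ m • (a ^ m * b) := by
    intro m
    induction m with
    | zero => simp
    | succ m ih =>
      rw [pow_succ a, ← mul_assoc, ih, smul_mul_assoc, mul_assoc, h, mul_smul_comm, smul_smul,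
        ← pow_succ, mul_assoc]
  rw [hQExp_eq, hQExp_eq, hQExp_eq, evalH_mul]
  congr 1
  ext1 m
  induction m with
  | zero => simp [qCoeff_zero]
  | succ m ih =>
    obtain ⟨u, hu⟩ := isUnit_qNum_succ m
    have hinj : ∀ x y : HCompl A, qNum (m + 1) • x = qNum (m + 1) • y → x = y := by
      intro x y hxy
      rw [← hu] at hxy
      simpa [smul_smul] using congrArg (fun t => ((u⁻¹ : Khˣ) : Kh) • t) hxy
    apply hinj
    rw [smul_smul, qNum_mul_qCoeff, pow_succ', ← mul_smul_comm, ih, add_mul, Finset.mul_sum,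
      Finset.mul_sum, Finset.smul_sum]
    -- `[i + j]` is split as in `qNum_add`, which gives one sum for each of `a` and `b`
    have hsplit : ∀ ij ∈ Finset.HasAntidiagonal.antidiagonal (m + 1),
        qNum (m + 1) • (qCoeff ij.1 • a ^ ij.1 * qCoeff ij.2 • b ^ ij.2) =
        (qNum ij.1 * qCoeff ij.1 * qCoeff ij.2) • (a ^ ij.1 * b ^ ij.2) +
        (qPow (-2) ^ ij.1 * qCoeff ij.1 * (qNum ij.2 * qCoeff ij.2)) • (a ^ ij.1 * b ^ ij.2) := by
      intro ij hij
      rw [Finset.HasAntidiagonal.mem_antidiagonal] at hij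
      rw [← hij, qNum_add, smul_mul_smul_comm, smul_smul, ← add_smul]
      congr 1
      ring
    rw [Finset.sum_congr rfl hsplit, Finset.sum_add_distrib]
    congr 1
    · rw [Finset.Nat.sum_antidiagonal_succ]
      simp only [qNum, Finset.range_zero, Finset.sum_empty, zero_mul, zero_smul,
        zero_add]
      refine Finset.sum_congr rfl fun ij _ => ?_
      rw [← qNum, qNum_mul_qCoeff, smul_mul_smul_comm, mul_smul_comm, ← mul_assoc, pow_succ']
    · rw [Finset.Nat.sum_antidiagonal_succ']
      simp only [qNum, Finset.range_zero, Finset.sum_empty, zero_mul, mul_zero, zero_smul,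
        zero_add]
      refine Finset.sum_congr rfl fun ij _ => ?_
      rw [← qNum, qNum_mul_qCoeff, smul_mul_smul_comm, mul_smul_comm, ← mul_assoc, hpow,
        smul_mul_assoc, smul_smul, mul_assoc (a ^ ij.1), ← pow_succ']
      congr 1
      ring

/-- Commutation of a `q`-exponential with an element `u`, when the commutator of `z` and `u` is a
sum of two terms that commute with `z` up to `q²` and `q⁻²`. The commutator is multiplied by `h`
because `hQExp z` stands for `Exp_q (h z)`, and no division by `h` is possible. -/
theorem hQExp_mul_sub {z u d₁ d₂ : HCompl A} (h : hh • (z * u - u * z) = d₁ + d₂)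
    (h₁ : d₁ * z = qPow (-2) • (z * d₁)) (h₂ : z * d₂ = qPow (-2) • (d₂ * z)) :
    hQExp z * (u - d₁) = (u + d₂) * hQExp z := by
  have key : ∀ m, hh • (z ^ (m + 1) * u - u * z ^ (m + 1)) =
      qNum (m + 1) • (z ^ m * d₁ + d₂ * z ^ m) := by
    intro m
    induction m with
    | zero => simpa [qNum] using h
    | succ m ih =>
      have hd : d₁ * z ^ (m + 1) = qPow (-2) ^ (m + 1) • (z ^ (m + 1) * d₁) := by
        clear ih
        induction m with
        | zero => simpa using h₁
        | succ m ih =>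
          rw [pow_succ z, ← mul_assoc, ih, smul_mul_assoc, mul_assoc, h₁, mul_smul_comm, smul_smul,
            ← pow_succ, mul_assoc]
      have hstep : hh • (z ^ (m + 1 + 1) * u - u * z ^ (m + 1 + 1)) =
          z * hh • (z ^ (m + 1) * u - u * z ^ (m + 1)) + hh • (z * u - u * z) * z ^ (m + 1) := by
        rw [mul_smul_comm, smul_mul_assoc, ← smul_add]
        congr 1
        rw [pow_succ' z (m + 1)]
        noncomm_ring
      rw [hstep, ih, h, add_mul, hd, mul_smul_comm, mul_add, ← mul_assoc, ← mul_assoc, h₂,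
        smul_mul_assoc, mul_assoc d₂, ← pow_succ', smul_add, smul_add, smul_smul]
      have e1 : qNum (m + 1 + 1) • (d₂ * z ^ (m + 1)) =
          (qNum (m + 1) * qPow (-2)) • (d₂ * z ^ (m + 1)) + d₂ * z ^ (m + 1) := by
        rw [qNum_succ', add_smul, one_smul, add_comm, mul_comm]
      rw [e1, qNum_succ (m + 1), add_smul]
      abel
  have h3 : hQExp z = 1 + hh • evalH fun m => qCoeff (m + 1) • z ^ (m + 1) := by
    rw [hQExp_eq, evalH_eq_head_add, qCoeff_zero, pow_zero, one_smul]
  have h4 : hQExp z * u + (-1 : Kh) • (u * hQExp z) = d₂ * hQExp z + hQExp z * d₁ := by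
    rw [h3, add_mul, mul_add, one_mul, mul_one, smul_mul_assoc, mul_smul_comm, smul_add,
      add_add_add_comm, neg_one_smul, add_neg_cancel, zero_add, smul_comm, ← smul_add,
      evalH_mul_right, mul_evalH, smul_evalH, evalH_add, smul_evalH, ← h3, hQExp_eq,
      evalH_mul_right, mul_evalH, evalH_add]
    congr 1
    ext1 m
    have h5 := key m
    rw [smul_mul_assoc, mul_smul_comm, smul_comm (-1 : Kh), ← smul_add, neg_one_smul,
      ← sub_eq_add_neg, smul_comm, h5, smul_smul, mul_comm, qNum_mul_qCoeff, mul_smul_comm,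
      smul_mul_assoc, ← smul_add, add_comm]
  rw [neg_one_smul, ← sub_eq_add_neg] at h4
  rw [mul_sub, add_mul, sub_eq_iff_eq_add, add_assoc, ← sub_eq_iff_eq_add', h4]

end HCompl

/-! ### Root vectors in algebras with Serre relations -/

section RootVectors

variable {K T : Type} [CommRing K] [Ring T] [Algebra K T] {q p : K}

variable (q p) in
/-- The scalars `q` and `p` are inverse to each other, and `2` and `1 + q²` are invertible. -/
structure IsQParam : Prop where
  mul_eq_one : q * p = 1
  isUnit_two : IsUnit (2 : K)
  isUnit_one_add_sq : IsUnit (1 + q * q)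

variable (q p) in
/-- A family satisfying the quantum Serre relations of type `A`, where `p` stands for `q⁻¹`. -/
structure IsSerre (e : ℕ → T) : Prop extends IsQParam q p where
  serre : ∀ i j, i + 1 = j ∨ j + 1 = i →
    e i ^ 2 * e j - (q + p) • (e i * e j * e i) + e j * e i ^ 2 = 0
  comm : ∀ i j, i + 1 < j → Commute (e i) (e j)

variable (p) in
/-- The root vector of the segment `a, …, a + d`. -/
def rv (e : ℕ → T) : ℕ → ℕ → T
  | a, 0 => e a
  | a, d + 1 => e a * rv e (a + 1) d - p • (rv e (a + 1) d * e a)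

theorem IsSerre.comm' {e : ℕ → T} (he : IsSerre q p e) {i j : ℕ} (hij : i + 1 < j ∨ j + 1 < i) :
    Commute (e i) (e j) :=
  hij.elim (he.comm i j) fun h => (he.comm j i h).symm

theorem commute_rv {e : ℕ → T} {x : T} {a d : ℕ} (hx : ∀ i, a ≤ i → i ≤ a + d → Commute x (e i)) :
    Commute x (rv p e a d) := by
  induction d generalizing a with
  | zero => exact hx a le_rfl le_rfl
  | succ d ih =>
    have h1 := hx a le_rfl (by omega)
    have h2 : Commute x (rv p e (a + 1) d) := ih fun i h1 h2 => hx i (by omega) (by omega)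
    exact (h1.mul_right h2).sub_right ((h2.mul_right h1).smul_right _)

theorem smul_cancel_of_isUnit {c : K} (hc : IsUnit c) {x y : T} (h : c • x = c • y) : x = y := by
  obtain ⟨u, rfl⟩ := hc
  simpa [smul_smul] using congrArg (fun t => ((u⁻¹ : Kˣ) : K) • t) h

/-- The elements `x` and `y` commute up to the scalar `c`. -/
def QComm (c : K) (x y : T) : Prop := x * y = c • (y * x)

namespace QComm

variable {c d : K} {x y z : T}

theorem of_commute (h : Commute x y) : QComm (1 : K) x y := by rw [QComm, one_smul, h.eq]

theorem commute (h : QComm (1 : K) x y) : Commute x y := by rwa [QComm, one_smul] at h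

theorem mul_right (h : QComm c x y) (h' : QComm d x z) : QComm (c * d) x (y * z) := by
  rw [QComm] at *
  rw [← mul_assoc, h, smul_mul_assoc, mul_assoc, h', mul_smul_comm, smul_smul, mul_assoc]

theorem mul_left (h : QComm c x z) (h' : QComm d y z) : QComm (c * d) (x * y) z := by
  rw [QComm] at *
  rw [mul_assoc, h', mul_smul_comm, ← mul_assoc, h, smul_mul_assoc, smul_smul, mul_assoc,
    mul_comm c]

theorem smul_right (r : K) (h : QComm c x y) : QComm c x (r • y) := by
  rw [QComm] at *
  rw [mul_smul_comm, h, smul_mul_assoc, smul_comm]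

theorem smul_left (r : K) (h : QComm c x y) : QComm c (r • x) y := by
  rw [QComm] at *
  rw [mul_smul_comm, smul_mul_assoc, h, smul_comm]

theorem sub_right (h : QComm c x y) (h' : QComm c x z) : QComm c x (y - z) := by
  rw [QComm] at *
  rw [mul_sub, sub_mul, h, h', smul_sub]

theorem sub_left (h : QComm c x z) (h' : QComm c y z) : QComm c (x - y) z := by
  rw [QComm] at *
  rw [mul_sub, sub_mul, h, h', smul_sub]

theorem symm (hcd : c * d = 1) (h : QComm c x y) : QComm d y x := by
  rw [QComm] at *
  rw [h, smul_smul, mul_comm, hcd, one_smul]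

theorem bracket_right (r : K) (h : QComm c x y) (h' : QComm d x z) :
    QComm (c * d) x (y * z - r • (z * y)) :=
  (h.mul_right h').sub_right (by rw [mul_comm]; exact (h'.mul_right h).smul_right r)

theorem bracket_left (r : K) (h : QComm c x z) (h' : QComm d y z) :
    QComm (c * d) (x * y - r • (y * x)) z :=
  (h.mul_left h').sub_left (by rw [mul_comm]; exact (h'.mul_left h).smul_left r)

end QComm

/-- In the application `u`, `y`, `v` are the root vectors of three consecutive segments, the middle
one being a single vertex, `uy` and `yv` are those of the joined pairs, and `t` is that of the
union. The commutator of `uy` and `yv` can be expanded in two ways, through `yv` or through `uy`;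
together they show that a `1 + q²`-multiple of the commutator of `y` and `t` vanishes. -/
theorem interior_commute (hq : IsQParam q p) {u y v uy yv t : T}
    (h1 : u * y - p • (y * u) = uy)
    (h2 : y * v - p • (v * y) = yv) (h3 : uy * v - p • (v * uy) = t)
    (h4 : u * yv - p • (yv * u) = t) (h5 : uy * y = q • (y * uy))
    (h6 : y * yv = q • (yv * y)) : y * t = t * y := by
  have hqp := hq.mul_eq_one
  have e1 : u * y * yv - yv * (u * y) = q • (t * y) := by
    have e := congrArg (· * y) h4
    simp only [sub_mul, smul_mul_assoc, mul_assoc] at e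
    rw [mul_assoc, h6, ← e]
    simp only [mul_smul_comm]
    match_scalars <;> grind
  have e2 : uy * (y * v) - y * v * uy = q • (y * t) := by
    have e := congrArg (y * ·) h3
    simp only [mul_sub, mul_smul_comm] at e
    rw [← mul_assoc, h5, ← e]
    simp only [smul_mul_assoc, mul_assoc]
    match_scalars <;> grind
  have e3 : y * t - t * y = (q - p) • (u * y * yv - yv * (u * y)) - q • (uy * yv - yv * uy) := by
    rw [← h4, ← h1]
    have e := congrArg (u * ·) h6
    have e' := congrArg (· * u) h6
    simp only [mul_sub, sub_mul, smul_mul_assoc, mul_smul_comm, mul_assoc, smul_sub] at e e' ⊢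
    linear_combination (norm := skip) p • e - p • e'
    match_scalars <;> grind
  have e4 : y * t - t * y = (p - q) • (uy * (y * v) - y * v * uy) + q • (uy * yv - yv * uy) := by
    rw [← h3, ← h2]
    have e := congrArg (· * v) h5
    have e' := congrArg (v * ·) h5
    simp only [mul_sub, sub_mul, smul_mul_assoc, mul_smul_comm, mul_assoc, smul_sub] at e e' ⊢
    linear_combination (norm := skip) p • e' - p • e
    match_scalars <;> grind
  refine smul_cancel_of_isUnit hq.isUnit_one_add_sq ?_
  rw [e1] at e3
  rw [e2] at e4
  linear_combination (norm := skip) e3 + e4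
  match_scalars <;> grind

section

variable {e : ℕ → T} (he : IsSerre q p e)
include he

/-- A root vector can be built by splitting its segment at any place, not only after the first
vertex. -/
theorem IsSerre.rv_bracket (a c d : ℕ) :
    rv p e a c * rv p e (a + c + 1) d - p • (rv p e (a + c + 1) d * rv p e a c) =
      rv p e a (c + d + 1) := by
  induction c generalizing a with
  | zero => simp [rv]
  | succ c ih =>
    have h1 := ih (a + 1)
    rw [show a + 1 + c + 1 = a + (c + 1) + 1 by ring] at h1
    have h2 : e a * rv p e (a + (c + 1) + 1) d = rv p e (a + (c + 1) + 1) d * e a :=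
      (commute_rv fun i _ _ => he.comm' (by omega)).eq
    rw [show c + 1 + d + 1 = (c + d + 1) + 1 by ring, rv, rv, ← h1]
    generalize rv p e (a + (c + 1) + 1) d = Y at *
    generalize rv p e (a + 1) c = X at *
    have h3 := congrArg (X * ·) h2
    have h4 := congrArg (· * X) h2
    simp only [mul_sub, sub_mul, mul_smul_comm, smul_mul_assoc, mul_assoc, smul_sub] at h3 h4 ⊢
    linear_combination (norm := module) p • h4 - p • h3

theorem IsSerre.simple_mul_rv (a d : ℕ) : QComm q (e a) (rv p e a (d + 1)) := by
  have hqp := he.mul_eq_one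
  have h1 : QComm q (e a) (rv p e a 1) := by
    have h := he.serre a (a + 1) (by omega)
    rw [QComm]
    simp only [rv, mul_sub, sub_mul, mul_smul_comm, smul_mul_assoc, mul_assoc, pow_two] at h ⊢
    linear_combination (norm := skip) h
    match_scalars <;> grind
  cases d with
  | zero => exact h1
  | succ d =>
    have h2 := he.rv_bracket a 1 d
    have h3 : Commute (e a) (rv p e (a + 1 + 1) d) := commute_rv fun i _ _ => he.comm' (by omega)
    rw [show d + 1 + 1 = 1 + d + 1 by ring, ← h2]
    simpa using h1.bracket_right p (.of_commute h3)

theorem IsSerre.rv_mul_simple (a d : ℕ) :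
    QComm q (rv p e a (d + 1)) (e (a + d + 1)) := by
  have hqp := he.mul_eq_one
  have h1 : ∀ b, QComm q (rv p e b 1) (e (b + 1)) := by
    intro b
    have h := he.serre (b + 1) b (by omega)
    rw [QComm]
    simp only [rv, mul_sub, sub_mul, mul_smul_comm, smul_mul_assoc, mul_assoc, pow_two] at h ⊢
    linear_combination (norm := skip) h
    match_scalars <;> grind
  cases d with
  | zero => exact h1 a
  | succ d =>
    have h2 := he.rv_bracket a d 1
    have h3 : Commute (e (a + d + 1 + 1)) (rv p e a d) :=
      commute_rv fun i _ _ => he.comm' (by omega)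
    rw [← h2, ← add_assoc a]
    simpa using QComm.bracket_left p (.of_commute h3.symm) (h1 (a + d + 1))

/-- A simple root vector commutes with the root vector of a segment that contains its vertex in the
interior. -/
theorem IsSerre.simple_commute_rv {a i d : ℕ} (h1 : a < i) (h2 : i < a + d) :
    Commute (e i) (rv p e a d) := by
  obtain ⟨c, rfl⟩ := Nat.exists_eq_add_of_lt h1
  obtain ⟨f, rfl⟩ : ∃ f, d = c + 1 + f + 1 := ⟨d - (c + 2), by omega⟩
  have k1 := he.rv_bracket a c 0
  have k3 := he.rv_bracket a (c + 1) f
  have k4 := he.rv_bracket a c (f + 1)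
  have k5 := he.rv_mul_simple a c
  have k6 := he.simple_mul_rv (a + c + 1) f
  rw [show c + (f + 1) + 1 = c + 1 + f + 1 by ring] at k4
  exact interior_commute he.toIsQParam k1 rfl k3 k4 k5 k6

theorem IsSerre.rv_commute_nested {a c s d : ℕ} (h1 : a < s) (h2 : s + d < a + c) :
    Commute (rv p e a c) (rv p e s d) :=
  commute_rv fun _ h3 h4 => (he.simple_commute_rv (by omega) (by omega)).symm

theorem IsSerre.rv_mul_rv_row (a c d : ℕ) :
    QComm q (rv p e a c) (rv p e a (c + d + 1)) := by
  have h1 := he.simple_mul_rv a (c + d)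
  cases c with
  | zero => exact h1
  | succ c =>
    have h2 := he.rv_commute_nested (a := a) (c := c + 1 + d + 1) (s := a + 1) (d := c)
      (by omega) (by omega)
    have h3 := h1.bracket_left p (.of_commute h2.symm)
    rwa [mul_one] at h3

theorem IsSerre.rv_mul_rv_column (a c d : ℕ) :
    QComm q (rv p e a (c + d + 1)) (rv p e (a + c + 1) d) := by
  induction d generalizing c with
  | zero => exact he.rv_mul_simple a c
  | succ d ih =>
    have h1 := ih (c + 1)
    have h2 := he.simple_commute_rv (a := a) (i := a + c + 1) (d := c + (d + 1) + 1)
      (by omega) (by omega)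
    rw [show c + 1 + d + 1 = c + (d + 1) + 1 by ring,
      show a + (c + 1) + 1 = a + c + 1 + 1 by ring] at h1
    have h3 := QComm.bracket_right p (.of_commute h2.symm) h1
    rwa [one_mul] at h3

/-- The commutator of the root vectors of two crossing segments. -/
theorem IsSerre.rv_crossing (a c d f : ℕ) :
    rv p e a (c + d + 1) * rv p e (a + c + 1) (d + f + 1) -
      rv p e (a + c + 1) (d + f + 1) * rv p e a (c + d + 1) =
      (q - p) • (rv p e a (c + d + f + 2) * rv p e (a + c + 1) d) := by
  have hqp := he.mul_eq_one
  have h1 := he.rv_bracket (a + c + 1) d f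
  have h2 := he.rv_bracket a (c + d + 1) f
  have h3 := he.rv_mul_rv_column a c d
  have h4 := (he.rv_commute_nested (a := a) (c := c + d + f + 2) (s := a + c + 1) (d := d)
      (by omega) (by omega)).eq
  rw [show c + d + 1 + f + 1 = c + d + f + 2 by ring] at h2
  rw [show a + (c + d + 1) + 1 = a + c + 1 + d + 1 by ring] at h2
  rw [← h1]
  generalize rv p e a (c + d + f + 2) = at' at *
  generalize rv p e (a + c + 1) d = sb at *
  generalize rv p e (a + c + 1 + d + 1) f = r at *
  generalize rv p e a (c + d + 1) = ab at *
  have k1 := congrArg (· * r) h3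
  have k2 := congrArg (r * ·) h3
  have k3 := congrArg (· * sb) h2
  have k4 := congrArg (sb * ·) h2
  simp only [mul_sub, sub_mul, mul_smul_comm, smul_mul_assoc, mul_assoc] at k1 k2 k3 k4 ⊢
  linear_combination (norm := skip) k1 - (p * p) • k2 - p • k3 + q • k4 - q • h4
  match_scalars <;> grind

end

variable (p) in
/-- The root vector of the segment `s, …, t`, which is zero if `t < s`. -/
def seg (e : ℕ → T) (s t : ℕ) : T := if s ≤ t then rv p e s (t - s) else 0

theorem seg_add (e : ℕ → T) (a d : ℕ) : seg p e a (a + d) = rv p e a d := by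
  rw [seg, if_pos (Nat.le_add_right a d), Nat.add_sub_cancel_left]

theorem seg_self (e : ℕ → T) (a : ℕ) : seg p e a a = e a := seg_add e a 0

theorem seg_eq_zero (e : ℕ → T) {a b : ℕ} (h : b < a) : seg p e a b = 0 := if_neg (by omega)

theorem seg_eq (e : ℕ → T) {a b : ℕ} (h : a < b) :
    seg p e a b = e a * seg p e (a + 1) b - p • (seg p e (a + 1) b * e a) := by
  obtain ⟨d, rfl⟩ := Nat.exists_eq_add_of_lt h
  rw [add_assoc, seg_add, show a + (d + 1) = a + 1 + d by ring, seg_add, rv]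

theorem commute_seg {e : ℕ → T} {x : T} {a b : ℕ} (hx : ∀ i, a ≤ i → i ≤ b → Commute x (e i)) :
    Commute x (seg p e a b) := by
  rcases lt_or_ge b a with h | h
  · rw [seg_eq_zero e h]; exact Commute.zero_right x
  · obtain ⟨d, rfl⟩ := Nat.exists_eq_add_of_le h
    rw [seg_add]; exact commute_rv hx

namespace IsSerre

variable {e : ℕ → T} (he : IsSerre q p e) {a b s t : ℕ}
include he

theorem seg_bracket (h1 : a ≤ b) (h2 : b < t) :
    seg p e a b * seg p e (b + 1) t - p • (seg p e (b + 1) t * seg p e a b) = seg p e a t := by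
  obtain ⟨c, rfl⟩ := Nat.exists_eq_add_of_le h1
  obtain ⟨d, rfl⟩ := Nat.exists_eq_add_of_lt h2
  rw [show a + c + d + 1 = a + c + 1 + d by ring, seg_add, seg_add,
    show a + c + 1 + d = a + (c + d + 1) by ring, seg_add, he.rv_bracket]

theorem seg_row (h1 : a ≤ b) (h2 : b < t) : QComm q (seg p e a b) (seg p e a t) := by
  obtain ⟨c, rfl⟩ := Nat.exists_eq_add_of_le h1
  obtain ⟨d, rfl⟩ := Nat.exists_eq_add_of_lt h2
  rw [show a + c + d + 1 = a + (c + d + 1) by ring, seg_add, seg_add]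
  exact he.rv_mul_rv_row a c d

theorem seg_column (h1 : a < s) (h2 : s ≤ b) : QComm q (seg p e a b) (seg p e s b) := by
  obtain ⟨c, rfl⟩ := Nat.exists_eq_add_of_lt h1
  obtain ⟨d, rfl⟩ := Nat.exists_eq_add_of_le h2
  rw [seg_add, show a + c + 1 + d = a + (c + d + 1) by ring, seg_add]
  exact he.rv_mul_rv_column a c d

theorem seg_nested (h1 : a < s) (h2 : t < b) : Commute (seg p e a b) (seg p e s t) := by
  rcases lt_or_ge t s with h | h
  · rw [seg_eq_zero e h]; exact Commute.zero_right _
  · obtain ⟨d, rfl⟩ := Nat.exists_eq_add_of_le h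
    obtain ⟨c, rfl⟩ := Nat.exists_eq_add_of_le (show a ≤ b by omega)
    rw [seg_add, seg_add]
    exact he.rv_commute_nested h1 h2

theorem seg_far (h : b + 1 < s) : Commute (seg p e a b) (seg p e s t) :=
  commute_seg fun _ _ _ => (commute_seg fun _ _ _ => he.comm' (by omega)).symm

theorem seg_crossing (h1 : a < s) (h2 : s ≤ b) (h3 : b < t) :
    seg p e a b * seg p e s t - seg p e s t * seg p e a b =
      (q - p) • (seg p e a t * seg p e s b) := by
  obtain ⟨c, rfl⟩ := Nat.exists_eq_add_of_lt h1
  obtain ⟨d, rfl⟩ := Nat.exists_eq_add_of_le h2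
  obtain ⟨f, rfl⟩ := Nat.exists_eq_add_of_lt h3
  have := he.rv_crossing a c d f
  rw [seg_add, show a + c + 1 + d + f + 1 = a + c + 1 + (d + f + 1) by ring, seg_add,
    show a + c + 1 + d = a + (c + d + 1) by ring, seg_add,
    show a + c + 1 + (d + f + 1) = a + (c + d + f + 2) by ring, seg_add]
  exact this

end IsSerre

end RootVectors

/-! ### Sums over pairs of root vectors -/

section RowSums

variable {K T : Type} [CommRing K] [Ring T] [Algebra K T] {q p : K}

/-- Double sums of antisymmetric terms vanish. The commutation relations of row sums with `upperSum`
and `triSum` are instances: the terms `(t, t')` and `(t', t)` cancel by the relations between root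
vectors. -/
theorem sum_sum_eq_zero_of_antisymm (h2 : IsUnit (2 : K)) (n : ℕ) (f : ℕ → ℕ → T)
    (hf : ∀ t t', t ≤ t' → f t t' + f t' t = 0) :
    ∑ t ∈ Finset.range n, ∑ t' ∈ Finset.range n, f t t' = 0 := by
  have hf' : ∀ t t', f t t' + f t' t = 0 := fun t t' =>
    (le_total t t').elim (hf t t') fun h => by rw [add_comm, hf t' t h]
  refine smul_cancel_of_isUnit h2 ?_
  rw [smul_zero, two_smul]
  nth_rewrite 2 [Finset.sum_comm]
  rw [← Finset.sum_add_distrib]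
  refine Finset.sum_eq_zero fun t _ => ?_
  rw [← Finset.sum_add_distrib]
  exact Finset.sum_eq_zero fun t' _ => hf' t t'

variable (p) in
/-- The row sum `∑ t, e_{s,t} φ_{s,t}`. -/
def rowSum (n : ℕ) (e φ : ℕ → T) (s : ℕ) : T := ∑ t ∈ Finset.range n, seg p e s t * seg p φ s t

variable (q p) in
/-- The entries of the triangular matrix with `1` on the diagonal and multiples of the root vectors
`α_{b+1,t}` above it. -/
def triEntry (α : ℕ → T) (b t : ℕ) : T := if t = b then 1 else (q - p) • seg p α (b + 1) t

theorem triEntry_self (α : ℕ → T) (b : ℕ) : triEntry q p α b b = 1 := if_pos rfl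

theorem triEntry_of_ne (α : ℕ → T) {b t : ℕ} (h : t ≠ b) :
    triEntry q p α b t = (q - p) • seg p α (b + 1) t := if_neg h

theorem triEntry_of_lt (α : ℕ → T) {b t : ℕ} (h : t < b) : triEntry q p α b t = 0 := by
  rw [triEntry_of_ne α h.ne, seg_eq_zero α (by omega), smul_zero]

variable (q p) in
/-- The sum `∑ t, l_{b,t} ε φ_{a,t}` with the triangular matrix `l` built from the `α`. -/
def triSum (n : ℕ) (α φ : ℕ → T) (ε : T) (a b : ℕ) : T :=
  ∑ t ∈ Finset.range n, triEntry q p α b t * ε * seg p φ a t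

variable (p) in
/-- The part of `triSum` above the diagonal, without its scalar factor. -/
def upperSum (n : ℕ) (α φ : ℕ → T) (ε : T) (a b : ℕ) : T :=
  ∑ t ∈ Finset.range n, seg p α (b + 1) t * ε * seg p φ a t

theorem triSum_eq {n : ℕ} {b : ℕ} (hb : b < n) (α φ : ℕ → T) (ε : T) (a : ℕ) :
    triSum q p n α φ ε a b = ε * seg p φ a b + (q - p) • upperSum p n α φ ε a b := by
  have : ∀ t ∈ Finset.range n, triEntry q p α b t * ε * seg p φ a t =
      (if t = b then ε * seg p φ a b else 0) + (q - p) • (seg p α (b + 1) t * ε * seg p φ a t) := by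
    intro t _
    split_ifs with h
    · subst h
      rw [triEntry_self, seg_eq_zero α (Nat.lt_succ_self t)]
      simp
    · rw [triEntry_of_ne α h]
      simp
  rw [triSum, Finset.sum_congr rfl this, Finset.sum_add_distrib, ← Finset.smul_sum, upperSum,
    Finset.sum_ite_eq' _ b, if_pos (Finset.mem_range.2 hb)]

/-- Together with `mul_mul_normal'`, this brings a product of a term `A B` of a row sum and a term
`A' ε B'` to the normal form with the factors of the first family on the left, then `ε`, then the
factors of the second family. -/
theorem mul_mul_normal {A B A' B' ε : T} (h1 : Commute A' B) (h2 : Commute ε B) :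
    A * B * (A' * ε * B') = A * A' * ε * (B * B') := by
  rw [mul_assoc A, mul_assoc A' ε, ← mul_assoc B, ← h1.eq, mul_assoc A', ← mul_assoc B, ← h2.eq]
  simp only [mul_assoc]

theorem mul_mul_normal' {A B A' B' ε : T} {d : K} (h1 : Commute A B') (h2 : QComm d ε A) :
    A' * ε * B' * (A * B) = d • (A' * A * ε * (B' * B)) := by
  rw [QComm] at h2
  rw [mul_assoc (A' * ε), ← mul_assoc B', ← h1.eq, mul_assoc A', mul_assoc A, ← mul_assoc ε, h2]
  simp only [mul_assoc, smul_mul_assoc, mul_smul_comm]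

variable {α φ : ℕ → T} (hα : IsSerre q p α) (hφ : IsSerre q p φ)
  (hαφ : ∀ i j, Commute (α i) (φ j)) {ε : T} (hεφ : ∀ j, Commute ε (φ j))

include hαφ in
theorem seg_seg_commute (a b s t : ℕ) : Commute (seg p α a b) (seg p φ s t) :=
  commute_seg fun _ _ _ => (commute_seg fun _ _ _ => (hαφ _ _).symm).symm

include hα hφ hαφ hεφ

/-- The commutator of row `b + 1` with `ε φ_{a,b}`. -/
theorem rowSum_commutator (n : ℕ) {a b : ℕ} (hab : a ≤ b)
    (hd : ∀ t, b < t → QComm q ε (seg p α (b + 1) t)) :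
    rowSum p n α φ (b + 1) * (ε * seg p φ a b) - ε * seg p φ a b * rowSum p n α φ (b + 1) =
      -(q • upperSum p n α φ ε a b) := by
  have hqp := hα.mul_eq_one
  rw [rowSum, upperSum, Finset.sum_mul, Finset.mul_sum, ← Finset.sum_sub_distrib, Finset.smul_sum,
    ← Finset.sum_neg_distrib]
  refine Finset.sum_congr rfl fun t _ => ?_
  rcases lt_or_ge b t with hbt | hbt
  · have h1 := mul_mul_normal (A := seg p α (b + 1) t) (B := seg p φ (b + 1) t) (B' := seg p φ a b)
      (Commute.one_left _) (commute_seg fun j _ _ => hεφ j)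
    have h2 := mul_mul_normal' (A' := 1) (B := seg p φ (b + 1) t)
      (seg_seg_commute (p := p) hαφ (b + 1) t a b) (hd t hbt)
    simp only [one_mul, mul_one] at h1 h2
    have h3 := hφ.seg_bracket hab hbt
    rw [h1, h2, ← h3]
    simp only [mul_sub, mul_smul_comm]
    match_scalars <;> grind
  · rw [seg_eq_zero α (by omega)]
    simp

/-- The sum that arises as the commutator in `rowSum_commutator` commutes with the row sum up to
`q⁻²`, as `HCompl.hQExp_mul_sub` requires. -/
theorem rowSum_mul_upperSum (n : ℕ) {a b : ℕ} (hab : a ≤ b)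
    (hd : ∀ t, b < t → QComm q ε (seg p α (b + 1) t)) :
    rowSum p n α φ (b + 1) * upperSum p n α φ ε a b =
      (p * p) • (upperSum p n α φ ε a b * rowSum p n α φ (b + 1)) := by
  have hqp := hα.mul_eq_one
  have hsum : rowSum p n α φ (b + 1) * upperSum p n α φ ε a b -
      (p * p) • (upperSum p n α φ ε a b * rowSum p n α φ (b + 1)) =
      ∑ t ∈ Finset.range n, ∑ t' ∈ Finset.range n,
        (seg p α (b + 1) t * seg p α (b + 1) t' * ε * (seg p φ (b + 1) t * seg p φ a t') -
        p • (seg p α (b + 1) t' * seg p α (b + 1) t * ε * (seg p φ a t' * seg p φ (b + 1) t))) := by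
    rw [rowSum, upperSum, Finset.sum_mul_sum, Finset.sum_mul_sum,
      Finset.sum_comm (s := Finset.range n)
      (t := Finset.range n) (f := fun i j => seg p α (b + 1) i * ε * seg p φ a i * _),
      Finset.smul_sum, ← Finset.sum_sub_distrib]
    refine Finset.sum_congr rfl fun t _ => ?_
    rw [Finset.smul_sum, ← Finset.sum_sub_distrib]
    refine Finset.sum_congr rfl fun t' _ => ?_
    rcases lt_or_ge b t with hbt | hbt
    · rw [mul_mul_normal (seg_seg_commute hαφ _ _ _ _) (commute_seg fun j _ _ => hεφ j),
        mul_mul_normal' (seg_seg_commute hαφ _ _ _ _) (hd t hbt), smul_smul]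
      congr 2
      grind
    · rw [seg_eq_zero α (by omega)]
      simp
  rw [← sub_eq_zero, hsum]
  refine sum_sum_eq_zero_of_antisymm hα.isUnit_two n _ fun t t' htt => ?_
  rcases lt_or_ge b t with hbt | hbt
  · rcases eq_or_lt_of_le htt with rfl | htt
    · have h1 : _ = _ • _ := hφ.seg_column (a := a) (s := b + 1) (b := t) (by omega) (by omega)
      rw [h1]
      simp only [mul_smul_comm]
      match_scalars
      grind
    · have h1 : _ = _ • _ := hα.seg_row (a := b + 1) (b := t) (t := t') (by omega) htt
      have h2 := (hφ.seg_nested (a := a) (s := b + 1) (t := t) (b := t') (by omega) htt).eq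
      have h3 := sub_eq_iff_eq_add.1 (hφ.seg_crossing (a := a) (s := b + 1) (b := t) (t := t')
        (by omega) (by omega) htt)
      rw [h1, h2, h3, h2]
      simp only [mul_smul_comm, smul_mul_assoc, mul_add]
      match_scalars <;> grind
  · rw [seg_eq_zero α (show t < b + 1 by omega)]
    simp

/-- The sum into which `ε φ_{a,b}` is turned by row `b + 1` commutes with the rows `s` for `a < s ≤
b`. The scalars in `hd` are those of an element `ε` with the weight of the segment `a, …, b`. -/
theorem rowSum_commute_triSum (n : ℕ) {a s b : ℕ} (has : a < s) (hsb : s ≤ b)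
    (hd : ∀ t, s ≤ t → QComm (if t = b then p else 1) ε (seg p α s t)) :
    Commute (rowSum p n α φ s) (triSum q p n α φ ε a b) := by
  have hqp := hα.mul_eq_one
  have hl : ∀ t i j, Commute (triEntry q p α b t) (seg p φ i j) := by
    intro t i j
    unfold triEntry
    split_ifs
    · exact Commute.one_left _
    · exact (seg_seg_commute hαφ _ _ _ _).smul_left _
  have hsum : rowSum p n α φ s * triSum q p n α φ ε a b -
        triSum q p n α φ ε a b * rowSum p n α φ s =
      ∑ t ∈ Finset.range n, ∑ t' ∈ Finset.range n,
        (seg p α s t * triEntry q p α b t' * ε * (seg p φ s t * seg p φ a t') -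
        (if t = b then p else 1) •
          (triEntry q p α b t' * seg p α s t * ε * (seg p φ a t' * seg p φ s t))) := by
    rw [rowSum, triSum, Finset.sum_mul_sum, Finset.sum_mul_sum,
      Finset.sum_comm (s := Finset.range n)
      (t := Finset.range n) (f := fun i j => triEntry q p α b i * ε * seg p φ a i * _),
      ← Finset.sum_sub_distrib]
    refine Finset.sum_congr rfl fun t _ => ?_
    rw [← Finset.sum_sub_distrib]
    refine Finset.sum_congr rfl fun t' _ => ?_
    rcases le_or_gt s t with hbt | hbt
    · rw [mul_mul_normal (hl _ _ _) (commute_seg fun j _ _ => hεφ j),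
        mul_mul_normal' (seg_seg_commute hαφ _ _ _ _) (hd t hbt)]
    · rw [seg_eq_zero α hbt]
      simp
  rw [commute_iff_eq, ← sub_eq_zero, hsum]
  refine sum_sum_eq_zero_of_antisymm hα.isUnit_two n _ fun t t' htt => ?_
  rcases lt_trichotomy t b with htb | rfl | htb
  · rw [triEntry_of_lt α htb, if_neg htb.ne]
    rcases lt_or_ge t s with hts | hts
    · rw [seg_eq_zero α hts]
      simp
    · rcases lt_trichotomy t' b with htb' | rfl | htb'
      · rw [triEntry_of_lt α htb']
        simp
      · have h1 := (hφ.seg_nested has htb).eq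
        rw [triEntry_self, h1]
        simp
      · have h1 := (hφ.seg_nested has (htb.trans htb')).eq
        have h2 := (hα.seg_far (a := s) (b := t) (s := b + 1) (t := t') (by omega)).eq
        rw [triEntry_of_ne α htb'.ne', h1, mul_smul_comm, h2]
        simp
  · rw [triEntry_self, if_pos rfl]
    rcases eq_or_lt_of_le htt with rfl | htt
    · have h1 : _ = _ • _ := hφ.seg_column has hsb
      rw [triEntry_self, if_pos rfl, h1]
      simp only [mul_smul_comm, one_mul, mul_one]
      match_scalars
      grind
    · have h1 := (hφ.seg_nested has htt).eq
      have h2 := sub_eq_iff_eq_add.1 (hα.seg_bracket hsb htt)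
      have h3 := sub_eq_iff_eq_add.1 (hφ.seg_crossing has hsb htt)
      rw [triEntry_of_ne α htt.ne', if_neg htt.ne', mul_smul_comm, h2, h3, h1]
      simp only [mul_smul_comm, smul_mul_assoc, mul_add, add_mul, smul_add, one_mul, mul_one]
      match_scalars <;> grind
  · rw [triEntry_of_ne α htb.ne', if_neg htb.ne']
    rcases eq_or_lt_of_le htt with rfl | htt
    · have h1 : _ = _ • _ := hφ.seg_column has (hsb.trans htb.le)
      have h2 : _ = _ • _ := hα.seg_column (a := s) (s := b + 1) (b := t) (by omega) (by omega)
      rw [triEntry_of_ne α htb.ne', if_neg htb.ne', mul_smul_comm, h2, h1]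
      simp only [mul_smul_comm, smul_mul_assoc]
      match_scalars
      grind
    · have htb' := htb.trans htt
      have h1 := (hφ.seg_nested has htt).eq
      have h2 := (hα.seg_nested (a := s) (s := b + 1) (t := t) (b := t') (by omega) htt).eq
      have h3 := sub_eq_iff_eq_add.1 (hφ.seg_crossing has (hsb.trans htb.le) htt)
      have h4 := sub_eq_iff_eq_add.1 (hα.seg_crossing (a := s) (s := b + 1) (b := t) (t := t')
        (by omega) (by omega) htt)
      rw [triEntry_of_ne α htb'.ne', if_neg htb'.ne', mul_smul_comm, mul_smul_comm, h4, h2, h3, h1]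
      simp only [mul_smul_comm, smul_mul_assoc, mul_add, add_mul, smul_add, one_smul]
      match_scalars <;> grind

/-- The sum into which `ε φ_{a,b}` is turned by row `b + 1` commutes with row `a` up to `q²`. The
scalars in `hd` are those of an element `ε` with the weight of the segment `a, …, b`. -/
theorem triSum_mul_rowSum (n : ℕ) {a b : ℕ} (hab : a ≤ b)
    (hd : ∀ t, a ≤ t → QComm (if t = b then p * p else p) ε (seg p α a t)) :
    triSum q p n α φ ε a b * rowSum p n α φ a =
      (p * p) • (rowSum p n α φ a * triSum q p n α φ ε a b) := by
  have hqp := hα.mul_eq_one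
  have hl : ∀ t i j, Commute (triEntry q p α b t) (seg p φ i j) := by
    intro t i j
    unfold triEntry
    split_ifs
    · exact Commute.one_left _
    · exact (seg_seg_commute hαφ _ _ _ _).smul_left _
  have hsum : (p * p) • (rowSum p n α φ a * triSum q p n α φ ε a b) -
        triSum q p n α φ ε a b * rowSum p n α φ a =
      ∑ t ∈ Finset.range n, ∑ t' ∈ Finset.range n,
        ((p * p) • (seg p α a t * triEntry q p α b t' * ε * (seg p φ a t * seg p φ a t')) -
        (if t = b then p * p else p) •
          (triEntry q p α b t' * seg p α a t * ε * (seg p φ a t' * seg p φ a t))) := by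
    rw [rowSum, triSum, Finset.sum_mul_sum, Finset.sum_mul_sum,
      Finset.sum_comm (s := Finset.range n)
      (t := Finset.range n) (f := fun i j => triEntry q p α b i * ε * seg p φ a i * _),
      Finset.smul_sum, ← Finset.sum_sub_distrib]
    refine Finset.sum_congr rfl fun t _ => ?_
    rw [Finset.smul_sum, ← Finset.sum_sub_distrib]
    refine Finset.sum_congr rfl fun t' _ => ?_
    rcases le_or_gt a t with hbt | hbt
    · rw [mul_mul_normal (hl _ _ _) (commute_seg fun j _ _ => hεφ j),
        mul_mul_normal' (seg_seg_commute hαφ _ _ _ _) (hd t hbt)]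
    · rw [seg_eq_zero α hbt]
      simp
  rw [eq_comm, ← sub_eq_zero, hsum]
  refine sum_sum_eq_zero_of_antisymm hα.isUnit_two n _ fun t t' htt => ?_
  rcases lt_trichotomy t b with htb | rfl | htb
  · rw [triEntry_of_lt α htb, if_neg htb.ne]
    rcases lt_or_ge t a with hts | hts
    · rw [seg_eq_zero α hts]
      simp
    · rcases lt_trichotomy t' b with htb' | rfl | htb'
      · rw [triEntry_of_lt α htb']
        simp
      · have h1 : _ = _ • _ := hφ.seg_row hts htb
        rw [triEntry_self, h1]
        simp only [mul_smul_comm, zero_mul, mul_zero, one_mul, mul_one, smul_zero]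
        match_scalars
        grind
      · have h1 : _ = _ • _ := hφ.seg_row hts (htb.trans htb')
        have h2 := (hα.seg_far (a := a) (b := t) (s := b + 1) (t := t') (by omega)).eq
        rw [triEntry_of_ne α htb'.ne', h1]
        simp only [mul_smul_comm, smul_mul_assoc, zero_mul, mul_zero, smul_zero, h2]
        match_scalars
        grind
  · rw [triEntry_self, if_pos rfl]
    rcases eq_or_lt_of_le htt with rfl | htt
    · rw [triEntry_self, if_pos rfl]
      simp
    · have h1 : _ = _ • _ := hφ.seg_row hab htt
      have h2 := sub_eq_iff_eq_add.1 (hα.seg_bracket hab htt)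
      rw [triEntry_of_ne α htt.ne', if_neg htt.ne', mul_smul_comm, h2, h1]
      simp only [mul_smul_comm, smul_mul_assoc, add_mul, smul_add, one_mul, mul_one]
      match_scalars <;> grind
  · rw [triEntry_of_ne α htb.ne', if_neg htb.ne']
    rcases eq_or_lt_of_le htt with rfl | htt
    · have h2 : _ = _ • _ := hα.seg_column (a := a) (s := b + 1) (b := t) (by omega) (by omega)
      rw [triEntry_of_ne α htb.ne', if_neg htb.ne', mul_smul_comm, h2]
      simp only [smul_mul_assoc]
      match_scalars
      grind
    · have htb' := htb.trans htt
      have h1 : _ = _ • _ := hφ.seg_row (hab.trans htb.le) htt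
      have h2 := (hα.seg_nested (a := a) (s := b + 1) (t := t) (b := t') (by omega) htt).eq
      have h4 := sub_eq_iff_eq_add.1 (hα.seg_crossing (a := a) (s := b + 1) (b := t) (t := t')
        (by omega) (by omega) htt)
      rw [triEntry_of_ne α htb'.ne', if_neg htb'.ne', mul_smul_comm, mul_smul_comm, h4, h2, h1]
      simp only [mul_smul_comm, smul_mul_assoc, add_mul, smul_add]
      match_scalars <;> grind

end RowSums

/-! ### Weights -/

section Weights

variable {K T : Type} [CommRing K] [Ring T] [Algebra K T] {q p : K}

/-- The power `q ^ m`, for an integer `m`. -/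
def IsQParam.pow (h : IsQParam q p) (m : ℤ) : K :=
  (((⟨q, p, h.mul_eq_one, by rw [mul_comm]; exact h.mul_eq_one⟩ : Kˣ) ^ m : Kˣ) : K)

namespace IsQParam

variable (h : IsQParam q p)

theorem pow_zero : h.pow 0 = 1 := by simp [IsQParam.pow]

theorem pow_one : h.pow 1 = q := by simp [IsQParam.pow]

theorem pow_neg_one : h.pow (-1) = p := by simp [IsQParam.pow]

theorem pow_add (m k : ℤ) : h.pow (m + k) = h.pow m * h.pow k := by
  simp [IsQParam.pow, zpow_add]

theorem pow_mul_pow_neg (m : ℤ) : h.pow m * h.pow (-m) = 1 := by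
  rw [← h.pow_add, add_neg_cancel, h.pow_zero]

theorem pow_two : h.pow 2 = q * q := by
  rw [show (2 : ℤ) = 1 + 1 by norm_num, h.pow_add, h.pow_one]

theorem pow_neg_two : h.pow (-2) = p * p := by
  rw [show (-2 : ℤ) = -1 + -1 by norm_num, h.pow_add, h.pow_neg_one]

/-- A `q`-commutation relation with simple root vectors, extended to the root vector of a
segment. -/
theorem qComm_seg {x : T} {e : ℕ → T} {m : ℕ → ℤ} (hx : ∀ j, QComm (h.pow (m j)) x (e j))
    {a b : ℕ} (hab : a ≤ b) :
    QComm (h.pow (∑ j ∈ Finset.Icc a b, m j)) x (seg p e a b) := by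
  obtain ⟨d, rfl⟩ := Nat.exists_eq_add_of_le hab
  clear hab
  induction d generalizing a with
  | zero => simpa [seg_self] using hx a
  | succ d ih =>
    have h1 := ih (a := a + 1)
    rw [show a + 1 + d = a + (d + 1) by ring] at h1
    rw [seg_eq e (by omega), ← Finset.insert_Icc_add_one_left_eq_Icc (by omega),
      Finset.sum_insert (by simp), h.pow_add]
    exact (hx a).bracket_right p h1

end IsQParam

/-- The Cartan integers of type `A`, with indices in `ℕ`. -/
def cartan (i j : ℕ) : ℤ := if i = j then 2 else if i + 1 = j ∨ j + 1 = i then -1 else 0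

theorem cartan_comm (i j : ℕ) : cartan i j = cartan j i := by
  unfold cartan; split_ifs <;> omega

/-- The pairing of a simple root with the root of a segment. -/
def cartanSeg (i a b : ℕ) : ℤ :=
  (if i = a then 1 else 0) + (if i = b then 1 else 0) - (if i + 1 = a then 1 else 0)
    - (if i = b + 1 then 1 else 0)

theorem sum_cartan (i : ℕ) {a b : ℕ} (hab : a ≤ b) :
    ∑ j ∈ Finset.Icc a b, cartan i j = cartanSeg i a b := by
  induction b, hab using Nat.le_induction with
  | base => rw [Finset.Icc_self, Finset.sum_singleton, cartan, cartanSeg]; split_ifs <;> omega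
  | succ b hab ih =>
    rw [Finset.sum_Icc_succ_top (by omega), ih, cartan, cartanSeg, cartanSeg]
    grind

/-- The pairing of the roots of two segments. -/
def segPairing (s t a b : ℕ) : ℤ :=
  (if s ≤ a ∧ a ≤ t then 1 else 0) + (if s ≤ b ∧ b ≤ t then 1 else 0)
    - (if s + 1 ≤ a ∧ a ≤ t + 1 then 1 else 0) - (if s ≤ b + 1 ∧ b + 1 ≤ t then 1 else 0)

theorem sum_cartanSeg (a b : ℕ) {s t : ℕ} (hst : s ≤ t) :
    ∑ i ∈ Finset.Icc s t, cartanSeg i a b = segPairing s t a b := by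
  induction t, hst using Nat.le_induction with
  | base => rw [Finset.Icc_self, Finset.sum_singleton, cartanSeg, segPairing]; grind
  | succ t hst ih =>
    have h1 : ∀ c, (if s ≤ c ∧ c ≤ t + 1 then (1 : ℤ) else 0) =
        (if s ≤ c ∧ c ≤ t then 1 else 0) + if t + 1 = c then 1 else 0 := by
      intro c; split_ifs <;> omega
    have h2 : (if s + 1 ≤ a ∧ a ≤ t + 1 + 1 then (1 : ℤ) else 0) =
        (if s + 1 ≤ a ∧ a ≤ t + 1 then 1 else 0) + if t + 1 + 1 = a then 1 else 0 := by
      split_ifs <;> omega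
    rw [Finset.sum_Icc_succ_top (by omega), ih, cartanSeg, segPairing, segPairing, h1, h1, h1, h2]
    ring

variable {h : IsQParam q p}

theorem qComm_seg_of_cartan {x : T} {e : ℕ → T} {i : ℕ}
    (hx : ∀ j, QComm (h.pow (cartan i j)) x (e j)) {a b : ℕ} (hab : a ≤ b) :
    QComm (h.pow (cartanSeg i a b)) x (seg p e a b) := by
  rw [← sum_cartan i hab]; exact h.qComm_seg hx hab

theorem qComm_seg_of_neg_cartan {x : T} {e : ℕ → T} {i : ℕ}
    (hx : ∀ j, QComm (h.pow (-cartan i j)) x (e j)) {a b : ℕ} (hab : a ≤ b) :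
    QComm (h.pow (-cartanSeg i a b)) x (seg p e a b) := by
  rw [← sum_cartan i hab, ← Finset.sum_neg_distrib]; exact h.qComm_seg hx hab

theorem qComm_seg_seg {α ε : ℕ → T} (hαε : ∀ i j, QComm (h.pow (cartan i j)) (α i) (ε j))
    {a b s t : ℕ} (hab : a ≤ b) (hst : s ≤ t) :
    QComm (h.pow (-segPairing s t a b)) (seg p ε a b) (seg p α s t) := by
  rw [← sum_cartanSeg a b hst, ← Finset.sum_neg_distrib]
  exact h.qComm_seg
    (fun j => (qComm_seg_of_cartan (hαε j) hab).symm (h.pow_mul_pow_neg _)) hst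

/-- The expansion of the root vectors of a sum of two families with cross relations. -/
theorem seg_add_family {α ε : ℕ → T} (hα : IsSerre q p α)
    (hαε : ∀ i j, QComm (h.pow (cartan i j)) (α i) (ε j)) {n a b : ℕ} (hab : a ≤ b) (hb : b < n) :
    seg p (fun i => α i + ε i) a b = seg p α a b + seg p ε a b +
      (q - p) • ∑ c ∈ Finset.range n, seg p α (c + 1) b * seg p ε a c := by
  have hqp := h.mul_eq_one
  obtain ⟨d, rfl⟩ := Nat.exists_eq_add_of_le hab
  clear hab
  induction d generalizing a with
  | zero =>
    rw [Finset.sum_eq_zero]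
    · simp [seg_self]
    · intro c _
      rcases lt_or_ge c a with hc | hc
      · rw [seg_eq_zero ε hc, mul_zero]
      · rw [seg_eq_zero α (by omega), zero_mul]
  | succ d ih =>
    have ih := ih (a := a + 1) (by omega)
    rw [show a + 1 + d = a + (d + 1) by ring] at ih
    set b := a + (d + 1) with hbdef
    have hab : a < b := by omega
    have h1 : ∀ c, a < c → QComm p (α a) (seg p ε (a + 1) c) := by
      intro c hc
      have := qComm_seg_of_cartan (hαε a) (show a + 1 ≤ c by omega)
      rwa [show cartanSeg a (a + 1) c = -1 by unfold cartanSeg; grind, h.pow_neg_one] at this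
    have h2 : ∀ c, a ≤ c → c < b → QComm (if c = a then q else 1) (ε a) (seg p α (c + 1) b) := by
      intro c hc hcb
      have := qComm_seg_seg hαε (le_refl a) (show c + 1 ≤ b by omega)
      rw [seg_self] at this
      split_ifs with hca
      · subst hca
        rwa [show -segPairing (c + 1) b c c = 1 by unfold segPairing; grind, h.pow_one] at this
      · rwa [show -segPairing (c + 1) b a a = 0 by unfold segPairing; grind, h.pow_zero] at this
    rw [seg_eq _ hab, ih, seg_eq α hab, seg_eq ε hab]
    have h3 : α a * seg p ε (a + 1) b = _ • _ := h1 b hab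
    have h4 : ε a * seg p α (a + 1) b = _ • _ := h2 a le_rfl hab
    rw [if_pos rfl] at h4
    have key : ∀ c ∈ Finset.range n, seg p α (c + 1) b * seg p ε a c =
        (if c = a then seg p α (a + 1) b * ε a else 0) +
        ((α a + ε a) * (seg p α (c + 1) b * seg p ε (a + 1) c) -
          p • ((seg p α (c + 1) b * seg p ε (a + 1) c) * (α a + ε a))) := by
      intro c _
      rcases lt_trichotomy c a with hc | rfl | hc
      · rw [seg_eq_zero ε hc, seg_eq_zero ε (show c < a + 1 by omega), if_neg hc.ne]
        simp
      · rw [seg_self, seg_eq_zero ε (show c < c + 1 by omega), if_pos rfl]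
        simp
      · rw [if_neg hc.ne', zero_add]
        rcases lt_or_ge c b with hcb | hcb
        · have k1 : α a * seg p ε (a + 1) c = _ • _ := h1 c hc
          have k2 : ε a * seg p α (c + 1) b = _ • _ := h2 c hc.le hcb
          have k3 : α a * seg p α (c + 1) b = seg p α (c + 1) b * α a :=
            (commute_seg fun i _ _ => hα.comm' (by omega)).eq
          rw [if_neg hc.ne', one_smul] at k2
          rw [seg_eq ε hc, add_mul, ← mul_assoc, ← mul_assoc, k2, k3]
          simp only [mul_add, mul_sub, mul_assoc, k1, mul_smul_comm]
          module
        · rw [seg_eq_zero α (by omega)]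
          simp
    rw [Finset.sum_congr rfl key, Finset.sum_add_distrib, Finset.sum_ite_eq',
      if_pos (Finset.mem_range.2 (by omega)), Finset.sum_sub_distrib, ← Finset.mul_sum,
      ← Finset.smul_sum, ← Finset.sum_mul]
    generalize ∑ c ∈ Finset.range n, seg p α (c + 1) b * seg p ε (a + 1) c = S
    simp only [mul_add, add_mul, h3, h4, mul_smul_comm, smul_mul_assoc, smul_add]
    match_scalars <;> grind

end Weights

/-! ### The commutator with an opposite generator -/

section Opposite

variable {K T : Type} [CommRing K] [Ring T] [Algebra K T] {q p : K}

/-- The relations of `g = 1 ⊗ E i` with the families `e j = E j ⊗ 1` and `f j = 1 ⊗ F j`, or of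
`g = F i ⊗ 1` with these families exchanged: `g` commutes with the `e j`, and with
the `f j` for `j ≠ i`, while its commutator with `f i` is `(κ - κ') / (1 - q⁻²)`. Here `κ` and `κ'`
stand for `1 ⊗ k i ^ 2` and `1 ⊗ kbar i ^ 2`, or for `kbar i ^ 2 ⊗ 1` and `k i ^ 2 ⊗ 1`. -/
structure IsOpposite (h : IsQParam q p) (i : ℕ) (e f : ℕ → T) (g κ κ' : T) : Prop where
  serre_e : IsSerre q p e
  serre_f : IsSerre q p f
  ef : ∀ j k, Commute (e j) (f k)
  ge : ∀ j, Commute g (e j)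
  gf : ∀ j, j ≠ i → Commute g (f j)
  bracket : (1 - p * p) • (f i * g - g * f i) = κ - κ'
  κe : ∀ j, Commute κ (e j)
  κ'e : ∀ j, Commute κ' (e j)
  κf : ∀ j, QComm (h.pow (-cartan i j)) κ (f j)
  κ'f : ∀ j, QComm (h.pow (cartan i j)) κ' (f j)

namespace IsOpposite

variable {h : IsQParam q p} {i : ℕ} {e f : ℕ → T} {g κ κ' : T} (H : IsOpposite h i e f g κ κ')
include H

theorem κ_seg {m : ℤ} {s t : ℕ} (hst : s ≤ t) (hm : -cartanSeg i s t = m) :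
    QComm (h.pow m) κ (seg p f s t) := hm ▸ qComm_seg_of_neg_cartan H.κf hst

theorem κ'_seg {m : ℤ} {s t : ℕ} (hst : s ≤ t) (hm : cartanSeg i s t = m) :
    QComm (h.pow m) κ' (seg p f s t) := hm ▸ qComm_seg_of_cartan H.κ'f hst

/-- The commutator of `g` with the root vector of a segment that begins at the vertex `i`: only the
term with `κ` survives. -/
theorem bracket_seg_left {t : ℕ} (ht : i < t) :
    (1 - p * p) • (seg p f i t * g - g * seg p f i t) = (q - p) • (seg p f (i + 1) t * κ) := by
  have hqp := h.mul_eq_one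
  have h1 : κ * _ = _ • _ := H.κ_seg (m := 1) (s := i + 1) (t := t) (by omega)
    (by unfold cartanSeg; grind)
  have h2 : κ' * _ = _ • _ := H.κ'_seg (m := -1) (s := i + 1) (t := t) (by omega)
    (by unfold cartanSeg; grind)
  rw [h.pow_one] at h1
  rw [h.pow_neg_one] at h2
  have h3 : g * seg p f (i + 1) t = seg p f (i + 1) t * g :=
    (commute_seg fun j _ _ => H.gf j (by omega)).eq
  have h4 := H.bracket
  rw [seg_eq f ht]
  generalize seg p f (i + 1) t = F at *
  have k1 := congrArg (· * F) h4
  have k2 := congrArg (F * ·) h4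
  have k3 := congrArg (f i * ·) h3
  have k4 := congrArg (· * f i) h3
  simp only [mul_sub, sub_mul, mul_smul_comm, smul_mul_assoc, mul_assoc, h1, h2] at k1 k2 k3 k4 ⊢
  linear_combination (norm := skip) k1 - p • k2 - (1 - p * p) • k3 + (p * (1 - p * p)) • k4
  match_scalars <;> grind

/-- The commutator of `g` with the root vector of a segment that ends at the vertex `i`: only the
term with `κ'` survives. -/
theorem bracket_seg_right {s : ℕ} (hs : s < i) :
    (1 - p * p) • (seg p f s i * g - g * seg p f s i) =
      -((1 - p * p) • (seg p f s (i - 1) * κ')) := by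
  have hqp := h.mul_eq_one
  have h1 : κ * _ = _ • _ := H.κ_seg (m := 1) (s := s) (t := i - 1) (by omega)
    (by unfold cartanSeg; grind)
  have h2 : κ' * _ = _ • _ := H.κ'_seg (m := -1) (s := s) (t := i - 1) (by omega)
    (by unfold cartanSeg; grind)
  rw [h.pow_one] at h1
  rw [h.pow_neg_one] at h2
  have h3 : g * seg p f s (i - 1) = seg p f s (i - 1) * g :=
    (commute_seg fun j _ _ => H.gf j (by omega)).eq
  have h4 := H.bracket
  have h5 := H.serre_f.seg_bracket (a := s) (b := i - 1) (t := i) (by omega) (by omega)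
  rw [show i - 1 + 1 = i by omega, seg_self] at h5
  rw [← h5]
  generalize seg p f s (i - 1) = F at *
  have k1 := congrArg (· * F) h4
  have k2 := congrArg (F * ·) h4
  have k3 := congrArg (f i * ·) h3
  have k4 := congrArg (· * f i) h3
  simp only [mul_sub, sub_mul, mul_smul_comm, smul_mul_assoc, mul_assoc, h1, h2] at k1 k2 k3 k4 ⊢
  linear_combination (norm := skip) k2 - p • k1 + (p * (1 - p * p)) • k3 - (1 - p * p) • k4
  match_scalars <;> grind

/-- The contributions of `κ` and `κ'` cancel for a segment with `i` in its interior. The scalar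
cannot be removed, since it is not a unit. -/
theorem bracket_seg_interior {s t : ℕ} (hs : s < i) (ht : i < t) :
    (1 - p * p) • (seg p f s t * g - g * seg p f s t) = 0 := by
  have hqp := h.mul_eq_one
  have h1 : κ * _ = _ • _ := H.κ_seg (m := 1) (s := s) (t := i - 1) (by omega)
    (by unfold cartanSeg; grind)
  rw [h.pow_one] at h1
  have h3 : g * seg p f s (i - 1) = seg p f s (i - 1) * g :=
    (commute_seg fun j _ _ => H.gf j (by omega)).eq
  have h4 := H.bracket_seg_left ht
  have h5 := H.serre_f.seg_bracket (a := s) (b := i - 1) (t := t) (by omega) (by omega)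
  have h6 := (H.serre_f.seg_far (a := s) (b := i - 1) (s := i + 1) (t := t) (by omega)).eq
  rw [show i - 1 + 1 = i by omega] at h5
  rw [← h5]
  generalize seg p f s (i - 1) = F at *
  have k1 := congrArg (· * F) h4
  have k2 := congrArg (F * ·) h4
  have k3 := congrArg (seg p f i t * ·) h3
  have k4 := congrArg (· * seg p f i t) h3
  have k5 := congrArg (· * κ) h6
  simp only [mul_sub, sub_mul, mul_smul_comm, smul_mul_assoc, mul_assoc, h1] at k1 k2 k3 k4 k5 ⊢
  linear_combination (norm := skip) k2 - p • k1 + (p * (1 - p * p)) • k3 - (1 - p * p) • k4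
    + (q - p) • k5
  match_scalars <;> grind

theorem seg_commute (a b s t : ℕ) : Commute (seg p e a b) (seg p f s t) :=
  seg_seg_commute H.ef a b s t

theorem g_mul_seg (a b : ℕ) : g * seg p e a b = seg p e a b * g :=
  (commute_seg fun j _ _ => H.ge j).eq

theorem fe (j k : ℕ) : Commute (f j) (e k) := (H.ef k j).symm

theorem rowSum_comm (n s : ℕ) : rowSum p n e f s = rowSum p n f e s :=
  Finset.sum_congr rfl fun _ _ => (H.seg_commute _ _ _ _).eq

/-- The commutator of `g` with the row sum of its own row. -/
theorem rowSum_bracket_self {n : ℕ} (hi : i < n) :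
    (1 - p * p) • (rowSum p n e f i * g - g * rowSum p n e f i) =
      triSum q p n f e κ i i - κ' * e i := by
  rw [rowSum, Finset.sum_mul, Finset.mul_sum, ← Finset.sum_sub_distrib, Finset.smul_sum, triSum]
  have : ∀ t ∈ Finset.range n, (1 - p * p) •
      (seg p e i t * seg p f i t * g - g * (seg p e i t * seg p f i t)) =
      triEntry q p f i t * κ * seg p e i t - if t = i then κ' * e i else 0 := by
    intro t _
    have h1 : seg p e i t * seg p f i t * g - g * (seg p e i t * seg p f i t) =
        seg p e i t * (seg p f i t * g - g * seg p f i t) := by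
      rw [← mul_assoc, H.g_mul_seg, mul_sub, mul_assoc, mul_assoc]
    rw [h1, ← mul_smul_comm]
    rcases lt_trichotomy t i with ht | rfl | ht
    · rw [seg_eq_zero e ht, if_neg ht.ne]; simp
    · rw [seg_self, seg_self, H.bracket, triEntry_self, if_pos rfl, one_mul, mul_sub,
        (H.κe t).eq, (H.κ'e t).eq]
    · rw [H.bracket_seg_left ht, triEntry_of_ne f ht.ne', if_neg ht.ne', sub_zero, smul_mul_assoc,
        smul_mul_assoc, mul_smul_comm, ← mul_assoc, (H.seg_commute _ _ _ _).eq, mul_assoc,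
        mul_assoc, (commute_seg (p := p) fun j _ _ => H.κe j).eq]
  rw [Finset.sum_congr rfl this, Finset.sum_sub_distrib, Finset.sum_ite_eq',
    if_pos (Finset.mem_range.2 hi)]

theorem commute_rowSum_above (n : ℕ) {r : ℕ} (hr : i + 1 < r) :
    Commute (g + κ * e i) (rowSum p n e f r) := by
  refine Commute.sum_right _ _ _ fun t _ => ?_
  rcases le_or_gt r t with ht | ht
  · have h0 : Commute κ (seg p f r t) := by
      have := H.κ_seg (m := 0) ht (by unfold cartanSeg; grind)
      rw [h.pow_zero] at this
      exact this.commute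
    refine Commute.add_left (Commute.mul_right ?_ ?_) (Commute.mul_left
      (Commute.mul_right ?_ h0) (Commute.mul_right ?_ ?_))
    · exact commute_seg fun j _ _ => H.ge j
    · exact commute_seg fun j _ _ => H.gf j (by omega)
    · exact commute_seg fun j _ _ => H.κe j
    · exact commute_seg fun j _ _ => H.serre_e.comm' (by omega)
    · exact commute_seg fun j _ _ => H.ef _ _
  · rw [seg_eq_zero e ht, zero_mul]
    exact Commute.zero_right _

/-- The second term of `rowSum_bracket_self` commutes with the row sum up to `q²`. -/
theorem κ'e_mul_rowSum (n : ℕ) :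
    rowSum p n e f i * (κ' * e i) = (p * p) • (κ' * e i * rowSum p n e f i) := by
  rw [rowSum, Finset.sum_mul, Finset.mul_sum, Finset.smul_sum]
  refine Finset.sum_congr rfl fun t _ => ?_
  have hqq : q * q * (p * p) = 1 := by linear_combination (q * p + 1) * h.mul_eq_one
  refine QComm.symm hqq ?_
  have k1 : QComm (1 : K) κ' (seg p e i t) := .of_commute (commute_seg fun j _ _ => H.κ'e j)
  have k2 : QComm (1 : K) (e i) (seg p f i t) := .of_commute (commute_seg fun j _ _ => H.ef _ _)
  rcases lt_trichotomy t i with ht | rfl | ht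
  · rw [seg_eq_zero e ht]; simp [QComm]
  · have k3 := H.κ'_seg (m := 2) (s := t) (t := t) le_rfl (by unfold cartanSeg; grind)
    rw [h.pow_two] at k3
    have k4 : QComm (1 : K) (e t) (seg p e t t) := by
      rw [seg_self]; exact .of_commute (Commute.refl _)
    have := (k1.mul_right k3).mul_left (k4.mul_right k2)
    simpa using this
  · have k3 := H.κ'_seg (m := 1) (s := i) (t := t) ht.le (by unfold cartanSeg; grind)
    rw [h.pow_one] at k3
    have k4 : QComm q (e i) (seg p e i t) := by
      have := H.serre_e.seg_row (a := i) (b := i) (t := t) le_rfl ht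
      rwa [seg_self] at this
    have := (k1.mul_right k3).mul_left (k4.mul_right k2)
    simpa using this

/-- Row `r` commutes with `g + κ' e_i` up to a scalar factor, for `r < i`: the contribution of the
segment that ends at `i` cancels that of the segment that ends at `i - 1`. -/
theorem bracket_rowSum_below (n : ℕ) (hi : i < n) {r : ℕ} (hr : r < i) :
    (1 - p * p) • (rowSum p n e f r * (g + κ' * e i) - (g + κ' * e i) * rowSum p n e f r) = 0 := by
  have hqp := h.mul_eq_one
  -- the contribution of `t = i - 1`, which is the negative of that of `t = i`
  set D : T := seg p e r i * (seg p f r (i - 1) * κ') with hD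
  have key : ∀ t ∈ Finset.range n, (1 - p * p) • (seg p e r t * seg p f r t * (g + κ' * e i) -
      (g + κ' * e i) * (seg p e r t * seg p f r t)) =
      (if t = i - 1 then (1 - p * p) • D else 0) - if t = i then (1 - p * p) • D else 0 := by
    intro t _
    have hg : seg p e r t * seg p f r t * g - g * (seg p e r t * seg p f r t) =
        seg p e r t * (seg p f r t * g - g * seg p f r t) := by
      rw [← mul_assoc, H.g_mul_seg, mul_sub, mul_assoc, mul_assoc]
    rw [mul_add, add_mul, add_sub_add_comm, hg]
    rcases lt_or_ge t r with htr | htr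
    · rw [seg_eq_zero e htr, if_neg (by omega), if_neg (by omega)]; simp
    have k1 : Commute κ' (seg p e r t) := commute_seg fun j _ _ => H.κ'e j
    have k2 : Commute (e i) (seg p f r t) := commute_seg fun j _ _ => H.ef _ _
    rcases lt_trichotomy t i with ht | rfl | ht
    · have k3 : g * seg p f r t = seg p f r t * g :=
        (commute_seg fun j _ _ => H.gf j (by omega)).eq
      rw [k3, sub_self, mul_zero, zero_add, if_neg ht.ne, sub_zero]
      split_ifs with hti
      · subst hti
        have k4 := H.κ'_seg (m := -1) htr (by unfold cartanSeg; grind)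
        rw [h.pow_neg_one] at k4
        have k5 := H.serre_e.seg_bracket (a := r) (b := i - 1) (t := i) htr ht
        rw [show i - 1 + 1 = i by omega, seg_self] at k5
        have k6 : κ' * _ = _ • _ := k4
        rw [hD, ← k5]
        congr 1
        have k7 : seg p e r (i - 1) * seg p f r (i - 1) * (κ' * e i) =
            seg p e r (i - 1) * e i * (seg p f r (i - 1) * κ') := by
          rw [(H.κ'e i).eq, mul_assoc, ← mul_assoc (seg p f r (i - 1)), ← k2.eq]
          simp only [mul_assoc]
        have k8 : κ' * e i * (seg p e r (i - 1) * seg p f r (i - 1)) =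
            p • (e i * seg p e r (i - 1) * (seg p f r (i - 1) * κ')) := by
          rw [(H.κ'e i).eq, mul_assoc, ← mul_assoc κ', k1.eq, mul_assoc (seg p e r (i - 1)), k6]
          simp only [mul_assoc, mul_smul_comm]
        rw [k7, k8, sub_mul, smul_mul_assoc]
      · have k4 := H.κ'_seg (m := 0) htr (by unfold cartanSeg; grind)
        rw [h.pow_zero] at k4
        have k5 : Commute (e i) (seg p e r t) :=
          commute_seg fun j _ _ => H.serre_e.comm' (by omega)
        rw [((k1.mul_right k4.commute).mul_left (k5.mul_right k2)).eq, sub_self, smul_zero]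
    · have k4 := H.κ'_seg (m := 1) htr (by unfold cartanSeg; grind)
      rw [h.pow_one] at k4
      have k5 : QComm q (seg p e r t) (e t) := by
        have := H.serre_e.seg_column (a := r) (s := t) (b := t) hr le_rfl
        rwa [seg_self] at this
      have k6 := ((QComm.of_commute (K := K) k1).mul_right k4).mul_left
        ((k5.symm hqp).mul_right (.of_commute k2))
      rw [one_mul, mul_one, hqp] at k6
      rw [k6.commute.eq, sub_self, add_zero, if_neg (by omega), if_pos rfl, zero_sub,
        ← mul_smul_comm, H.bracket_seg_right hr, hD, mul_neg, mul_smul_comm]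
    · rw [if_neg (by omega), if_neg (by omega), sub_zero, smul_add, ← mul_smul_comm,
        H.bracket_seg_interior hr ht, mul_zero, zero_add]
      have k4 := H.κ'_seg (m := 0) htr (by unfold cartanSeg; grind)
      rw [h.pow_zero] at k4
      have k5 : Commute (e i) (seg p e r t) := by
        have := H.serre_e.seg_nested (a := r) (b := t) (s := i) (t := i) hr ht
        rw [seg_self] at this
        exact this.symm
      rw [((k1.mul_right k4.commute).mul_left (k5.mul_right k2)).eq, sub_self, smul_zero]
  rw [rowSum, Finset.sum_mul, Finset.mul_sum, ← Finset.sum_sub_distrib, Finset.smul_sum,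
    Finset.sum_congr rfl key, Finset.sum_sub_distrib, Finset.sum_ite_eq', Finset.sum_ite_eq',
    if_pos (Finset.mem_range.2 hi), if_pos (Finset.mem_range.2 (by omega)), sub_self]

end IsOpposite

end Opposite

/-! ### Ordered products of `q`-exponentials of row sums -/

theorem isQParam_qPow : IsQParam (qPow 1) (qPow (-1)) where
  mul_eq_one := qPow_mul_qPow_neg 1
  isUnit_two := by
    rw [PowerSeries.isUnit_iff_constantCoeff, map_ofNat]
    exact isUnit_iff_ne_zero.2 two_ne_zero
  isUnit_one_add_sq := by
    rw [PowerSeries.isUnit_iff_constantCoeff, map_add, map_mul, map_one, constantCoeff_qPow]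
    norm_num

theorem qPow_neg_two : qPow (-2) = qPow (-1) * qPow (-1) := by
  rw [← qPow_add]; norm_num

theorem isQParam_pow (m : ℤ) : isQParam_qPow.pow m = qPow m := by
  have hN : ∀ k : ℕ, isQParam_qPow.pow k = qPow k := by
    intro k
    induction k with
    | zero => simpa [qPow_zero] using isQParam_qPow.pow_zero
    | succ k ih =>
      push_cast at ih ⊢
      rw [isQParam_qPow.pow_add, ih, isQParam_qPow.pow_one, qPow_add]
  obtain ⟨k, rfl | rfl⟩ := m.eq_nat_or_neg
  · exact_mod_cast hN k
  · have h1 := isQParam_qPow.pow_mul_pow_neg k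
    have h2 := qPow_mul_qPow_neg k
    rw [hN] at h1
    have h3 : qPow k ≠ 0 := left_ne_zero_of_mul_eq_one h2
    push_cast
    exact mul_left_cancel₀ h3 (h1.trans h2.symm)

theorem hh_mul_lamDiv' : hh * lamDiv = 1 - qPow (-1) * qPow (-1) := by
  rw [hh_mul_lamDiv, mul_sub, mul_comm, qPow_mul_qPow_neg]

section Theta

variable {A : Type} [Ring A] [Algebra Kh A]

/-- The `q`-exponential of a row sum. -/
def expRow (n : ℕ) (e φ : ℕ → HCompl A) (s : ℕ) : HCompl A :=
  HCompl.hQExp ((-lamDiv) • rowSum (qPow (-1)) n e φ s)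

/-- The product of the `q`-exponentials of `k` consecutive row sums, beginning with row `s`. -/
def theta (n : ℕ) (e φ : ℕ → HCompl A) : ℕ → ℕ → HCompl A
  | _, 0 => 1
  | s, k + 1 => expRow n e φ s * theta n e φ (s + 1) k

/-- It suffices that the commutator is annihilated by `h`, since `hQExp z` is a series in `h z`. -/
theorem hQExp_commute {z u : HCompl A} (h : hh • (z * u - u * z) = 0) :
    Commute (HCompl.hQExp z) u := by
  have := HCompl.hQExp_mul_sub (z := z) (u := u) (d₁ := 0) (d₂ := 0) (by simpa using h) (by simp)
    (by simp)
  rwa [sub_zero, add_zero] at this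

theorem hQExp_zero : HCompl.hQExp (0 : HCompl A) = 1 := by
  rw [HCompl.hQExp_eq, HCompl.evalH_eq_head_add, qCoeff_zero]
  have : (fun m => qCoeff (m + 1) • (0 : HCompl A) ^ (m + 1)) = fun _ => (0 : HCompl A) * 0 := by
    ext1 m; simp
  rw [this, ← HCompl.mul_evalH]
  simp

theorem isUnit_theta (n : ℕ) (e φ : ℕ → HCompl A) (s k : ℕ) : IsUnit (theta n e φ s k) := by
  induction k generalizing s with
  | zero => exact isUnit_one
  | succ k ih => exact (HCompl.isUnit_hQExp _).mul (ih _)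

theorem map_rv {K T T' : Type} [CommRing K] [Ring T] [Algebra K T] [Ring T'] [Algebra K T']
    (p : K) (f : T →ₐ[K] T') (e : ℕ → T) (a d : ℕ) :
    f (rv p e a d) = rv p (fun i => f (e i)) a d := by
  induction d generalizing a with
  | zero => rfl
  | succ d ih => simp only [rv, map_sub, map_mul, map_smul, ih]

theorem map_rowSum {K T T' : Type} [CommRing K] [Ring T] [Algebra K T] [Ring T'] [Algebra K T']
    (p : K) (f : T →ₐ[K] T') (n : ℕ) (e φ : ℕ → T) (s : ℕ) :
    f (rowSum p n e φ s) = rowSum p n (fun i => f (e i)) (fun i => f (φ i)) s := by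
  simp only [rowSum, map_sum, map_mul, seg, apply_ite f, map_zero, map_rv]

theorem map_theta {B : Type} [Ring B] [Algebra Kh B] (f : HCompl A →ₐ[Kh] HCompl B) (n : ℕ)
    (e φ : ℕ → HCompl A) (s k : ℕ) :
    f (theta n e φ s k) = theta n (fun i => f (e i)) (fun i => f (φ i)) s k := by
  induction k generalizing s with
  | zero => exact map_one f
  | succ k ih =>
    rw [theta, theta, map_mul, ih, expRow, expRow, HCompl.map_hQExp, map_smul, map_rowSum]

/-- The scalar `h (- λ_q / h) = - (1 - q⁻²)` that relates the commutators with a row sum to the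
hypothesis of `HCompl.hQExp_mul_sub`. -/
theorem neg_lamDiv_commutator {Z u : HCompl A} :
    hh • ((-lamDiv) • Z * u - u * (-lamDiv) • Z) =
      (1 - qPow (-1) * qPow (-1)) • (u * Z - Z * u) := by
  rw [smul_mul_assoc, mul_smul_comm, ← smul_sub, smul_smul, mul_neg, hh_mul_lamDiv', neg_smul,
    ← smul_neg, neg_sub]

/-- A row sum of `(α + ε) φ` is that of `α φ` plus a sum in which every term involves `ε`. -/
theorem rowSum_add {α ε φ : ℕ → HCompl A} (hα : IsSerre (qPow 1) (qPow (-1)) α)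
    (hαε : ∀ i j, QComm (isQParam_qPow.pow (cartan i j)) (α i) (ε j)) {n s : ℕ} :
    rowSum (qPow (-1)) n (fun i => α i + ε i) φ s = rowSum (qPow (-1)) n α φ s +
      ∑ b ∈ Finset.range n, triSum (qPow 1) (qPow (-1)) n α φ (seg (qPow (-1)) ε s b) s b := by
  have h1 : ∀ b ∈ Finset.range n,
      triSum (qPow 1) (qPow (-1)) n α φ (seg (qPow (-1)) ε s b) s b =
      seg (qPow (-1)) ε s b * seg (qPow (-1)) φ s b +
        (qPow 1 - qPow (-1)) • upperSum (qPow (-1)) n α φ (seg (qPow (-1)) ε s b) s b :=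
    fun b hb => triSum_eq (Finset.mem_range.1 hb) _ _ _ _
  rw [Finset.sum_congr rfl h1, Finset.sum_add_distrib, ← Finset.smul_sum]
  simp only [upperSum]
  rw [Finset.sum_comm, Finset.smul_sum, rowSum, rowSum, ← Finset.sum_add_distrib,
    ← Finset.sum_add_distrib]
  refine Finset.sum_congr rfl fun t ht => ?_
  rcases lt_or_ge t s with hts | hts
  · simp [seg_eq_zero φ hts]
  · rw [seg_add_family hα hαε hts (Finset.mem_range.1 ht), add_mul, add_mul, smul_mul_assoc,
      Finset.sum_mul, add_assoc]

section Factorization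

variable {α ε φ : ℕ → HCompl A} (hα : IsSerre (qPow 1) (qPow (-1)) α)
  (hφ : IsSerre (qPow 1) (qPow (-1)) φ)
  (hαφ : ∀ i j, Commute (α i) (φ j))
include hα hφ hαφ

/-- The passage of `ε φ_{a,b}` through the row that begins right after `b`. -/
theorem expRow_mul {n a b : ℕ} (hab : a ≤ b) (hb : b < n) {ε : HCompl A}
    (hεφ : ∀ j, Commute ε (φ j))
    (hd : ∀ t, b < t → QComm (qPow 1) ε (seg (qPow (-1)) α (b + 1) t)) :
    expRow n α φ (b + 1) * (ε * seg (qPow (-1)) φ a b) =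
      triSum (qPow 1) (qPow (-1)) n α φ ε a b * expRow n α φ (b + 1) := by
  have h1 := rowSum_commutator hα hφ hαφ hεφ n hab hd
  have h2 := rowSum_mul_upperSum hα hφ hαφ hεφ n hab hd
  have h3 := HCompl.hQExp_mul_sub (z := (-lamDiv) • rowSum (qPow (-1)) n α φ (b + 1))
    (u := ε * seg (qPow (-1)) φ a b) (d₁ := 0)
    (d₂ := (qPow 1 - qPow (-1)) • upperSum (qPow (-1)) n α φ ε a b) (by
      rw [neg_lamDiv_commutator, zero_add,
        ← neg_sub (rowSum _ _ _ _ _ * _), h1, neg_neg, smul_smul]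
      congr 1
      linear_combination (-qPow (-1)) * qPow_mul_qPow_neg 1) (by simp) (by
      rw [qPow_neg_two]
      simp only [smul_mul_assoc, mul_smul_comm, h2, smul_smul]
      congr 1
      ring)
  rw [sub_zero] at h3
  rw [triSum_eq hb]
  exact h3

variable (hεφ : ∀ i j, Commute (ε i) (φ j))
  (hαε : ∀ i j, QComm (isQParam_qPow.pow (cartan i j)) (α i) (ε j))
include hεφ hαε

/-- The passage of a term `ε_{s,b} φ_{s,b}` of row `s` through the rows `r, …, n - 1`: the rows
after row `b + 1` commute with it, row `b + 1` turns it into `triSum`, and the rows up to row `b`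
commute with the result. -/
theorem theta_mul {n s b r k : ℕ} (hsr : s < r) (hb : b < n) (hrk : r + k = n) (hsb : s ≤ b) :
    theta n α φ r k * (seg (qPow (-1)) ε s b * seg (qPow (-1)) φ s b) =
      (if r ≤ b + 1 then triSum (qPow 1) (qPow (-1)) n α φ (seg (qPow (-1)) ε s b) s b
        else seg (qPow (-1)) ε s b * seg (qPow (-1)) φ s b) * theta n α φ r k := by
  have hεb : ∀ j, Commute (seg (qPow (-1)) ε s b) (φ j) := fun j =>
    (commute_seg fun i _ _ => (hεφ i j).symm).symm
  induction k generalizing r with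
  | zero =>
    rw [theta, mul_one, one_mul]
    split_ifs with hrb
    · rw [triSum_eq hb, upperSum, Finset.sum_eq_zero, smul_zero, add_zero]
      intro t ht
      rw [seg_eq_zero α (by rw [Finset.mem_range] at ht; omega)]
      simp
    · rfl
  | succ k ih =>
    have ih := ih (r := r + 1) (by omega) (by omega)
    rw [theta, mul_assoc, ih]
    rcases lt_trichotomy r (b + 1) with hr | rfl | hr
    · rw [if_pos (by omega), if_pos (by omega), ← mul_assoc]
      have hc : Commute (rowSum (qPow (-1)) n α φ r)
          (triSum (qPow 1) (qPow (-1)) n α φ (seg (qPow (-1)) ε s b) s b) := by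
        refine rowSum_commute_triSum hα hφ hαφ hεb n hsr (by omega) fun t ht => ?_
        have := qComm_seg_seg hαε hsb ht
        split_ifs with htb
        · rwa [show -segPairing r t s b = -1 by unfold segPairing; grind,
            isQParam_qPow.pow_neg_one] at this
        · rwa [show -segPairing r t s b = 0 by unfold segPairing; grind,
            isQParam_qPow.pow_zero] at this
      rw [expRow, (hQExp_commute (by
        rw [neg_lamDiv_commutator, hc.eq, sub_self, smul_zero])).eq, mul_assoc]
    · rw [if_neg (by omega), if_pos le_rfl, ← mul_assoc, expRow_mul hα hφ hαφ hsb hb hεb, mul_assoc]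
      intro t ht
      have := qComm_seg_seg hαε hsb (show b + 1 ≤ t by omega)
      rwa [show -segPairing (b + 1) t s b = 1 by unfold segPairing; grind,
        isQParam_qPow.pow_one] at this
    · rw [if_neg (by omega), if_neg (by omega), ← mul_assoc]
      have hc : Commute (rowSum (qPow (-1)) n α φ r)
          (seg (qPow (-1)) ε s b * seg (qPow (-1)) φ s b) := by
        refine Commute.sum_left _ _ _ fun t _ => ?_
        rcases lt_or_ge t r with ht | ht
        · rw [seg_eq_zero α ht, zero_mul]; exact Commute.zero_left _
        have h0 := qComm_seg_seg hαε hsb ht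
        rw [show -segPairing r t s b = 0 by unfold segPairing; grind,
          isQParam_qPow.pow_zero] at h0
        exact (h0.commute.symm.mul_right (seg_seg_commute hαφ _ _ _ _)).mul_left
          ((seg_seg_commute hεφ _ _ _ _).symm.mul_right (hφ.seg_far (by omega)).symm)
      rw [expRow, (hQExp_commute (by
        rw [neg_lamDiv_commutator, hc.eq, sub_self, smul_zero])).eq, mul_assoc]

/-- Conjugation by the product of the rows below turns a row sum of the `ε φ` into the part of the
row sum of the `(α + ε) φ` that involves `ε`. -/
theorem theta_mul_rowSum {n s k : ℕ} (hrk : s + 1 + k = n) :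
    theta n α φ (s + 1) k * rowSum (qPow (-1)) n ε φ s =
      (∑ b ∈ Finset.range n, triSum (qPow 1) (qPow (-1)) n α φ (seg (qPow (-1)) ε s b) s b) *
        theta n α φ (s + 1) k := by
  rw [rowSum, Finset.mul_sum, Finset.sum_mul]
  refine Finset.sum_congr rfl fun b hb => ?_
  rcases lt_or_ge b s with hbs | hbs
  · rw [seg_eq_zero ε hbs]
    simp [triSum]
  · rw [theta_mul hα hφ hαφ hεφ hαε (by omega) (Finset.mem_range.1 hb) hrk hbs,
      if_pos (by omega)]

/-- The product of the `q`-exponentials for a sum of two families is the product of those for the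
two summands. -/
theorem theta_add {n s k : ℕ} (hsk : s + k = n) :
    theta n (fun i => α i + ε i) φ s k = theta n α φ s k * theta n ε φ s k := by
  induction k generalizing s with
  | zero => simp [theta]
  | succ k ih =>
    have h1 := theta_mul_rowSum hα hφ hαφ hεφ hαε (show s + 1 + k = n by omega)
    set W := ∑ b ∈ Finset.range n, triSum (qPow 1) (qPow (-1)) n α φ (seg (qPow (-1)) ε s b) s b
      with hW
    have h2 : W * rowSum (qPow (-1)) n α φ s = qPow (-2) • (rowSum (qPow (-1)) n α φ s * W) := by
      rw [hW, Finset.sum_mul, Finset.mul_sum, Finset.smul_sum, qPow_neg_two]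
      refine Finset.sum_congr rfl fun b _ => ?_
      rcases lt_or_ge b s with hbs | hbs
      · rw [seg_eq_zero ε hbs]
        simp [triSum]
      · refine triSum_mul_rowSum hα hφ hαφ
          (fun j => (commute_seg fun i _ _ => (hεφ i j).symm).symm) n hbs fun t ht => ?_
        have := qComm_seg_seg hαε hbs ht
        split_ifs with htb
        · rwa [show -segPairing s t s b = -2 by unfold segPairing; grind,
            isQParam_qPow.pow_neg_two] at this
        · rwa [show -segPairing s t s b = -1 by unfold segPairing; grind,
            isQParam_qPow.pow_neg_one] at this
    have h3 : SemiconjBy (theta n α φ (s + 1) k) ((-lamDiv) • rowSum (qPow (-1)) n ε φ s)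
        ((-lamDiv) • W) := by
      rw [SemiconjBy, mul_smul_comm, h1, smul_mul_assoc]
    rw [theta, theta, theta, ih (by omega), expRow, rowSum_add hα hαε, ← hW, smul_add,
      HCompl.hQExp_add, mul_assoc, ← mul_assoc (HCompl.hQExp ((-lamDiv) • W)),
      ← (HCompl.hQExp_semiconj h3).eq]
    · simp only [expRow, mul_assoc]
    · simp only [smul_mul_assoc, mul_smul_comm, h2]
      rw [smul_comm (-lamDiv) (qPow (-2)), smul_comm (-lamDiv) (qPow (-2))]

end Factorization

section Intertwining

variable {i : ℕ} {e f : ℕ → HCompl A} {g κ κ' : HCompl A}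
  (H : IsOpposite isQParam_qPow i e f g κ κ')
include H

/-- The passage of `g + κ e_i` through the rows `r, …, n - 1`, after which it has become `g + κ'
e_i` if `r ≤ i`. Only the rows `i + 1` and `i` change it. -/
theorem theta_mul_opposite {n r k : ℕ} (hi : i < n) (hrk : r + k = n) :
    theta n e f r k * (g + κ * e i) =
      (if r ≤ i then g + κ' * e i else if r = i + 1 then
        g + triSum (qPow 1) (qPow (-1)) n f e κ i i else g + κ * e i) * theta n e f r k := by
  have hrow : ∀ s, expRow n e f s = expRow n f e s := fun s => by
    rw [expRow, H.rowSum_comm, expRow]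
  induction k generalizing r with
  | zero =>
    rw [theta, mul_one, one_mul, if_neg (by omega)]
    split_ifs with hr
    · rw [triSum_eq hi, seg_self, upperSum, Finset.sum_eq_zero, smul_zero, add_zero]
      intro t ht
      rw [seg_eq_zero f (by rw [Finset.mem_range] at ht; omega)]
      simp
    · rfl
  | succ k ih =>
    have ih := ih (r := r + 1) (by omega)
    rw [theta, mul_assoc, ih, ← mul_assoc, ← mul_assoc]
    congr 1
    rcases lt_trichotomy r i with hr | rfl | hr
    · rw [if_pos (by omega), if_pos hr.le, expRow]
      refine (hQExp_commute ?_).eq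
      rw [smul_mul_assoc, mul_smul_comm, ← smul_sub, smul_smul, mul_neg, hh_mul_lamDiv', neg_smul,
        H.bracket_rowSum_below n hi hr, neg_zero]
    · rw [if_neg (by omega), if_pos rfl, if_pos le_rfl]
      have h1 := triSum_mul_rowSum H.serre_f H.serre_e H.fe H.κe n (le_refl r) fun t ht => by
        have := qComm_seg_of_neg_cartan H.κf ht
        split_ifs with htr
        · rwa [show -cartanSeg r r t = -2 by unfold cartanSeg; grind,
            isQParam_qPow.pow_neg_two] at this
        · rwa [show -cartanSeg r r t = -1 by unfold cartanSeg; grind,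
            isQParam_qPow.pow_neg_one] at this
      have h2 := HCompl.hQExp_mul_sub (z := (-lamDiv) • rowSum (qPow (-1)) n e f r) (u := g)
        (d₁ := -triSum (qPow 1) (qPow (-1)) n f e κ r r) (d₂ := κ' * e r) (by
          rw [smul_mul_assoc, mul_smul_comm, ← smul_sub, smul_smul, mul_neg, hh_mul_lamDiv',
            neg_smul, H.rowSum_bracket_self hi]
          abel) (by
          rw [← H.rowSum_comm] at h1
          rw [qPow_neg_two, neg_mul, mul_neg, mul_smul_comm, h1, smul_mul_assoc, smul_neg,
            smul_comm (-lamDiv)]) (by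
          rw [smul_mul_assoc, mul_smul_comm, H.κ'e_mul_rowSum, qPow_neg_two, smul_comm (-lamDiv)])
      rw [sub_neg_eq_add] at h2
      exact h2
    · rw [if_neg (by omega), if_neg (by omega), if_neg (by omega)]
      split_ifs with hr1
      · subst hr1
        have h1 := expRow_mul H.serre_f H.serre_e H.fe (le_refl i) hi H.κe fun t ht => by
          have := qComm_seg_of_neg_cartan H.κf (show i + 1 ≤ t by omega)
          rwa [show -cartanSeg i (i + 1) t = 1 by unfold cartanSeg; grind,
            isQParam_qPow.pow_one] at this
        have h2 : Commute (expRow n f e (i + 1)) g := by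
          refine hQExp_commute ?_
          have : Commute g (rowSum (qPow (-1)) n f e (i + 1)) := by
            refine Commute.sum_right _ _ _ fun t _ => Commute.mul_right ?_ ?_
            · exact commute_seg fun j _ _ => H.gf j (by omega)
            · exact commute_seg fun j _ _ => H.ge j
          rw [smul_mul_assoc, mul_smul_comm, this.eq, sub_self, smul_zero]
        rw [seg_self] at h1
        rw [hrow, mul_add, add_mul, h1, h2.eq]
      · rw [expRow]
        refine (hQExp_commute ?_).eq
        rw [smul_mul_assoc, mul_smul_comm, (H.commute_rowSum_above n (by omega)).eq, sub_self,
          smul_zero]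

end Intertwining

/-- The `q`-exponential of a row sum is the ordered product of the `q`-exponentials of its
terms. -/
theorem expRow_eq_prod {n s : ℕ} {e φ : ℕ → HCompl A} (he : IsSerre (qPow 1) (qPow (-1)) e)
    (hφ : IsSerre (qPow 1) (qPow (-1)) φ) (heφ : ∀ i j, Commute (e i) (φ j)) {m : ℕ}
    (hm : s + m = n) :
    expRow n e φ s = (List.ofFn fun d : Fin m =>
      HCompl.hQExp ((-lamDiv) • (rv (qPow (-1)) e s d * rv (qPow (-1)) φ s d))).prod := by
  have h1 : rowSum (qPow (-1)) n e φ s =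
      ∑ d ∈ Finset.range m, rv (qPow (-1)) e s d * rv (qPow (-1)) φ s d := by
    rw [rowSum, ← hm, Finset.sum_range_add, Finset.sum_eq_zero, zero_add]
    · simp only [seg_add]
    · intro t ht
      rw [seg_eq_zero e (Finset.mem_range.1 ht), zero_mul]
  rw [expRow, h1]
  clear h1 hm
  induction m with
  | zero => simp [hQExp_zero]
  | succ m ih =>
    rw [List.ofFn_succ', List.concat_eq_append, List.prod_append, List.prod_singleton,
      Finset.sum_range_succ, smul_add, HCompl.hQExp_add]
    · simp only [Fin.val_castSucc, Fin.val_last]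
      rw [ih]
    · have hc : Commute (rv (qPow (-1)) e s m) (rv (qPow (-1)) φ s m) := by
        rw [← seg_add, ← seg_add]; exact seg_seg_commute heφ _ _ _ _
      rw [smul_mul_assoc, smul_mul_assoc, mul_smul_comm, mul_smul_comm, Finset.mul_sum,
        Finset.sum_mul]
      simp only [Finset.smul_sum]
      refine Finset.sum_congr rfl fun d hd => ?_
      obtain ⟨f, rfl⟩ := Nat.exists_eq_add_of_lt (Finset.mem_range.1 hd)
      have k1 := (he.rv_mul_rv_row s d f).symm he.mul_eq_one
      have k2 := (hφ.rv_mul_rv_row s d f).symm hφ.mul_eq_one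
      have k3 : ∀ x y, QComm (1 : Kh) (rv (qPow (-1)) e s x) (rv (qPow (-1)) φ s y) := fun x y => by
        rw [← seg_add, ← seg_add]; exact .of_commute (seg_seg_commute heφ _ _ _ _)
      have k4 := (k1.mul_right (k3 _ d)).mul_left (((k3 d _).symm (one_mul 1)).mul_right k2)
      rw [one_mul, mul_one, ← qPow_neg_two] at k4
      have k5 : _ = _ • _ := k4
      rw [k5, smul_comm (-lamDiv) (qPow (-2)), smul_comm (-lamDiv) (qPow (-2))]

end Theta

/-! ### Operations on families with Serre relations -/

section SerreOperations

variable {K T : Type} [CommRing K] [Ring T] [Algebra K T] {q p : K}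

/-- If the elements of two families satisfying the Serre relations commute up to powers of `q`
given by the Cartan integers, then the sum of the families satisfies the Serre relations. -/
theorem IsSerre.add (h : IsQParam q p) {α ε : ℕ → T} (hα : IsSerre q p α) (hε : IsSerre q p ε)
    (hαε : ∀ i j, QComm (h.pow (cartan i j)) (α i) (ε j)) :
    IsSerre q p fun i => α i + ε i where
  toIsQParam := h
  serre i j hij := by
    have hqp := h.mul_eq_one
    have h1 := hα.serre i j hij
    have h2 := hε.serre i j hij
    have hii : α i * ε i = (q * q) • (ε i * α i) := by
      have := hαε i i
      rwa [show cartan i i = 2 by simp [cartan], h.pow_two] at this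
    have hij1 : α i * ε j = p • (ε j * α i) := by
      have := hαε i j
      rwa [show cartan i j = -1 by unfold cartan; grind, h.pow_neg_one] at this
    have hji : α j * ε i = p • (ε i * α j) := by
      have := hαε j i
      rwa [show cartan j i = -1 by unfold cartan; grind, h.pow_neg_one] at this
    have hii' : ∀ z, α i * (ε i * z) = (q * q) • (ε i * (α i * z)) := fun z => by
      rw [← mul_assoc, hii, smul_mul_assoc, mul_assoc]
    have hij' : ∀ z, α i * (ε j * z) = p • (ε j * (α i * z)) := fun z => by
      rw [← mul_assoc, hij1, smul_mul_assoc, mul_assoc]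
    have hji' : ∀ z, α j * (ε i * z) = p • (ε i * (α j * z)) := fun z => by
      rw [← mul_assoc, hji, smul_mul_assoc, mul_assoc]
    rw [← add_zero (0 : T)]
    nth_rw 1 [← h1]
    rw [← h2]
    simp only [pow_two, mul_add, add_mul, mul_assoc, smul_mul_assoc, mul_smul_comm, hii, hii', hij1,
      hij', hji, hji', smul_smul]
    clear hii hii' hij1 hij' hji hji' h1 h2 hαε hij
    match_scalars <;> grind
  comm i j hij := by
    have h1 : ∀ i j, i + 1 < j ∨ j + 1 < i → Commute (α i) (ε j) := fun i j hij => by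
      have := hαε i j
      rw [show cartan i j = 0 by unfold cartan; grind, h.pow_zero] at this
      exact this.commute
    exact ((hα.comm i j hij).add_right (h1 i j (.inl hij))).add_left
      ((h1 j i (.inr hij)).symm.add_right (hε.comm i j hij))

/-- Multiplication of a family satisfying the Serre relations by commuting elements, with which
it commutes up to a symmetric system of scalars. -/
theorem IsSerre.twist {e t : ℕ → T} (he : IsSerre q p e) (w : ℕ → ℕ → K)
    (hw : ∀ i j, w i j = w j i) (ht : ∀ i j, Commute (t i) (t j))
    (hte : ∀ i j, QComm (w i j) (e i) (t j)) : IsSerre q p fun i => t i * e i where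
  toIsQParam := he.toIsQParam
  serre i j hij := by
    have h0 := he.serre i j hij
    have hte' : ∀ i j z, e i * (t j * z) = w i j • (t j * (e i * z)) := fun i j z => by
      have : e i * t j = w i j • (t j * e i) := hte i j
      rw [← mul_assoc, this, smul_mul_assoc, mul_assoc]
    have ht' : ∀ z, t j * (t i * z) = t i * (t j * z) := fun z => by
      rw [← mul_assoc, (ht j i).eq, mul_assoc]
    have h1 := congrArg (fun z => (w i i * w i j * w i j) • (t i * (t i * (t j * z)))) h0
    simp only [mul_zero, smul_zero] at h1
    rw [← h1]
    simp only [pow_two, mul_add, mul_sub, mul_assoc, smul_mul_assoc, mul_smul_comm, hte', ht',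
      smul_smul, hw j i]
    match_scalars <;> ring
  comm i j hij := by
    have h0 := (he.comm i j hij).eq
    have hte' : ∀ i j z, e i * (t j * z) = w i j • (t j * (e i * z)) := fun i j z => by
      have : e i * t j = w i j • (t j * e i) := hte i j
      rw [← mul_assoc, this, smul_mul_assoc, mul_assoc]
    have ht' : ∀ z, t j * (t i * z) = t i * (t j * z) := fun z => by
      rw [← mul_assoc, (ht j i).eq, mul_assoc]
    rw [Commute, SemiconjBy]
    simp only [mul_assoc, mul_smul_comm, hte', ht', h0, hw j i]

theorem IsSerre.smul {e : ℕ → T} (he : IsSerre q p e) (c : K) : IsSerre q p fun i => c • e i where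
  toIsQParam := he.toIsQParam
  serre i j hij := by
    have h1 := congrArg (fun z => (c * c * c) • z) (he.serre i j hij)
    simp only [smul_zero] at h1
    rw [← h1]
    simp only [pow_two, mul_smul_comm, smul_mul_assoc, smul_add, smul_sub, smul_smul]
    match_scalars <;> ring
  comm i j hij := ((he.comm i j hij).smul_right c).smul_left c

theorem IsSerre.neg {e : ℕ → T} (he : IsSerre q p e) : IsSerre q p fun i => -e i := by
  simpa using he.smul (-1)

theorem IsSerre.map {T' : Type} [Ring T'] [Algebra K T'] {e : ℕ → T} (he : IsSerre q p e)
    (f : T →ₐ[K] T') : IsSerre q p fun i => f (e i) where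
  toIsQParam := he.toIsQParam
  serre i j hij := by
    have := congrArg f (he.serre i j hij)
    simpa only [map_add, map_sub, map_smul, map_mul, map_pow, map_zero] using this
  comm i j hij := (he.comm i j hij).map f

theorem IsSerre.op {e : ℕ → T} (he : IsSerre q p e) :
    IsSerre q p fun i => MulOpposite.op (e i) where
  toIsQParam := he.toIsQParam
  serre i j hij := by
    have := congrArg MulOpposite.op (he.serre i j hij)
    rw [← MulOpposite.op_zero, ← this]
    apply MulOpposite.unop_injective
    simp only [MulOpposite.unop_add, MulOpposite.unop_sub, MulOpposite.unop_mul,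
      MulOpposite.unop_pow, MulOpposite.unop_op, MulOpposite.unop_smul, mul_assoc]
    abel
  comm i j hij := (he.comm i j hij).op

theorem rv_neg (e : ℕ → T) (a d : ℕ) :
    rv p (fun i => -e i) a d = (-1 : K) ^ (d + 1) • rv p e a d := by
  induction d generalizing a with
  | zero => simp [rv]
  | succ d ih =>
    simp only [rv, ih, mul_smul_comm, smul_mul_assoc, neg_mul, mul_neg]
    rw [pow_succ _ (d + 1)]
    match_scalars <;> ring

end SerreOperations

/-! ### The Cartan matrix -/

section Cartan

variable {n : ℕ}

theorem cartanMatrix_apply (i j : Fin n) : CartanMatrix.A n i j = cartan i j := by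
  simp only [CartanMatrix.A, cartan, Matrix.of_apply, Fin.ext_iff]

/-- The Cartan matrix as a discrete Laplacian with boundary values zero. -/
theorem sum_cartan_mul (i : ℕ) (hi : i < n) (v : ℕ → ℂ) (hv : v n = 0) :
    ∑ j : Fin n, (cartan i j : ℂ) * v j = 2 * v i - v (i + 1) - if i = 0 then 0 else v (i - 1) := by
  have h1 : ∀ j, (cartan i j : ℂ) * v j = (if j = i then 2 * v i else 0)
      - (if j = i + 1 then v (i + 1) else 0) -
      (if i = 0 then 0 else if j = i - 1 then v (i - 1) else 0) := by
    intro j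
    unfold cartan
    rcases Nat.eq_zero_or_pos i with rfl | h0
    · by_cases h1 : j = 0
      · subst h1; simp
      · by_cases h2 : j = 1
        · subst h2; simp
        · simp [h1, h2, Ne.symm h1, Ne.symm h2]
    · obtain ⟨i, rfl⟩ : ∃ k, i = k + 1 := ⟨i - 1, by omega⟩
      by_cases h1 : j = i
      · subst h1; simp [show ¬ j = j + 1 + 1 by omega]
      · by_cases h2 : j = i + 1
        · subst h2; simp
        · by_cases h3 : j = i + 1 + 1
          · subst h3; simp [show ¬ i + 1 + 1 = i by omega]
          · simp [h1, h2, h3, Ne.symm h2, Ne.symm h3]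
  rw [Fin.sum_univ_eq_sum_range (fun j => (cartan i j : ℂ) * v j) n]
  simp only [h1, Finset.sum_sub_distrib, Finset.sum_ite_eq', Finset.mem_range]
  rw [if_pos hi]
  congr 1
  · split_ifs with h
    · rfl
    · rw [show i + 1 = n by omega, hv]
  · split_ifs with h
    · simp
    · rw [Finset.sum_ite_eq', if_pos (by rw [Finset.mem_range]; omega)]

/-- A vector in the kernel of the Cartan matrix is determined by its first entry, as `v i = (i + 1)
v 0`, and the boundary condition `v n = 0` forces `v 0 = 0`. -/
theorem cartanMatrix_det_ne_zero :
    ((CartanMatrix.A n).map (Int.cast : ℤ → ℂ)).det ≠ 0 := by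
  intro hdet
  obtain ⟨v, hv0, hv⟩ := Matrix.exists_mulVec_eq_zero_iff.2 hdet
  set w : ℕ → ℂ := fun i => if h : i < n then v ⟨i, h⟩ else 0 with hw
  have hwn : w n = 0 := by simp [hw]
  have hrec : ∀ i, i < n → 2 * w i - w (i + 1) - (if i = 0 then 0 else w (i - 1)) = 0 := by
    intro i hi
    rw [← sum_cartan_mul i hi w hwn, ← show _ = (0 : ℂ) from congrFun hv ⟨i, hi⟩]
    simp only [Matrix.mulVec, dotProduct, Matrix.map_apply, cartanMatrix_apply]
    refine Finset.sum_congr rfl fun j _ => ?_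
    simp [hw]
  have hlin : ∀ i, i + 1 ≤ n → w i = (i + 1) * w 0 ∧ w (i + 1) = (i + 2) * w 0 := by
    intro i
    induction i with
    | zero =>
      intro hi
      have := hrec 0 hi
      simp only [if_true] at this
      exact ⟨by push_cast; ring, by push_cast; linear_combination -this⟩
    | succ i ih =>
      intro hi
      obtain ⟨h1, h2⟩ := ih (by omega)
      have := hrec (i + 1) hi
      simp only [Nat.add_eq_zero_iff, one_ne_zero, and_false, if_false, Nat.add_sub_cancel] at this
      refine ⟨by rw [h2]; push_cast; ring, ?_⟩
      push_cast
      linear_combination -this + 2 * h2 - h1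
  rcases Nat.eq_zero_or_pos n with rfl | hn
  · exact hv0 (Subsingleton.elim _ _)
  · obtain ⟨m, rfl⟩ : ∃ m, n = m + 1 := ⟨n - 1, by omega⟩
    have h0 : w 0 = 0 := by
      have := (hlin m le_rfl).2
      rw [hwn] at this
      refine (mul_eq_zero.1 this.symm).resolve_left ?_
      exact_mod_cast (show m + 2 ≠ 0 by omega)
    refine hv0 (funext fun i => ?_)
    have := (hlin i (by omega)).1
    rw [h0, mul_zero] at this
    exact (dif_pos i.2).symm.trans this

/-- The matrix `κ` is twice the inverse of the Cartan matrix. -/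
theorem sum_kappa_mul_cartan (i j : Fin n) :
    ∑ m : Fin n, Uh.kappa n i m * (cartan m j : ℂ) = if i = j then 2 else 0 := by
  have h1 : Uh.kappa n * (CartanMatrix.A n).map (Int.cast : ℤ → ℂ) = (2 : ℂ) • 1 := by
    rw [Uh.kappa, smul_mul_assoc, Matrix.nonsing_inv_mul _ (isUnit_iff_ne_zero.2
      cartanMatrix_det_ne_zero)]
  have h2 := congrFun (congrFun h1 i) j
  simpa [Matrix.mul_apply, cartanMatrix_apply, Matrix.one_apply] using h2

theorem sum_cartan_mul_kappa (i j : Fin n) :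
    ∑ m : Fin n, (cartan i m : ℂ) * Uh.kappa n m j = if i = j then 2 else 0 := by
  have h1 : (CartanMatrix.A n).map (Int.cast : ℤ → ℂ) * Uh.kappa n = (2 : ℂ) • 1 := by
    rw [Uh.kappa, mul_smul_comm, Matrix.mul_nonsing_inv _ (isUnit_iff_ne_zero.2
      cartanMatrix_det_ne_zero)]
  have h2 := congrFun (congrFun h1 i) j
  simpa [Matrix.mul_apply, cartanMatrix_apply, Matrix.one_apply] using h2

end Cartan

/-! ### Extension of finite families by zero -/

section ExtZero

variable {K T : Type} [CommRing K] [Ring T] [Algebra K T] {n : ℕ}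

/-- The extension by zero of a family indexed by `Fin n` to a family indexed by `ℕ`. The
Serre relations are inherited by this extension (`isSerre_extZero`), which makes sums of consecutive
indices harmless. -/
def extZero (f : Fin n → T) (i : ℕ) : T := if h : i < n then f ⟨i, h⟩ else 0

theorem extZero_of_lt (f : Fin n → T) {i : ℕ} (h : i < n) : extZero f i = f ⟨i, h⟩ := dif_pos h

theorem extZero_of_ge (f : Fin n → T) {i : ℕ} (h : ¬ i < n) : extZero f i = 0 := dif_neg h

theorem extZero_val (f : Fin n → T) (i : Fin n) : extZero f i = f i := dif_pos i.2

theorem extZero_add (f g : Fin n → T) :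
    extZero (fun i => f i + g i) = fun i => extZero f i + extZero g i := by
  ext i
  unfold extZero
  split_ifs <;> simp

theorem extZero_mul (f g : Fin n → T) :
    extZero (fun i => f i * g i) = fun i => extZero f i * extZero g i := by
  ext i
  unfold extZero
  split_ifs <;> simp

theorem extZero_smul (c : K) (f : Fin n → T) :
    extZero (fun i => c • f i) = fun i => c • extZero f i := by
  ext i
  unfold extZero
  split_ifs <;> simp

theorem extZero_neg (f : Fin n → T) : extZero (fun i => -f i) = fun i => -extZero f i := by
  ext i
  unfold extZero
  split_ifs <;> simp

theorem extZero_map {F T' : Type} [Ring T'] [FunLike F T T'] [ZeroHomClass F T T'] (φ : F)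
    (f : Fin n → T) : extZero (fun i => φ (f i)) = fun i => φ (extZero f i) := by
  ext i
  unfold extZero
  split_ifs <;> simp

theorem commute_extZero {x : T} {f : Fin n → T} (h : ∀ i, Commute x (f i)) (i : ℕ) :
    Commute x (extZero f i) := by
  unfold extZero
  split_ifs
  · exact h _
  · exact Commute.zero_right _

theorem qComm_extZero_right {x : T} {f : Fin n → T} {c : ℕ → K}
    (h : ∀ i : Fin n, QComm (c i) x (f i)) (i : ℕ) : QComm (c i) x (extZero f i) := by
  unfold extZero
  split_ifs with hi
  · exact h ⟨i, hi⟩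
  · simp [QComm]

theorem qComm_extZero {f g : Fin n → T} {c : ℕ → ℕ → K}
    (h : ∀ i j : Fin n, QComm (c i j) (f i) (g j)) (i j : ℕ) :
    QComm (c i j) (extZero f i) (extZero g j) := by
  by_cases hi : i < n
  · rw [extZero_of_lt f hi]
    exact qComm_extZero_right (c := c i) (h ⟨i, hi⟩) j
  · simp [extZero_of_ge f hi, QComm]

/-- The Serre relations that involve an index outside of `Fin n` are trivial. -/
theorem isSerre_extZero {q p : K} (h : IsQParam q p) {f : Fin n → T}
    (hs : ∀ i j : Fin n, (i : ℕ) + 1 = j ∨ (j : ℕ) + 1 = i →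
      f i ^ 2 * f j - (q + p) • (f i * f j * f i) + f j * f i ^ 2 = 0)
    (hc : ∀ i j : Fin n, (i : ℕ) + 1 < j → Commute (f i) (f j)) : IsSerre q p (extZero f) where
  toIsQParam := h
  serre i j hij := by
    by_cases hi : i < n
    · by_cases hj : j < n
      · rw [extZero_of_lt f hi, extZero_of_lt f hj]
        exact hs ⟨i, hi⟩ ⟨j, hj⟩ hij
      · simp [extZero_of_ge f hj]
    · simp [extZero_of_ge f hi]
  comm i j hij := by
    by_cases hi : i < n
    · by_cases hj : j < n
      · rw [extZero_of_lt f hi, extZero_of_lt f hj]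
        exact hc ⟨i, hi⟩ ⟨j, hj⟩ hij
      · simp [extZero_of_ge f hj]
    · simp [extZero_of_ge f hi]

theorem IsSerre.extZero_twist {q p : K} {e t : Fin n → T} (he : IsSerre q p (extZero e))
    (w : ℕ → ℕ → K) (hw : ∀ i j, w i j = w j i) (ht : ∀ i j, Commute (t i) (t j))
    (hte : ∀ i j : Fin n, QComm (w i j) (e i) (t j)) :
    IsSerre q p (extZero fun i => t i * e i) := by
  rw [extZero_mul]
  exact he.twist w hw
    (fun i j => commute_extZero (fun j => (commute_extZero (fun i => ht j i) i).symm) j)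
    (qComm_extZero hte)

theorem IsSerre.extZero_map {q p : K} {T' : Type} [Ring T'] [Algebra K T'] {e : Fin n → T}
    (he : IsSerre q p (extZero e)) (φ : T →ₐ[K] T') :
    IsSerre q p (extZero fun i => φ (e i)) := by
  rw [QuantumSl.extZero_map φ]
  exact he.map φ

end ExtZero

/-! ### Weight vectors -/

section HasWeight

variable {K T : Type} [CommRing K] [Ring T] [Algebra K T] {a b x y : T} {c d : K}

/-- The element `x` is an eigenvector of the commutator with `a`, with eigenvalue `c`. -/
def HasWeight (a : T) (c : K) (x : T) : Prop := a * x - x * a = c • x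

theorem HasWeight.of_commute (h : Commute a x) : HasWeight a (0 : K) x := by
  rw [HasWeight, h.eq, sub_self, zero_smul]

theorem HasWeight.mul (hx : HasWeight a c x) (hy : HasWeight a d y) :
    HasWeight a (c + d) (x * y) := by
  rw [HasWeight] at *
  rw [add_smul, ← smul_mul_assoc, ← mul_smul_comm, ← hx, ← hy]
  noncomm_ring

theorem HasWeight.add (hx : HasWeight a c x) (hy : HasWeight a c y) : HasWeight a c (x + y) := by
  rw [HasWeight] at *
  rw [smul_add, ← hx, ← hy]
  noncomm_ring

theorem HasWeight.add_left (hx : HasWeight a c x) (hy : HasWeight b d x) :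
    HasWeight (a + b) (c + d) x := by
  rw [HasWeight] at *
  rw [add_smul, ← hx, ← hy]
  noncomm_ring

theorem HasWeight.smul (r : K) (hx : HasWeight a c x) : HasWeight a c (r • x) := by
  rw [HasWeight] at *
  rw [mul_smul_comm, smul_mul_assoc, ← smul_sub, hx, smul_comm]

theorem HasWeight.map {T' : Type} [Ring T'] [Algebra K T'] (φ : T →ₐ[K] T')
    (hx : HasWeight a c x) : HasWeight (φ a) c (φ x) := by
  have := congrArg φ hx
  rwa [map_sub, map_mul, map_mul, map_smul] at this

end HasWeight

/-! ### The universal property of the quantized enveloping algebra -/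

section UniversalProperty

variable {n : ℕ} {B : Type} [Ring B] [Algebra Kh B]

/-- Elements of a complete algebra that satisfy the defining relations of `U_h(sl (n + 1))`. -/
structure IsRep (X H Y : Fin n → HCompl B) : Prop where
  HH : ∀ i j, Commute (H i) (H j)
  Hx : ∀ i j : Fin n, HasWeight (H i) (PowerSeries.C (cartan i j : ℂ)) (X j)
  Hy : ∀ i j : Fin n, HasWeight (H i) (PowerSeries.C (-cartan i j : ℂ)) (Y j)
  xy : ∀ i j, X i * Y j - Y j * X i = if i = j then HCompl.qBracket (H i) else 0
  serre_x : IsSerre (qPow 1) (qPow (-1)) (extZero X)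
  serre_y : IsSerre (qPow 1) (qPow (-1)) (extZero Y)

theorem zsmul_eq_C_smul {V : Type} [AddCommGroup V] [Module Kh V] (m : ℤ) (v : V) :
    m • v = (PowerSeries.C (m : ℂ) : Kh) • v := by
  rw [map_intCast, Int.cast_smul_eq_zsmul]

theorem toUh_eq_of_rel {a b : FreeCompl n} (h : Rel n a b) : toUh n a = toUh n b :=
  congrArg (HCompl.of (PreU n)) (RingQuot.mkAlgHom_rel Kh h)

namespace Uh

theorem isRep : IsRep (x (n := n)) H y where
  HH i j := by
    have := toUh_eq_of_rel (Rel.HH i j)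
    rwa [map_mul, map_mul] at this
  Hx i j := by
    have := toUh_eq_of_rel (Rel.Hx i j)
    rwa [map_sub, map_mul, map_mul, map_zsmul, zsmul_eq_C_smul, cartanMatrix_apply] at this
  Hy i j := by
    have := toUh_eq_of_rel (Rel.Hy i j)
    rwa [map_sub, map_mul, map_mul, map_zsmul, zsmul_eq_C_smul, cartanMatrix_apply,
      Int.cast_neg] at this
  xy i j := by
    have := toUh_eq_of_rel (Rel.xy i j)
    rwa [map_sub, map_mul, map_mul, apply_ite (toUh n), map_zero, HCompl.map_qBracket] at this
  serre_x := isSerre_extZero isQParam_qPow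
    (fun i j hij => by
      have := toUh_eq_of_rel (Rel.serre_x i j hij)
      simp only [map_add, map_sub, map_smul, map_mul, map_pow, map_zero] at this
      exact this)
    (fun i j hij => by
      have := toUh_eq_of_rel (Rel.comm_x i j (.inl hij))
      rwa [map_mul, map_mul] at this)
  serre_y := isSerre_extZero isQParam_qPow
    (fun i j hij => by
      have := toUh_eq_of_rel (Rel.serre_y i j hij)
      simp only [map_add, map_sub, map_smul, map_mul, map_pow, map_zero] at this
      exact this)
    (fun i j hij => by
      have := toUh_eq_of_rel (Rel.comm_y i j (.inl hij))
      rwa [map_mul, map_mul] at this)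

/-- Two `ℂ⟦h⟧`-linear maps are equal if they agree on the generators and if the set where they
agree is closed under multiplication. -/
theorem linearMap_ext {φ ψ : Uh n →ₗ[Kh] HCompl B} (h1 : φ 1 = ψ 1)
    (hmul : ∀ a b, φ a = ψ a → φ b = ψ b → φ (a * b) = ψ (a * b))
    (hx : ∀ i, φ (x i) = ψ (x i)) (hH : ∀ i, φ (H i) = ψ (H i)) (hy : ∀ i, φ (y i) = ψ (y i)) :
    φ = ψ := by
  have key : φ ∘ₗ (toUh n).toLinearMap = ψ ∘ₗ (toUh n).toLinearMap := by
    refine HCompl.linearMap_ext fun w => ?_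
    induction w using FreeAlgebra.induction with
    | grade0 r =>
      simp only [LinearMap.comp_apply, AlgHom.toLinearMap_apply,
        Algebra.algebraMap_eq_smul_one, map_smul, map_one, h1]
    | grade1 g =>
      cases g with
      | x i => exact hx i
      | H i => exact hH i
      | y i => exact hy i
    | mul a b ha hb =>
      simp only [LinearMap.comp_apply, AlgHom.toLinearMap_apply, map_mul] at *
      exact hmul _ _ ha hb
    | add a b ha hb => rw [map_add, map_add, map_add, ha, hb]
  refine HCompl.linearMap_ext fun a => ?_
  obtain ⟨w, rfl⟩ := RingQuot.mkAlgHom_surjective Kh (Rel n) a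
  exact LinearMap.congr_fun key w

theorem algHom_ext {φ ψ : Uh n →ₐ[Kh] HCompl B} (hx : ∀ i, φ (x i) = ψ (x i))
    (hH : ∀ i, φ (H i) = ψ (H i)) (hy : ∀ i, φ (y i) = ψ (y i)) : φ = ψ :=
  AlgHom.toLinearMap_injective <| linearMap_ext (by simp)
    (fun a b ha hb => by
      simp only [AlgHom.toLinearMap_apply, map_mul] at *
      rw [ha, hb]) hx hH hy

variable {X H' Y : Fin n → HCompl B}

/-- The values on the generators of the homomorphism determined by `X`, `H'` and `Y`. -/
def genMap (X H' Y : Fin n → HCompl B) : Gen n → HCompl B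
  | .x i => X i
  | .H i => H' i
  | .y i => Y i

theorem extend_genMap (g : Gen n) :
    HCompl.extend (FreeAlgebra.lift Kh (genMap X H' Y)) (gen g) = genMap X H' Y g := by
  rw [gen, HCompl.extend_of, FreeAlgebra.lift_ι_apply]

theorem extend_genMap_eq_of_rel (h : IsRep X H' Y) ⦃a b : FreeCompl n⦄ (hab : Rel n a b) :
    HCompl.extend (FreeAlgebra.lift Kh (genMap X H' Y)) a =
      HCompl.extend (FreeAlgebra.lift Kh (genMap X H' Y)) b := by
  cases hab with
  | HH i j => simpa only [map_mul, extend_genMap, genMap] using (h.HH i j).eq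
  | Hx i j =>
    simp only [map_sub, map_mul, map_smul, extend_genMap, genMap, zsmul_eq_C_smul,
      cartanMatrix_apply]
    exact h.Hx i j
  | Hy i j =>
    simp only [map_sub, map_mul, map_smul, extend_genMap, genMap, zsmul_eq_C_smul,
      cartanMatrix_apply, Int.cast_neg]
    exact h.Hy i j
  | xy i j =>
    simp only [map_sub, map_mul, extend_genMap, genMap, apply_ite (HCompl.extend _), map_zero,
      HCompl.map_qBracket]
    exact h.xy i j
  | serre_x i j hij =>
    have := h.serre_x.serre i j hij
    simpa only [map_add, map_sub, map_smul, map_mul, map_pow, map_zero, extend_genMap,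
      genMap, extZero_val] using this
  | serre_y i j hij =>
    have := h.serre_y.serre i j hij
    simpa only [map_add, map_sub, map_smul, map_mul, map_pow, map_zero, extend_genMap,
      genMap, extZero_val] using this
  | comm_x i j hij =>
    have := h.serre_x.comm' hij
    simpa only [map_mul, extend_genMap, genMap, extZero_val] using this.eq
  | comm_y i j hij =>
    have := h.serre_y.comm' hij
    simpa only [map_mul, extend_genMap, genMap, extZero_val] using this.eq

/-- The homomorphism from `U_h(sl (n + 1))` to a complete algebra determined by elements that
satisfy the defining relations. -/
def lift (h : IsRep X H' Y) : Uh n →ₐ[Kh] HCompl B :=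
  HCompl.extend (RingQuot.liftAlgHom Kh
    ⟨HCompl.extend (FreeAlgebra.lift Kh (genMap X H' Y)), extend_genMap_eq_of_rel h⟩)

theorem lift_toUh_gen (h : IsRep X H' Y) (g : Gen n) :
    lift h (toUh n (gen g)) = genMap X H' Y g := by
  have h1 : lift h (toUh n (gen g)) = _ := HCompl.extend_of _ (RingQuot.mkAlgHom Kh (Rel n) (gen g))
  exact h1.trans ((RingQuot.liftAlgHom_mkAlgHom_apply _ _ _ _).trans (extend_genMap g))

theorem lift_x (h : IsRep X H' Y) (i : Fin n) : lift h (x i) = X i := lift_toUh_gen h _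

theorem lift_H (h : IsRep X H' Y) (i : Fin n) : lift h (H i) = H' i := lift_toUh_gen h _

theorem lift_y (h : IsRep X H' Y) (i : Fin n) : lift h (y i) = Y i := lift_toUh_gen h _

end Uh

end UniversalProperty

/-! ### Tensor legs -/

section Legs

variable {A B : Type} [Ring A] [Algebra Kh A] [Ring B] [Algebra Kh B]

/-- `a ↦ a ⊗ 1`, with values in the completed tensor square. -/
def inl : A →ₐ[Kh] T2 A := (HCompl.of (A ⊗[Kh] A)).comp Algebra.TensorProduct.includeLeft

/-- `a ↦ 1 ⊗ a`, with values in the completed tensor square. -/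
def inr : A →ₐ[Kh] T2 A := (HCompl.of (A ⊗[Kh] A)).comp Algebra.TensorProduct.includeRight

/-- `a ↦ a ⊗ 1 ⊗ 1`, with values in the completed tensor cube. -/
def in₁ : A →ₐ[Kh] T3 A := (HCompl.map (leg12 A)).comp inl

/-- `a ↦ 1 ⊗ a ⊗ 1`, with values in the completed tensor cube. -/
def in₂ : A →ₐ[Kh] T3 A := (HCompl.map (leg12 A)).comp inr

/-- `a ↦ 1 ⊗ 1 ⊗ a`, with values in the completed tensor cube. -/
def in₃ : A →ₐ[Kh] T3 A := (HCompl.map (leg23 A)).comp inr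

theorem inl_apply (a : A) : inl a = HCompl.of (A ⊗[Kh] A) (a ⊗ₜ[Kh] 1) := rfl

theorem inr_apply (a : A) : inr a = HCompl.of (A ⊗[Kh] A) (1 ⊗ₜ[Kh] a) := rfl

theorem tmul_eq (a b : A) : tmul a b = inl a * inr b := by
  rw [tmul, inl, inr, AlgHom.comp_apply, AlgHom.comp_apply, ← map_mul,
    Algebra.TensorProduct.includeLeft_apply, Algebra.TensorProduct.includeRight_apply,
    Algebra.TensorProduct.tmul_mul_tmul, one_mul, mul_one]

theorem commute_inl_inr (a b : A) : Commute (inl a) (inr b) := by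
  rw [inl, inr, AlgHom.comp_apply, AlgHom.comp_apply]
  refine Commute.map ?_ _
  simp [Commute, SemiconjBy]

theorem tmul_eq' (a b : A) : tmul a b = inr b * inl a := by
  rw [tmul_eq, (commute_inl_inr a b).eq]

theorem twist_inl (a : A) : twist (inl a) = inr a := HCompl.map_of _ _

theorem twist_inr (a : A) : twist (inr a) = inl a := HCompl.map_of _ _

theorem map_leg12_inl (a : A) : HCompl.map (leg12 A) (inl a) = in₁ a := rfl

theorem map_leg12_inr (a : A) : HCompl.map (leg12 A) (inr a) = in₂ a := rfl

theorem map_leg13_inl (a : A) : HCompl.map (leg13 A) (inl a) = in₁ a := by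
  rw [in₁, AlgHom.comp_apply, inl, AlgHom.comp_apply, HCompl.map_of, HCompl.map_of]
  simp [leg12, leg13]

theorem map_leg13_inr (a : A) : HCompl.map (leg13 A) (inr a) = in₃ a := by
  rw [in₃, AlgHom.comp_apply, inr, AlgHom.comp_apply, HCompl.map_of, HCompl.map_of]
  simp [leg23, leg13]

theorem map_leg23_inl (a : A) : HCompl.map (leg23 A) (inl a) = in₂ a := by
  rw [in₂, AlgHom.comp_apply, inl, inr, AlgHom.comp_apply, AlgHom.comp_apply, HCompl.map_of,
    HCompl.map_of]
  simp [leg23, leg12]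

theorem map_leg23_inr (a : A) : HCompl.map (leg23 A) (inr a) = in₃ a := rfl

theorem commute_in₁_in₂ (a b : A) : Commute (in₁ a) (in₂ b) :=
  (commute_inl_inr a b).map (HCompl.map (leg12 A))

theorem commute_in₂_in₃ (a b : A) : Commute (in₂ a) (in₃ b) := by
  rw [← map_leg23_inl, ← map_leg23_inr]
  exact (commute_inl_inr a b).map _

theorem commute_in₁_in₃ (a b : A) : Commute (in₁ a) (in₃ b) := by
  rw [← map_leg13_inl, ← map_leg13_inr]
  exact (commute_inl_inr a b).map _

variable (D : A →ₐ[Kh] T2 A)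

theorem mapId_inl (a : A) : mapId D (inl a) = HCompl.map (leg12 A) (D a) := by
  rw [mapId, inl, AlgHom.comp_apply, HCompl.extend_of]
  exact (Algebra.TensorProduct.lift_tmul _ _ _ _ _).trans (by
    rw [map_one, mul_one, AlgHom.comp_apply])

theorem mapId_inr (a : A) : mapId D (inr a) = in₃ a := by
  rw [mapId, inr, AlgHom.comp_apply, HCompl.extend_of, in₃, AlgHom.comp_apply, inr,
    AlgHom.comp_apply, HCompl.map_of]
  exact (Algebra.TensorProduct.lift_tmul _ _ _ _ _).trans (by
    rw [map_one, one_mul, leg23, Algebra.TensorProduct.includeRight_apply,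
      Algebra.TensorProduct.map_tmul, map_one]
    rfl)

theorem idMap_inl (a : A) : idMap D (inl a) = in₁ a := by
  rw [idMap, inl, AlgHom.comp_apply, HCompl.extend_of, in₁, AlgHom.comp_apply, inl,
    AlgHom.comp_apply, HCompl.map_of]
  exact (Algebra.TensorProduct.lift_tmul _ _ _ _ _).trans (by simp)

theorem idMap_inr (a : A) : idMap D (inr a) = HCompl.map (leg23 A) (D a) := by
  rw [idMap, inr, AlgHom.comp_apply, HCompl.extend_of]
  exact (Algebra.TensorProduct.lift_tmul _ _ _ _ _).trans (by
    rw [map_one, one_mul, AlgHom.comp_apply])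

end Legs

/-- An element of weight `d` for `a` commutes with `exp (c h a)` up to `q ^ (2 c d)`. -/
theorem HasWeight.qComm {A : Type} [Ring A] [Algebra Kh A] {a x : HCompl A} {d : ℂ}
    (h : HasWeight a (PowerSeries.C d) x) (c : ℂ) :
    QComm (qPow (2 * c * d)) (HCompl.hExp c a) x := HCompl.hExp_mul_of_commutator c d h

theorem QComm.of_eq {K T : Type} [CommRing K] [Ring T] [Algebra K T] {c d : K} {x y : T}
    (h : QComm c x y) (hcd : c = d) : QComm d x y := hcd ▸ h

theorem QComm.map {K T T' : Type} [CommRing K] [Ring T] [Algebra K T] [Ring T'] [Algebra K T']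
    {c : K} {x y : T} (h : QComm c x y) (φ : T →ₐ[K] T') : QComm c (φ x) (φ y) := by
  have := congrArg φ h
  rwa [map_mul, map_smul, map_mul] at this

namespace Uh

variable {n : ℕ}

theorem k_x (i j : Fin n) : QComm (qPow (cartan i j / 2)) (k i) (x j) :=
  ((isRep.Hx i j).qComm (1 / 4)).of_eq (by congr 1; ring)

theorem kbar_x (i j : Fin n) : QComm (qPow (-(cartan i j / 2))) (kbar i) (x j) :=
  ((isRep.Hx i j).qComm (-1 / 4)).of_eq (by congr 1; ring)

theorem k_y (i j : Fin n) : QComm (qPow (-(cartan i j / 2))) (k i) (y j) :=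
  ((isRep.Hy i j).qComm (1 / 4)).of_eq (by congr 1; ring)

theorem kbar_y (i j : Fin n) : QComm (qPow (cartan i j / 2)) (kbar i) (y j) :=
  ((isRep.Hy i j).qComm (-1 / 4)).of_eq (by congr 1; ring)

theorem x_k (i j : Fin n) : QComm (qPow (-(cartan i j / 2))) (x i) (k j) := by
  have := (k_x j i).symm (qPow_mul_qPow_neg _)
  rwa [cartan_comm] at this

theorem x_kbar (i j : Fin n) : QComm (qPow (cartan i j / 2)) (x i) (kbar j) := by
  have := (kbar_x j i).symm (d := qPow (cartan j i / 2)) (by rw [mul_comm, qPow_mul_qPow_neg])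
  rwa [cartan_comm] at this

theorem y_kbar (i j : Fin n) : QComm (qPow (-(cartan i j / 2))) (y i) (kbar j) := by
  have := (kbar_y j i).symm (qPow_mul_qPow_neg _)
  rwa [cartan_comm] at this

theorem y_k (i j : Fin n) : QComm (qPow (cartan i j / 2)) (y i) (k j) := by
  have := (k_y j i).symm (d := qPow (cartan j i / 2)) (by rw [mul_comm, qPow_mul_qPow_neg])
  rwa [cartan_comm] at this

theorem commute_hExp (c d : ℂ) (i j : Fin n) :
    Commute (HCompl.hExp c (H i)) (HCompl.hExp d (H j)) :=
  HCompl.hExp_commute d (HCompl.hExp_commute c (isRep.HH i j).symm).symm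

theorem commute_k (i j : Fin n) : Commute (k i) (k j) := commute_hExp _ _ i j

theorem commute_kbar (i j : Fin n) : Commute (kbar i) (kbar j) := commute_hExp _ _ i j

theorem commute_H_k (i j : Fin n) : Commute (H i) (k j) :=
  HCompl.hExp_commute _ (isRep.HH i j)

theorem commute_H_kbar (i j : Fin n) : Commute (H i) (kbar j) :=
  HCompl.hExp_commute _ (isRep.HH i j)

theorem k_mul_kbar (i : Fin n) : k i * kbar i = 1 := by
  rw [k, kbar, neg_div]
  exact HCompl.hExp_mul_hExp_neg _ _

theorem kbar_mul_k (i : Fin n) : kbar i * k i = 1 := by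
  rw [← k_mul_kbar i]
  exact (commute_hExp _ _ _ _).eq

/-! ### The coproduct -/

/-- The coproduct of `x i`. -/
def comulX (i : Fin n) : T2 (Uh n) := inr (k i) * inl (x i) + inl (kbar i) * inr (x i)

/-- The coproduct of `y i`. -/
def comulY (i : Fin n) : T2 (Uh n) := inl (kbar i) * inr (y i) + inr (k i) * inl (y i)

/-- The coproduct of `H i`. -/
def comulH (i : Fin n) : T2 (Uh n) := inl (H i) + inr (H i)

theorem isSerre_comulX : IsSerre (qPow 1) (qPow (-1)) (extZero (comulX (n := n))) := by
  unfold comulX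
  rw [extZero_add]
  refine IsSerre.add isQParam_qPow ?_ ?_ ?_
  · exact (isRep.serre_x.extZero_map inl).extZero_twist (fun _ _ => 1) (fun _ _ => rfl)
      (fun i j => (commute_hExp _ _ i j).map inr) fun i j => .of_commute (commute_inl_inr _ _)
  · exact (isRep.serre_x.extZero_map inr).extZero_twist (fun _ _ => 1) (fun _ _ => rfl)
      (fun i j => (commute_hExp _ _ i j).map inl) fun i j => .of_commute (commute_inl_inr _ _).symm
  · refine qComm_extZero (c := fun i j => isQParam_qPow.pow (cartan i j)) fun i j => ?_
    rw [isQParam_pow]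
    refine QComm.of_eq (((QComm.of_commute (commute_inl_inr _ _).symm).mul_right
      ((k_x i j).map inr)).mul_left (((x_kbar i j).map inl).mul_right
        (.of_commute (commute_inl_inr _ _)))) ?_
    rw [one_mul, mul_one, ← qPow_add]
    congr 1
    ring

theorem isSerre_comulY : IsSerre (qPow 1) (qPow (-1)) (extZero (comulY (n := n))) := by
  unfold comulY
  rw [extZero_add]
  refine IsSerre.add isQParam_qPow ?_ ?_ ?_
  · exact (isRep.serre_y.extZero_map inr).extZero_twist (fun _ _ => 1) (fun _ _ => rfl)
      (fun i j => (commute_hExp _ _ i j).map inl) fun i j => .of_commute (commute_inl_inr _ _).symm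
  · exact (isRep.serre_y.extZero_map inl).extZero_twist (fun _ _ => 1) (fun _ _ => rfl)
      (fun i j => (commute_hExp _ _ i j).map inr) fun i j => .of_commute (commute_inl_inr _ _)
  · refine qComm_extZero (c := fun i j => isQParam_qPow.pow (cartan i j)) fun i j => ?_
    rw [isQParam_pow]
    refine QComm.of_eq (((QComm.of_commute (commute_inl_inr _ _)).mul_right
      ((kbar_y i j).map inl)).mul_left (((y_k i j).map inr).mul_right
        (.of_commute (commute_inl_inr _ _).symm))) ?_
    rw [one_mul, mul_one, ← qPow_add]
    congr 1
    ring

theorem comulX_mul_comulY (i j : Fin n) :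
    comulX i * comulY j - comulY j * comulX i =
      inr (k i * k j) * inl (x i * y j - y j * x i) +
        inl (kbar i * kbar j) * inr (x i * y j - y j * x i) := by
  have hc : ∀ a b : Uh n, inl a * inr b = inr b * inl a := fun a b => (commute_inl_inr a b).eq
  have h1 : Commute (inr (k i) * inl (x i)) (inl (kbar j) * inr (y j)) := by
    refine QComm.commute (((QComm.of_commute (commute_inl_inr _ _).symm).mul_right
      ((k_y i j).map inr)).mul_left (((x_kbar i j).map inl).mul_right
        (.of_commute (commute_inl_inr _ _))) |>.of_eq ?_)
    rw [one_mul, mul_one, mul_comm, qPow_mul_qPow_neg]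
  have h2 : Commute (inl (kbar i) * inr (x i)) (inr (k j) * inl (y j)) := by
    refine QComm.commute (((QComm.of_commute (commute_inl_inr _ _)).mul_right
      ((kbar_y i j).map inl)).mul_left (((x_k i j).map inr).mul_right
        (.of_commute (commute_inl_inr _ _).symm)) |>.of_eq ?_)
    rw [one_mul, mul_one, qPow_mul_qPow_neg]
  have h3 : ∀ a b c d : Uh n, inr a * inl b * (inr c * inl d) = inr (a * c) * inl (b * d) := by
    intro a b c d
    rw [map_mul, map_mul, mul_assoc, ← mul_assoc (inl b), hc, mul_assoc, mul_assoc]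
  have h4 : ∀ a b c d : Uh n, inl a * inr b * (inl c * inr d) = inl (a * c) * inr (b * d) := by
    intro a b c d
    rw [map_mul, map_mul, mul_assoc, ← mul_assoc (inr b), ← hc, mul_assoc, mul_assoc]
  rw [comulX, comulY, add_mul, mul_add, mul_add, mul_add, add_mul, add_mul, h1.eq, h2.eq, h3, h3,
    h4, h4, (commute_k j i).eq, (commute_kbar j i).eq, map_sub, map_sub, mul_sub, mul_sub]
  abel

/-- The elements to which the coproduct sends the generators satisfy the defining relations. -/
theorem isRep_comul : IsRep (comulX (n := n)) comulH comulY where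
  HH i j := (((isRep.HH i j).map inl).add_right (commute_inl_inr _ _)).add_left
    ((commute_inl_inr _ _).symm.add_right ((isRep.HH i j).map inr))
  Hx i j := by
    have h1 := (HasWeight.of_commute (K := Kh) (commute_inl_inr (H i) (k j))).mul
      ((isRep.Hx i j).map inl)
    have h2 := (HasWeight.of_commute (K := Kh) ((commute_H_k i j).map inr)).mul
      (HasWeight.of_commute (commute_inl_inr (x j) (H i)).symm)
    have h3 := (HasWeight.of_commute (K := Kh) ((commute_H_kbar i j).map inl)).mul
      (HasWeight.of_commute (commute_inl_inr (H i) (x j)))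
    have h4 := (HasWeight.of_commute (K := Kh) (commute_inl_inr (kbar j) (H i)).symm).mul
      ((isRep.Hx i j).map inr)
    simp only [add_zero, zero_add] at h1 h2 h3 h4
    have h5 := h1.add_left h2
    have h6 := h3.add_left h4
    rw [add_zero] at h5
    rw [zero_add] at h6
    exact h5.add h6
  Hy i j := by
    have h1 := (HasWeight.of_commute (K := Kh) (commute_inl_inr (H i) (k j))).mul
      ((isRep.Hy i j).map inl)
    have h2 := (HasWeight.of_commute (K := Kh) ((commute_H_k i j).map inr)).mul
      (HasWeight.of_commute (commute_inl_inr (y j) (H i)).symm)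
    have h3 := (HasWeight.of_commute (K := Kh) ((commute_H_kbar i j).map inl)).mul
      (HasWeight.of_commute (commute_inl_inr (H i) (y j)))
    have h4 := (HasWeight.of_commute (K := Kh) (commute_inl_inr (kbar j) (H i)).symm).mul
      ((isRep.Hy i j).map inr)
    simp only [add_zero, zero_add] at h1 h2 h3 h4
    have h5 := h1.add_left h2
    have h6 := h3.add_left h4
    rw [add_zero] at h5
    rw [zero_add] at h6
    exact h6.add h5
  xy i j := by
    rw [comulX_mul_comulY, isRep.xy]
    split_ifs with hij
    · subst hij
      rw [comulH, HCompl.qBracket_add (commute_inl_inr _ _), HCompl.map_qBracket,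
        HCompl.map_qBracket, k, kbar, HCompl.hExp_mul_hExp, HCompl.hExp_mul_hExp,
        HCompl.map_hExp, HCompl.map_hExp, show (1 / 4 + 1 / 4 : ℂ) = 1 / 2 by norm_num,
        show (-1 / 4 + -1 / 4 : ℂ) = -1 / 2 by norm_num]
      congr 1
      rw [← HCompl.map_qBracket, ← HCompl.map_hExp, (commute_inl_inr _ _).eq]
    · simp
  serre_x := isSerre_comulX
  serre_y := isSerre_comulY

/-- The coproduct of `U_h(sl (n + 1))`. -/
def comul : Uh n →ₐ[Kh] T2 (Uh n) := lift isRep_comul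

theorem comul_x (i : Fin n) : comul (x i) = inr (k i) * inl (x i) + inl (kbar i) * inr (x i) :=
  lift_x _ i

theorem comul_y (i : Fin n) : comul (y i) = inl (kbar i) * inr (y i) + inr (k i) * inl (y i) :=
  lift_y _ i

theorem comul_H (i : Fin n) : comul (H i) = inl (H i) + inr (H i) := lift_H _ i

theorem comul_hExp (c : ℂ) (i : Fin n) :
    comul (HCompl.hExp c (H i)) = inl (HCompl.hExp c (H i)) * inr (HCompl.hExp c (H i)) := by
  rw [HCompl.map_hExp, comul_H, HCompl.hExp_add (commute_inl_inr _ _), HCompl.map_hExp,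
    HCompl.map_hExp]

theorem comul_k (i : Fin n) : comul (k i) = inl (k i) * inr (k i) := comul_hExp _ i

theorem comul_kbar (i : Fin n) : comul (kbar i) = inl (kbar i) * inr (kbar i) := comul_hExp _ i

theorem coassoc (a : Uh n) : idMap comul (comul a) = mapId comul (comul a) := by
  have h : (idMap comul).comp comul = (mapId comul).comp (comul (n := n)) := by
    refine algHom_ext (fun i => ?_) (fun i => ?_) (fun i => ?_)
    · simp only [AlgHom.comp_apply, comul_x, map_add, map_mul, idMap_inl, idMap_inr, mapId_inl,
        mapId_inr, comul_k, comul_kbar, map_leg12_inl, map_leg12_inr, map_leg23_inl,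
        map_leg23_inr]
      have h1 := (commute_in₂_in₃ (k i) (k i)).eq
      have h2 := (commute_in₂_in₃ (x i) (k i)).eq
      have h3 := (commute_in₁_in₃ (kbar i) (k i)).eq
      simp only [mul_add, add_assoc, h1, ← mul_assoc, h3]
    · simp only [AlgHom.comp_apply, comul_H, map_add, idMap_inl, idMap_inr, mapId_inl,
        mapId_inr, map_leg12_inl, map_leg12_inr, map_leg23_inl, map_leg23_inr, add_assoc]
    · simp only [AlgHom.comp_apply, comul_y, map_add, map_mul, idMap_inl, idMap_inr, mapId_inl,
        mapId_inr, comul_k, comul_kbar, map_leg12_inl, map_leg12_inr, map_leg23_inl,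
        map_leg23_inr]
      have h1 := (commute_in₂_in₃ (k i) (k i)).eq
      have h3 := (commute_in₁_in₃ (kbar i) (k i)).eq
      simp only [mul_add, add_assoc, h1, ← mul_assoc, h3]
  exact AlgHom.congr_fun h a

/-! ### The counit -/

theorem isRep_zero {B : Type} [Ring B] [Algebra Kh B] :
    IsRep (fun _ : Fin n => (0 : HCompl B)) (fun _ => 0) (fun _ => 0) where
  HH _ _ := Commute.refl _
  Hx _ _ := by simp [HasWeight]
  Hy _ _ := by simp [HasWeight]
  xy _ _ := by simp [HCompl.qBracket_zero]
  serre_x := isSerre_extZero isQParam_qPow (by simp) (by simp)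
  serre_y := isSerre_extZero isQParam_qPow (by simp) (by simp)

/-- The counit of `U_h(sl (n + 1))`. -/
def counit : Uh n →ₐ[Kh] Kh :=
  (IsHComplete.base.equiv.symm : HCompl Kh →ₐ[Kh] Kh).comp (lift isRep_zero)

theorem counit_x (i : Fin n) : counit (x i) = 0 := by
  rw [counit, AlgHom.comp_apply, lift_x, map_zero]

theorem counit_y (i : Fin n) : counit (y i) = 0 := by
  rw [counit, AlgHom.comp_apply, lift_y, map_zero]

theorem counit_H (i : Fin n) : counit (H i) = 0 := by
  rw [counit, AlgHom.comp_apply, lift_H, map_zero]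

theorem counit_hExp (c : ℂ) (i : Fin n) : counit (HCompl.hExp c (H i)) = 1 := by
  rw [counit, AlgHom.comp_apply, HCompl.map_hExp, lift_H, HCompl.hExp_zero, map_one]

theorem counit_left (a : Uh n) :
    HCompl.map (Algebra.TensorProduct.map counit (AlgHom.id Kh (Uh n))) (comul a) =
      HCompl.of (Kh ⊗[Kh] Uh n) (1 ⊗ₜ[Kh] a) := by
  set φ := HCompl.map (Algebra.TensorProduct.map counit (AlgHom.id Kh (Uh n))) with hφ
  set ψ : Uh n →ₐ[Kh] HCompl (Kh ⊗[Kh] Uh n) :=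
    (HCompl.of (Kh ⊗[Kh] Uh n)).comp Algebra.TensorProduct.includeRight with hψ
  have hr : ∀ a, φ (inr a) = ψ a := fun a => by
    rw [hφ, inr_apply, HCompl.map_of, Algebra.TensorProduct.map_tmul, map_one]
    rfl
  have hl : ∀ a, φ (inl a) = algebraMap Kh _ (counit a) := fun a => by
    rw [hφ, inl_apply, HCompl.map_of, Algebra.TensorProduct.map_tmul, map_one,
      ← AlgHom.commutes (HCompl.of (Kh ⊗[Kh] Uh n))]
    rfl
  have h : φ.comp comul = ψ := by
    refine algHom_ext (fun i => ?_) (fun i => ?_) (fun i => ?_)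
    · simp only [AlgHom.comp_apply, comul_x, map_add, map_mul, hr, hl, k, kbar, counit_hExp,
        counit_x, map_zero, map_one, mul_zero, zero_add, one_mul]
    · simp only [AlgHom.comp_apply, comul_H, map_add, hr, hl, counit_H, map_zero, zero_add]
    · simp only [AlgHom.comp_apply, comul_y, map_add, map_mul, hr, hl, k, kbar, counit_hExp,
        counit_y, map_zero, map_one, mul_zero, add_zero, one_mul]
  exact AlgHom.congr_fun h a

theorem counit_right (a : Uh n) :
    HCompl.map (Algebra.TensorProduct.map (AlgHom.id Kh (Uh n)) counit) (comul a) =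
      HCompl.of (Uh n ⊗[Kh] Kh) (a ⊗ₜ[Kh] 1) := by
  set φ := HCompl.map (Algebra.TensorProduct.map (AlgHom.id Kh (Uh n)) counit) with hφ
  set ψ : Uh n →ₐ[Kh] HCompl (Uh n ⊗[Kh] Kh) :=
    (HCompl.of (Uh n ⊗[Kh] Kh)).comp Algebra.TensorProduct.includeLeft with hψ
  have hl : ∀ a, φ (inl a) = ψ a := fun a => by
    rw [hφ, inl_apply, HCompl.map_of, Algebra.TensorProduct.map_tmul, map_one]
    rfl
  have hr : ∀ a, φ (inr a) = algebraMap Kh _ (counit a) := fun a => by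
    rw [hφ, inr_apply, HCompl.map_of, Algebra.TensorProduct.map_tmul, map_one,
      ← AlgHom.commutes (HCompl.of (Uh n ⊗[Kh] Kh)), Algebra.TensorProduct.algebraMap_apply']
    rfl
  have h : φ.comp comul = ψ := by
    refine algHom_ext (fun i => ?_) (fun i => ?_) (fun i => ?_)
    · simp only [AlgHom.comp_apply, comul_x, map_add, map_mul, hr, hl, k, kbar, counit_hExp,
        counit_x, map_zero, map_one, mul_zero, add_zero, one_mul]
    · simp only [AlgHom.comp_apply, comul_H, map_add, hr, hl, counit_H, map_zero, add_zero]
    · simp only [AlgHom.comp_apply, comul_y, map_add, map_mul, hr, hl, k, kbar, counit_hExp,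
        counit_y, map_zero, map_one, mul_zero, zero_add, one_mul]
  exact AlgHom.congr_fun h a

end Uh

/-! ### The antipode -/

/-- A linear map that is compatible with the powers of one element, such as an anti-homomorphism,
commutes with the exponential of that element. -/
theorem HCompl.map_hExp_of_pow {A B : Type} [Ring A] [Algebra Kh A] [Ring B] [Algebra Kh B]
    (ψ : HCompl A →ₗ[Kh] HCompl B) (c : ℂ) {z : HCompl A} {w : HCompl B}
    (h : ∀ m, ψ (z ^ m) = w ^ m) : ψ (HCompl.hExp c z) = HCompl.hExp c w := by
  rw [hExp, hExp, hSeries_eq, hSeries_eq, map_evalH]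
  simp only [map_smul, h]

section

variable {A : Type} [Ring A] [Algebra Kh A]

/-- The canonical anti-homomorphism from an algebra to the completion of its opposite. -/
def ofOp : A →ₗ[Kh] HCompl Aᵐᵒᵖ :=
  (HCompl.of Aᵐᵒᵖ).toLinearMap ∘ₗ (MulOpposite.opLinearEquiv Kh).toLinearMap

theorem ofOp_apply (a : A) : ofOp a = HCompl.of Aᵐᵒᵖ (MulOpposite.op a) := rfl

theorem ofOp_mul (a b : A) : ofOp (a * b) = ofOp b * ofOp a := by
  rw [ofOp_apply, ofOp_apply, ofOp_apply, MulOpposite.op_mul, map_mul]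

theorem ofOp_pow (a : A) (m : ℕ) : ofOp (a ^ m) = ofOp a ^ m := by
  rw [ofOp_apply, ofOp_apply, MulOpposite.op_pow, map_pow]

theorem HasWeight.ofOp_neg {a x : A} {c : Kh} (h : HasWeight a c x) :
    HasWeight (ofOp (-a)) c (ofOp x) := by
  rw [HasWeight, ← ofOp_mul, ← ofOp_mul, ← map_sub, ← map_smul, ← h]
  congr 1
  noncomm_ring

theorem IsSerre.ofOp {n : ℕ} {e : Fin n → A} (he : IsSerre (qPow 1) (qPow (-1)) (extZero e)) :
    IsSerre (qPow 1) (qPow (-1)) (extZero fun i => ofOp (e i)) := by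
  rw [QuantumSl.extZero_map QuantumSl.ofOp]
  exact he.op.map (HCompl.of Aᵐᵒᵖ)

end

namespace Uh

variable {n : ℕ}

theorem isRep_antipode : IsRep (fun i : Fin n => ofOp (-(qPow 1 • x i))) (fun i => ofOp (-H i))
    (fun i => ofOp (-(qPow (-1) • y i))) where
  HH i j := by
    rw [Commute, SemiconjBy, ← ofOp_mul, ← ofOp_mul, neg_mul_neg, neg_mul_neg, (isRep.HH i j).eq]
  Hx i j := by
    simp only [← neg_smul]
    exact ((isRep.Hx i j).smul _).ofOp_neg
  Hy i j := by
    simp only [← neg_smul]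
    exact ((isRep.Hy i j).smul _).ofOp_neg
  xy i j := by
    rw [← HCompl.map_qBracket_of_pow ofOp (ofOp_pow _), HCompl.qBracket_neg, ← ofOp_mul,
      ← ofOp_mul, ← map_sub, neg_mul_neg, neg_mul_neg, smul_mul_smul_comm, smul_mul_smul_comm,
      mul_comm (qPow (-1)), qPow_mul_qPow_neg, one_smul, one_smul, ← neg_sub, isRep.xy]
    split_ifs <;> simp
  serre_x := by
    simp only [← neg_smul]
    refine IsSerre.ofOp ?_
    rw [extZero_smul]
    exact isRep.serre_x.smul _
  serre_y := by
    simp only [← neg_smul]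
    refine IsSerre.ofOp ?_
    rw [extZero_smul]
    exact isRep.serre_y.smul _

/-- The antipode of `U_h(sl (n + 1))`. -/
def antipode : Uh n →ₐ[Kh] (Uh n)ᵐᵒᵖ :=
  ((IsHComplete.hCompl (A := PreU n)).op.equiv.symm : HCompl (Uh n)ᵐᵒᵖ →ₐ[Kh] (Uh n)ᵐᵒᵖ).comp
    (lift isRep_antipode)

theorem antipode_eq_of_lift {a b : Uh n} (h : lift isRep_antipode a = ofOp b) :
    antipode a = MulOpposite.op b := by
  rw [antipode, AlgHom.comp_apply, h]
  exact IsHComplete.equiv_symm_of _ _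

theorem antipode_x (i : Fin n) : antipode (x i) = MulOpposite.op (-(qPow 1 • x i)) :=
  antipode_eq_of_lift (lift_x _ i)

theorem antipode_y (i : Fin n) : antipode (y i) = MulOpposite.op (-(qPow (-1) • y i)) :=
  antipode_eq_of_lift (lift_y _ i)

theorem antipode_H (i : Fin n) : antipode (H i) = MulOpposite.op (-H i) :=
  antipode_eq_of_lift (lift_H _ i)

theorem antipode_hExp (c : ℂ) (i : Fin n) :
    antipode (HCompl.hExp c (H i)) = MulOpposite.op (HCompl.hExp (-c) (H i)) := by
  refine antipode_eq_of_lift ?_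
  have h : -H i = (PowerSeries.C (-1) : Kh) • H i := by rw [map_neg, map_one, neg_one_smul]
  rw [HCompl.map_hExp, lift_H, ← HCompl.map_hExp_of_pow ofOp c (ofOp_pow _), h,
    HCompl.hExp_C_smul, mul_neg_one]

theorem antipode_k (i : Fin n) : antipode (k i) = MulOpposite.op (kbar i) := by
  rw [k, antipode_hExp, kbar, neg_div]

theorem antipode_kbar (i : Fin n) : antipode (kbar i) = MulOpposite.op (k i) := by
  rw [kbar, antipode_hExp, k]
  norm_num

/-- The antipode, as a linear endomorphism. -/
def antipodeLin : Uh n →ₗ[Kh] Uh n :=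
  (MulOpposite.opLinearEquiv Kh).symm.toLinearMap ∘ₗ antipode.toLinearMap

theorem antipodeLin_apply (a : Uh n) : antipodeLin a = (antipode a).unop := rfl

theorem antipodeLin_mul (a b : Uh n) : antipodeLin (a * b) = antipodeLin b * antipodeLin a := by
  simp only [antipodeLin_apply, map_mul, MulOpposite.unop_mul]

/-- The `ℂ⟦h⟧`-linear map `a ⊗ b ↦ S(a) b`. -/
def convLeft : T2 (Uh n) →ₗ[Kh] HCompl (Uh n) :=
  HCompl.mapLin (LinearMap.mul' Kh (Uh n) ∘ₗ TensorProduct.map antipodeLin LinearMap.id)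

/-- The `ℂ⟦h⟧`-linear map `a ⊗ b ↦ a S(b)`. -/
def convRight : T2 (Uh n) →ₗ[Kh] HCompl (Uh n) :=
  HCompl.mapLin (LinearMap.mul' Kh (Uh n) ∘ₗ TensorProduct.map LinearMap.id antipodeLin)

theorem convLeft_tmul (a b : Uh n) : convLeft (tmul a b) = HCompl.of _ (antipodeLin a * b) :=
  HCompl.mapLin_of _ _

theorem convRight_tmul (a b : Uh n) : convRight (tmul a b) = HCompl.of _ (a * antipodeLin b) :=
  HCompl.mapLin_of _ _

theorem T2.linearMap_ext {A B : Type} [Ring A] [Algebra Kh A] [Ring B] [Algebra Kh B]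
    {φ ψ : T2 A →ₗ[Kh] HCompl B} (h : ∀ a b, φ (tmul a b) = ψ (tmul a b)) : φ = ψ := by
  refine HCompl.linearMap_ext fun t => ?_
  induction t with
  | zero => simp
  | add s t hs ht => rw [map_add, map_add, map_add, hs, ht]
  | tmul a b => exact h a b

theorem tmul_mul_tmul {A : Type} [Ring A] [Algebra Kh A] (a b c d : A) :
    tmul a b * tmul c d = tmul (a * c) (b * d) := by
  rw [tmul, tmul, ← map_mul, Algebra.TensorProduct.tmul_mul_tmul]; rfl

theorem convLeft_mul_tmul (w : T2 (Uh n)) (a b : Uh n) :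
    convLeft (w * tmul a b) = HCompl.of _ (antipodeLin a) * convLeft w * HCompl.of _ b := by
  have h : convLeft ∘ₗ LinearMap.mulRight Kh (tmul a b) =
      LinearMap.mulRight Kh (HCompl.of _ b) ∘ₗ
        LinearMap.mulLeft Kh (HCompl.of _ (antipodeLin a)) ∘ₗ convLeft := by
    refine T2.linearMap_ext fun c d => ?_
    simp only [LinearMap.comp_apply, LinearMap.mulRight_apply, LinearMap.mulLeft_apply,
      tmul_mul_tmul, convLeft_tmul, antipodeLin_mul, map_mul, mul_assoc]
  exact LinearMap.congr_fun h w

theorem convRight_tmul_mul (w : T2 (Uh n)) (a b : Uh n) :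
    convRight (tmul a b * w) = HCompl.of _ a * convRight w * HCompl.of _ (antipodeLin b) := by
  have h : convRight ∘ₗ LinearMap.mulLeft Kh (tmul a b) =
      LinearMap.mulRight Kh (HCompl.of _ (antipodeLin b)) ∘ₗ
        LinearMap.mulLeft Kh (HCompl.of _ a) ∘ₗ convRight := by
    refine T2.linearMap_ext fun c d => ?_
    simp only [LinearMap.comp_apply, LinearMap.mulRight_apply, LinearMap.mulLeft_apply,
      tmul_mul_tmul, convRight_tmul, antipodeLin_mul, map_mul, mul_assoc]
  exact LinearMap.congr_fun h w

/-- If `m (S ⊗ id)` maps `w` to a scalar `c`, then it maps `w v` to `c` times the image of `v`. With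
`w = Δ a` this shows that the antipode axiom is stable under multiplication. -/
theorem convLeft_mul_of {w : T2 (Uh n)} {c : Kh}
    (hw : convLeft w = HCompl.of _ (algebraMap Kh (Uh n) c)) (v : T2 (Uh n)) :
    convLeft (w * v) = c • convLeft v := by
  have h : convLeft ∘ₗ LinearMap.mulLeft Kh w = c • convLeft := by
    refine T2.linearMap_ext fun a b => ?_
    rw [LinearMap.comp_apply, LinearMap.mulLeft_apply, convLeft_mul_tmul, hw, LinearMap.smul_apply,
      convLeft_tmul, Algebra.algebraMap_eq_smul_one, map_smul, map_one, mul_smul_comm,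
      smul_mul_assoc, mul_one, map_mul]
  exact LinearMap.congr_fun h v

theorem convRight_mul_of {w : T2 (Uh n)} {c : Kh}
    (hw : convRight w = HCompl.of _ (algebraMap Kh (Uh n) c)) (v : T2 (Uh n)) :
    convRight (v * w) = c • convRight v := by
  have h : convRight ∘ₗ LinearMap.mulRight Kh w = c • convRight := by
    refine T2.linearMap_ext fun a b => ?_
    rw [LinearMap.comp_apply, LinearMap.mulRight_apply, convRight_tmul_mul, hw,
      LinearMap.smul_apply,
      convRight_tmul, Algebra.algebraMap_eq_smul_one, map_smul, map_one, mul_smul_comm,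
      smul_mul_assoc, mul_one, map_mul]
  exact LinearMap.congr_fun h v

/-- A linear map `φ` with `φ (Δ a) = ε(a)` on the generators satisfies this everywhere, as soon as
this property is stable under multiplication. -/
theorem comp_comul_eq {φ : T2 (Uh n) →ₗ[Kh] HCompl (Uh n)} (h1 : φ 1 = 1)
    (hmul : ∀ a b, φ (comul a) = HCompl.of _ (algebraMap Kh (Uh n) (counit a)) →
      φ (comul b) = HCompl.of _ (algebraMap Kh (Uh n) (counit b)) →
      φ (comul a * comul b) = counit a • counit b • 1)
    (hx : ∀ i, φ (comul (x i)) = 0) (hH : ∀ i, φ (comul (H i)) = 0)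
    (hy : ∀ i, φ (comul (y i)) = 0) (a : Uh n) :
    φ (comul a) = HCompl.of _ (algebraMap Kh (Uh n) (counit a)) := by
  have h : φ ∘ₗ comul.toLinearMap =
      ((HCompl.of (Uh n)).comp ((Algebra.ofId Kh (Uh n)).comp counit)).toLinearMap := by
    refine linearMap_ext ?_ (fun a b ha hb => ?_) (fun i => ?_) (fun i => ?_) (fun i => ?_)
    · simp [h1]
    · rw [LinearMap.comp_apply, AlgHom.toLinearMap_apply, map_mul, hmul a b ha hb]
      simp only [AlgHom.toLinearMap_apply, map_mul, AlgHom.comp_apply, Algebra.ofId_apply,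
        Algebra.algebraMap_eq_smul_one, map_smul, map_one, smul_mul_assoc, one_mul]
    · simp [hx, counit_x]
    · simp [hH, counit_H]
    · simp [hy, counit_y]
  exact LinearMap.congr_fun h a

theorem convLeft_comul (a : Uh n) :
    convLeft (comul a) = HCompl.of _ (algebraMap Kh (Uh n) (counit a)) := by
  have h1 : antipodeLin (1 : Uh n) = 1 := by rw [antipodeLin_apply, map_one, MulOpposite.unop_one]
  refine comp_comul_eq ?_ (fun a b ha hb => ?_) (fun i => ?_) (fun i => ?_) (fun i => ?_) a
  · rw [show (1 : T2 (Uh n)) = tmul 1 1 from (map_one _).symm, convLeft_tmul, h1, one_mul, map_one]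
  · rw [convLeft_mul_of ha, hb, Algebra.algebraMap_eq_smul_one, map_smul, map_one]
  · have := (k_x i i : k i * x i = _ • _)
    rw [comul_x, ← tmul_eq', ← tmul_eq, map_add, convLeft_tmul, convLeft_tmul, ← map_add,
      antipodeLin_apply, antipodeLin_apply, antipode_x, antipode_kbar, MulOpposite.unop_op,
      MulOpposite.unop_op, this, show cartan i i = 2 by simp [cartan]]
    norm_num
  · rw [comul_H, show inl (H i) = tmul (H i) 1 from rfl, show inr (H i) = tmul 1 (H i) from rfl,
      map_add, convLeft_tmul, convLeft_tmul, h1, antipodeLin_apply, antipode_H]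
    simp
  · have := (k_y i i : k i * y i = _ • _)
    rw [comul_y, ← tmul_eq', ← tmul_eq, map_add, convLeft_tmul, convLeft_tmul, ← map_add,
      antipodeLin_apply, antipodeLin_apply, antipode_y, antipode_kbar, MulOpposite.unop_op,
      MulOpposite.unop_op, this, show cartan i i = 2 by simp [cartan]]
    norm_num

theorem convRight_comul (a : Uh n) :
    convRight (comul a) = HCompl.of _ (algebraMap Kh (Uh n) (counit a)) := by
  have h1 : antipodeLin (1 : Uh n) = 1 := by rw [antipodeLin_apply, map_one, MulOpposite.unop_one]
  refine comp_comul_eq ?_ (fun a b ha hb => ?_) (fun i => ?_) (fun i => ?_) (fun i => ?_) a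
  · rw [show (1 : T2 (Uh n)) = tmul 1 1 from (map_one _).symm, convRight_tmul, h1, one_mul, map_one]
  · rw [convRight_mul_of hb, ha, Algebra.algebraMap_eq_smul_one, map_smul, map_one, smul_comm]
  · have := (x_kbar i i : x i * kbar i = _ • _)
    rw [comul_x, ← tmul_eq', ← tmul_eq, map_add, convRight_tmul, convRight_tmul, ← map_add,
      antipodeLin_apply, antipodeLin_apply, antipode_x, antipode_k, MulOpposite.unop_op,
      MulOpposite.unop_op, this, show cartan i i = 2 by simp [cartan]]
    norm_num
  · rw [comul_H, show inl (H i) = tmul (H i) 1 from rfl, show inr (H i) = tmul 1 (H i) from rfl,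
      map_add, convRight_tmul, convRight_tmul, h1, antipodeLin_apply, antipode_H]
    simp
  · have := (y_kbar i i : y i * kbar i = _ • _)
    rw [comul_y, ← tmul_eq', ← tmul_eq, map_add, convRight_tmul, convRight_tmul, ← map_add,
      antipodeLin_apply, antipodeLin_apply, antipode_y, antipode_k, MulOpposite.unop_op,
      MulOpposite.unop_op, this, show cartan i i = 2 by simp [cartan]]
    norm_num

/-- The Hopf algebra structure of `U_h(sl (n + 1))`. -/
def hopf (n : ℕ) : HopfStructure (Uh n) where
  comul := comul
  counit := counit
  antipode := antipode
  coassoc := coassoc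
  counit_left := counit_left
  counit_right := counit_right
  antipode_left := convLeft_comul
  antipode_right := convRight_comul

end Uh

/-! ### Transporting ordered products of `q`-exponentials -/

section Transport

/-- Factors that commute with everything can be moved from one family of a row sum to the
other. -/
theorem rowSum_mul_left {K T : Type} [CommRing K] [Ring T] [Algebra K T] (p : K) {e φ t : ℕ → T}
    (ht : ∀ i j, Commute (t i) (t j)) (hte : ∀ i j, Commute (t i) (e j))
    (htφ : ∀ i j, Commute (t i) (φ j)) (n s : ℕ) :
    rowSum p n (fun i => t i * e i) φ s = rowSum p n e (fun i => t i * φ i) s := by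
  -- the product of the `t i` that splits off from a root vector
  have key : ∀ d a, ∃ w : T, (∀ j, Commute w (t j)) ∧ (∀ j, Commute w (e j)) ∧
      (∀ j, Commute w (φ j)) ∧ rv p (fun i => t i * e i) a d = w * rv p e a d ∧
      rv p (fun i => t i * φ i) a d = w * rv p φ a d := by
    intro d
    induction d with
    | zero => exact fun a => ⟨t a, ht a, hte a, htφ a, rfl, rfl⟩
    | succ d ih =>
      intro a
      obtain ⟨w, h1, h2, h3, h4, h5⟩ := ih (a + 1)
      have aux : ∀ f : ℕ → T, (∀ i j, Commute (t i) (f j)) → (∀ j, Commute w (f j)) →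
          rv p (fun i => t i * f i) (a + 1) d = w * rv p f (a + 1) d →
          rv p (fun i => t i * f i) a (d + 1) = t a * w * rv p f a (d + 1) := by
        intro f h6 h7 h8
        have h9 : Commute (t a) (rv p f (a + 1) d) := commute_rv fun i _ _ => h6 a i
        simp only [rv]
        rw [h8, mul_sub, mul_smul_comm]
        congr 1
        · rw [mul_assoc, ← mul_assoc (f a), ← (h7 a).eq, mul_assoc, mul_assoc]
        · rw [mul_assoc, ← mul_assoc (rv p f _ _), ← h9.eq, mul_assoc, ← mul_assoc w, (h1 a).eq,
            mul_assoc]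
      exact ⟨t a * w, fun j => (ht a j).mul_left (h1 j), fun j => (hte a j).mul_left (h2 j),
        fun j => (htφ a j).mul_left (h3 j), aux e hte h2 h4, aux φ htφ h3 h5⟩
  rw [rowSum, rowSum]
  refine Finset.sum_congr rfl fun b _ => ?_
  rcases lt_or_ge b s with hb | hb
  · rw [seg_eq_zero _ hb, seg_eq_zero e hb, zero_mul, zero_mul]
  obtain ⟨d, rfl⟩ := Nat.exists_eq_add_of_le hb
  obtain ⟨w, h1, h2, h3, h4, h5⟩ := key d s
  have h6 : Commute w (rv p e s d) := commute_rv fun i _ _ => h2 i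
  rw [seg_add, seg_add, seg_add, seg_add, h4, h5, h6.eq, mul_assoc]

variable {A : Type} [Ring A] [Algebra Kh A]

theorem theta_mul_left {e φ t : ℕ → HCompl A} (ht : ∀ i j, Commute (t i) (t j))
    (hte : ∀ i j, Commute (t i) (e j)) (htφ : ∀ i j, Commute (t i) (φ j)) (n s k : ℕ) :
    theta n (fun i => t i * e i) φ s k = theta n e (fun i => t i * φ i) s k := by
  induction k generalizing s with
  | zero => rfl
  | succ k ih => rw [theta, theta, ih, expRow, expRow, rowSum_mul_left _ ht hte htφ]

theorem theta_symm {e φ : ℕ → HCompl A} (h : ∀ i j, Commute (e i) (φ j)) (n s k : ℕ) :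
    theta n e φ s k = theta n φ e s k := by
  have h1 : ∀ s, rowSum (qPow (-1)) n e φ s = rowSum (qPow (-1)) n φ e s := fun s =>
    Finset.sum_congr rfl fun b _ => (seg_seg_commute h _ _ _ _).eq
  induction k generalizing s with
  | zero => rfl
  | succ k ih => rw [theta, theta, ih, expRow, expRow, h1]

/-- Conjugation by a unit. -/
def conjHom {K T : Type} [CommRing K] [Ring T] [Algebra K T] (u : Tˣ) : T →ₐ[K] T :=
  AlgHom.ofLinearMap (LinearMap.mulRight K ((u⁻¹ : Tˣ) : T) ∘ₗ LinearMap.mulLeft K (u : T))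
    (by simp) (fun a b => by simp [mul_assoc])

theorem conjHom_apply {K T : Type} [CommRing K] [Ring T] [Algebra K T] (u : Tˣ) (a : T) :
    conjHom (K := K) u a = u * a * ((u⁻¹ : Tˣ) : T) := rfl

theorem conjHom_eq {K T : Type} [CommRing K] [Ring T] [Algebra K T] {u : Tˣ} {a b : T}
    (h : (u : T) * a = b * u) : conjHom (K := K) u a = b := by
  rw [conjHom_apply, h, Units.mul_inv_cancel_right]

/-- Conjugation by a unit, applied to both families. -/
theorem theta_semiconj {e e' φ φ' : ℕ → HCompl A} {u : HCompl A} (hu : IsUnit u)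
    (he : ∀ i, u * e i = e' i * u) (hφ : ∀ i, u * φ i = φ' i * u) (n s k : ℕ) :
    u * theta n e φ s k = theta n e' φ' s k * u := by
  obtain ⟨u, rfl⟩ := hu
  have h := map_theta (conjHom u) n e φ s k
  simp only [fun i => conjHom_eq (K := Kh) (he i), fun i => conjHom_eq (K := Kh) (hφ i)] at h
  rw [← h, conjHom_apply, Units.inv_mul_cancel_right]

theorem HasWeight.rv {K T : Type} [CommRing K] [Ring T] [Algebra K T] (p : K) {x : T} {e : ℕ → T}
    {c : ℕ → K} (h : ∀ i, HasWeight x (c i) (e i)) (a d : ℕ) :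
    HasWeight x (∑ i ∈ Finset.range (d + 1), c (a + i)) (rv p e a d) := by
  induction d generalizing a with
  | zero => simpa [QuantumSl.rv] using h a
  | succ d ih =>
    have h1 := ih (a + 1)
    have h2 : ∑ i ∈ Finset.range (d + 1 + 1), c (a + i) =
        c a + ∑ i ∈ Finset.range (d + 1), c (a + 1 + i) := by
      rw [Finset.sum_range_succ', add_comm, add_zero]
      simp only [add_assoc, add_comm 1]
    rw [h2, QuantumSl.rv, sub_eq_add_neg, ← smul_neg, ← neg_one_smul K, smul_smul]
    refine ((h a).mul h1).add (HasWeight.smul _ ?_)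
    rw [add_comm]
    exact h1.mul (h a)

/-- An element for which the two families have opposite weights commutes with the ordered product
of the `q`-exponentials. -/
theorem commute_theta {x : HCompl A} {e φ : ℕ → HCompl A} {c : ℕ → Kh}
    (he : ∀ i, HasWeight x (c i) (e i)) (hφ : ∀ i, HasWeight x (-c i) (φ i)) (n s k : ℕ) :
    Commute x (theta n e φ s k) := by
  have h1 : ∀ s, Commute x (rowSum (qPow (-1)) n e φ s) := by
    intro s
    refine Commute.sum_right _ _ _ fun b _ => ?_
    rcases lt_or_ge b s with hb | hb
    · rw [seg_eq_zero _ hb, zero_mul]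
      exact Commute.zero_right _
    obtain ⟨d, rfl⟩ := Nat.exists_eq_add_of_le hb
    have h2 := (HasWeight.rv (qPow (-1)) he s d).mul (HasWeight.rv (qPow (-1)) hφ s d)
    rw [Finset.sum_neg_distrib, add_neg_cancel, HasWeight, zero_smul, sub_eq_zero] at h2
    rw [seg_add, seg_add]
    exact h2
  induction k generalizing s with
  | zero => exact Commute.one_right _
  | succ k ih =>
    refine Commute.mul_right ?_ (ih _)
    refine (hQExp_commute ?_).symm
    rw [((h1 s).smul_right (-lamDiv)).eq, sub_self, smul_zero]

theorem theta_eq_prod (n : ℕ) (e φ : ℕ → HCompl A) (s k : ℕ) :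
    theta n e φ s k = (List.ofFn fun a : Fin k => expRow n e φ (s + a)).prod := by
  induction k generalizing s with
  | zero => simp [theta]
  | succ k ih =>
    rw [theta, ih, List.ofFn_succ, List.prod_cons]
    simp [add_left_comm, add_comm]

end Transport

namespace Uh

variable {n : ℕ}

/-! ### Modified generators -/

/-- The element `k i * x i`. -/
def E (i : Fin n) : Uh n := k i * x i

/-- The element `- kbar i * y i`. The sign absorbs the signs in the factors of the `R`-matrix. -/
def F (i : Fin n) : Uh n := -(kbar i * y i)

theorem isSerre_E : IsSerre (qPow 1) (qPow (-1)) (extZero (E (n := n))) :=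
  isRep.serre_x.extZero_twist (fun i j => qPow (-(cartan i j / 2)))
    (fun i j => by rw [cartan_comm]) commute_k x_k

theorem isSerre_F : IsSerre (qPow 1) (qPow (-1)) (extZero (F (n := n))) := by
  unfold F
  rw [extZero_neg]
  exact (isRep.serre_y.extZero_twist (fun i j => qPow (-(cartan i j / 2)))
    (fun i j => by rw [cartan_comm]) commute_kbar y_kbar).neg

theorem E_hasWeight (i j : Fin n) : HasWeight (H i) (PowerSeries.C (cartan i j : ℂ)) (E j) := by
  have := (HasWeight.of_commute (K := Kh) (commute_H_k i j)).mul (isRep.Hx i j)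
  rwa [zero_add] at this

theorem F_hasWeight (i j : Fin n) : HasWeight (H i) (PowerSeries.C (-cartan i j : ℂ)) (F j) := by
  have := ((HasWeight.of_commute (K := Kh) (commute_H_kbar i j)).mul (isRep.Hy i j)).smul (-1)
  rwa [zero_add, neg_one_smul] at this

theorem k_mul_k (i : Fin n) : k i * k i = HCompl.hExp (1 / 2) (H i) := by
  rw [k, HCompl.hExp_mul_hExp]; norm_num

theorem kbar_mul_kbar (i : Fin n) : kbar i * kbar i = HCompl.hExp (-1 / 2) (H i) := by
  rw [kbar, HCompl.hExp_mul_hExp]; norm_num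

theorem kk_E (i j : Fin n) : QComm (qPow (cartan i j)) (k i * k i) (E j) := by
  rw [k_mul_k]
  exact ((E_hasWeight i j).qComm _).of_eq (by congr 1; ring)

theorem kk_F (i j : Fin n) : QComm (qPow (-cartan i j)) (k i * k i) (F j) := by
  rw [k_mul_k]
  exact ((F_hasWeight i j).qComm _).of_eq (by congr 1; ring)

theorem kbkb_E (i j : Fin n) : QComm (qPow (-cartan i j)) (kbar i * kbar i) (E j) := by
  rw [kbar_mul_kbar]
  exact ((E_hasWeight i j).qComm _).of_eq (by congr 1; ring)

theorem kbkb_F (i j : Fin n) : QComm (qPow (cartan i j)) (kbar i * kbar i) (F j) := by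
  rw [kbar_mul_kbar]
  exact ((F_hasWeight i j).qComm _).of_eq (by congr 1; ring)

theorem commute_E_F {i j : Fin n} (hij : i ≠ j) : Commute (E i) (F j) := by
  refine Commute.neg_right ?_
  have h : Commute (x i) (y j) := by
    have := isRep.xy i j
    rwa [if_neg hij, sub_eq_zero] at this
  refine QComm.commute ((((QComm.of_commute (commute_hExp _ _ _ _)).mul_right (k_y i j)).mul_left
    ((x_kbar i j).mul_right (.of_commute h))).of_eq ?_)
  rw [one_mul, mul_one, mul_comm, qPow_mul_qPow_neg]

/-- The commutator of `E i` and `F i`, in the normalization used in `IsOpposite`. -/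
theorem F_mul_E (i : Fin n) : (1 - qPow (-1) * qPow (-1)) • (F i * E i - E i * F i) =
    k i * k i - kbar i * kbar i := by
  have h1 : x i * kbar i = qPow 1 • (kbar i * x i) :=
    (x_kbar i i).of_eq (by congr 1; simp [cartan])
  have h2 : y i * k i = qPow 1 • (k i * y i) :=
    (y_k i i).of_eq (by congr 1; simp [cartan])
  have h3 : E i * (kbar i * y i) = qPow 1 • (x i * y i) := by
    rw [E, mul_assoc, ← mul_assoc (x i), h1, smul_mul_assoc, mul_smul_comm, mul_assoc,
      ← mul_assoc (k i), k_mul_kbar, one_mul]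
  have h4 : kbar i * y i * E i = qPow 1 • (y i * x i) := by
    rw [E, mul_assoc, ← mul_assoc (y i), h2, smul_mul_assoc, mul_smul_comm, mul_assoc,
      ← mul_assoc (kbar i), kbar_mul_k, one_mul]
  have h5 := isRep.xy i i
  rw [if_pos rfl] at h5
  rw [F, mul_neg, neg_mul, h3, h4, neg_sub_neg, ← smul_sub, h5, smul_smul, k_mul_k, kbar_mul_kbar,
    ← HCompl.qBracket_spec]
  congr 1
  linear_combination -qPow (-1) * qPow_mul_qPow_neg 1

theorem comul_E (i : Fin n) : comul (E i) = inr (k i * k i) * inl (E i) + inr (E i) := by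
  have hc : ∀ a b : Uh n, inl a * inr b = inr b * inl a := fun a b => (commute_inl_inr a b).eq
  have h1 : (inl (k i) * inl (kbar i) : T2 (Uh n)) = 1 := by
    rw [← map_mul, k_mul_kbar, map_one]
  rw [E, map_mul, comul_k, comul_x, mul_add, map_mul, map_mul, map_mul]
  congr 1
  · rw [hc, mul_assoc, ← mul_assoc (inl (k i)), hc, mul_assoc, mul_assoc]
  · rw [hc, mul_assoc, ← mul_assoc (inl (k i)), h1, one_mul]

theorem comul_F (i : Fin n) : comul (F i) = inl (kbar i * kbar i) * inr (F i) + inl (F i) := by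
  have hc : ∀ a b : Uh n, inl a * inr b = inr b * inl a := fun a b => (commute_inl_inr a b).eq
  have h1 : (inr (kbar i) * inr (k i) : T2 (Uh n)) = 1 := by
    rw [← map_mul, kbar_mul_k, map_one]
  rw [F, map_neg, map_mul, comul_kbar, comul_y, mul_add, map_neg, map_neg, map_mul, map_mul,
    map_mul, mul_neg, ← neg_add]
  congr 2
  · rw [mul_assoc, ← mul_assoc (inr (kbar i)), ← hc, mul_assoc, mul_assoc]
  · rw [mul_assoc, ← mul_assoc (inr (kbar i)), h1, one_mul]

end Uh

namespace Uh

variable {n : ℕ}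

/-! ### The factors of the `R`-matrix -/

theorem segProd_succ (g : Fin n → Uh n) (a d : ℕ) (had : a + (d + 1) < n) :
    segProd g a (d + 1) had = g ⟨a, by omega⟩ * segProd g (a + 1) d (by omega) := by
  rw [segProd, segProd, List.ofFn_succ, List.prod_cons]
  simp [add_assoc, add_comm]

section

variable {t g : Fin n → Uh n} (hgt : ∀ i j : Fin n, QComm (qPow (-(cartan i j / 2))) (g i) (t j))
include hgt

theorem commute_segProd (i : Fin n) {b d : ℕ} (hi : (i : ℕ) + 1 < b) (hbd : b + d < n) :
    Commute (g i) (segProd t b d hbd) := by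
  refine Commute.list_prod_right _ _ fun u hu => ?_
  obtain ⟨j, rfl⟩ := List.mem_ofFn.1 hu
  refine QComm.commute ((hgt i ⟨b + j, by omega⟩).of_eq ?_)
  rw [show cartan i (b + j) = 0 by unfold cartan; grind]
  simp [qPow_zero]

theorem qComm_segProd (a d : ℕ) (had : a + 1 + d < n) :
    QComm (qPow (1 / 2)) (g ⟨a, by omega⟩) (segProd t (a + 1) d had) := by
  have h1 : QComm (qPow (1 / 2)) (g ⟨a, by omega⟩) (t ⟨a + 1, by omega⟩) := by
    refine (hgt _ _).of_eq ?_
    rw [show cartan a (a + 1) = -1 by unfold cartan; grind]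
    norm_num
  cases d with
  | zero => simpa [segProd] using h1
  | succ d =>
    rw [segProd_succ]
    refine (h1.mul_right (.of_commute (commute_segProd hgt ⟨a, by omega⟩ ?_ _))).of_eq (mul_one _)
    change a + 1 < a + 1 + 1
    omega

theorem commute_rootVec {b d : ℕ} (hbd : b + d < n) (i : Fin n) (hi : (i : ℕ) + 1 < b) :
    Commute (rootVec g b d hbd) (t i) := by
  have h1 : ∀ j : Fin n, (i : ℕ) + 1 < j → Commute (g j) (t i) := by
    intro j hj
    refine QComm.commute ((hgt j i).of_eq ?_)
    rw [show cartan j i = 0 by unfold cartan; grind]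
    simp [qPow_zero]
  induction d generalizing b with
  | zero => exact h1 ⟨b, by omega⟩ hi
  | succ d ih =>
    have h2 := h1 ⟨b, by omega⟩ hi
    have h3 := ih (b := b + 1) (by omega) (by omega)
    exact ((h2.mul_left h3).smul_left _).sub_left ((h3.mul_left h2).smul_left _)

theorem qComm_rootVec (a d : ℕ) (had : a + 1 + d < n) :
    QComm (qPow (1 / 2)) (rootVec g (a + 1) d had) (t ⟨a, by omega⟩) := by
  have h1 : QComm (qPow (1 / 2)) (g ⟨a + 1, by omega⟩) (t ⟨a, by omega⟩) := by
    refine (hgt _ _).of_eq ?_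
    rw [show cartan (a + 1) a = -1 by unfold cartan; grind]
    norm_num
  cases d with
  | zero => exact h1
  | succ d =>
    have h2 : QComm (1 : Kh) (rootVec g (a + 1 + 1) d (by omega)) (t ⟨a, by omega⟩) :=
      .of_commute (commute_rootVec hgt _ ⟨a, by omega⟩ (by change a + 1 < a + 1 + 1; omega))
    exact (((h1.mul_left h2).of_eq (mul_one _)).smul_left _).sub_left
      (((h2.mul_left h1).of_eq (one_mul _)).smul_left _)

/-- Multiplication of a root vector by the corresponding product of `k i` (or `kbar i`) amounts to
multiplying each of the generators by `k i`, and adjusting the scalars in the `q`-commutators. -/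
theorem segProd_mul_rootVec (ht : ∀ i j, Commute (t i) (t j)) (a d : ℕ) (had : a + d < n) :
    segProd t a d had * rootVec g a d had = rv (qPow (-1)) (extZero fun i => t i * g i) a d := by
  induction d generalizing a with
  | zero =>
    rw [rv, extZero_of_lt _ (show a < n by omega)]
    simp [segProd, rootVec]
  | succ d ih =>
    have h1 : _ = _ • _ := qComm_segProd hgt a d (by omega)
    have h2 : _ = _ • _ := qComm_rootVec hgt a d (by omega)
    have h3 : qPow (-1) * qPow (1 / 2) = qPow (-1 / 2) := by rw [← qPow_add]; norm_num
    rw [segProd_succ, rootVec, rv, ← ih (a + 1) (by omega),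
      extZero_of_lt _ (show a < n by omega)]
    set S := segProd t (a + 1) d (by omega)
    set X := rootVec g (a + 1) d (by omega)
    set u := t ⟨a, by omega⟩
    set v := g ⟨a, by omega⟩
    have h4 : u * v * (S * X) = qPow (1 / 2) • (u * S * (v * X)) := by
      rw [mul_assoc, ← mul_assoc v, h1, smul_mul_assoc, mul_smul_comm, mul_assoc, mul_assoc]
    have h5 : qPow (-1) • (S * X * (u * v)) = qPow (-1 / 2) • (S * u * (X * v)) := by
      rw [mul_assoc, ← mul_assoc X, h2, smul_mul_assoc, mul_smul_comm, mul_assoc, mul_assoc,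
        smul_smul, h3]
    have h6 : Commute u S := by
      refine Commute.list_prod_right _ _ fun w hw => ?_
      obtain ⟨j, rfl⟩ := List.mem_ofFn.1 hw
      exact ht _ _
    rw [h4, h5, mul_sub, mul_smul_comm, mul_smul_comm, h6.eq]

end

theorem commute_E_F' (i j : ℕ) : Commute (inl (extZero E i) : T2 (Uh n)) (inr (extZero F j)) :=
  commute_inl_inr _ _

/-- The factors of the `R`-matrix in terms of `E` and `F`. The signs of `F` contribute
`(-1) ^ (b - a + 1)`, which accounts for the sign `(-1) ^ (b - a)` in the `R`-matrix and the sign of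
`- λ_q`. -/
theorem rFactor_eq (a d : ℕ) (had : a + d < n) : rFactor a d had =
    HCompl.hQExp ((-lamDiv) • (rv (qPow (-1)) (fun i => inl (extZero E i)) a d *
      rv (qPow (-1)) (fun i => inr (extZero F i)) a d)) := by
  have h : rv (qPow (-1)) (extZero F) a d =
      (-1 : Kh) ^ (d + 1) • rv (qPow (-1)) (extZero fun i : Fin n => kbar i * y i) a d := by
    unfold F
    rw [extZero_neg, rv_neg]
  rw [rFactor, segProd_mul_rootVec x_k commute_k, segProd_mul_rootVec y_kbar commute_kbar,
    ← map_rv, ← map_rv, h, map_smul,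
    mul_smul_comm, smul_smul, tmul_eq, pow_succ]
  congr 2
  ring

/-- The sum `∑ κ_{ij} H_i ⊗ H_j`. -/
def cartanSum (n : ℕ) : T2 (Uh n) :=
  ∑ i : Fin n, ∑ j : Fin n, (PowerSeries.C (kappa n i j) : Kh) • tmul (H i) (H j)

/-- The factor `exp ((h / 4) ∑ κ_{ij} H_i ⊗ H_j)` of the `R`-matrix. -/
def cartanPart (n : ℕ) : T2 (Uh n) :=
  HCompl.hExp (1 / 4) (cartanSum n)

theorem rMatrix_eq : rMatrix n = cartanPart n *
    theta n (fun i => inl (extZero E i)) (fun i => inr (extZero F i)) 0 n := by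
  rw [rMatrix, cartanPart, cartanSum, theta_eq_prod]
  congr 2
  refine congrArg List.ofFn (funext fun a => ?_)
  rw [zero_add, expRow_eq_prod (isSerre_E.map inl) (isSerre_F.map inr) commute_E_F'
    (show (a : ℕ) + (n - a) = n by omega)]
  simp only [rFactor_eq]

/-! ### The Cartan factor -/

theorem hExp_smul_H (s : ℂ) {B : Type} [Ring B] [Algebra Kh B] (z : HCompl B) :
    HCompl.hExp (1 / 4) ((PowerSeries.C (2 * s) : Kh) • z) = HCompl.hExp (s / 2) z := by
  rw [HCompl.hExp_C_smul]
  congr 1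
  ring

/-- Conjugation of an element `u ⊗ 1` by the Cartan factor, for `u` of weight `s` times a simple
root. -/
theorem cartanPart_mul_inl {u : Uh n} {m : Fin n} {s : ℂ}
    (hu : ∀ i : Fin n, HasWeight (H i) (PowerSeries.C (s * cartan i m)) u) :
    cartanPart n * inl u = inl u * cartanPart n * inr (HCompl.hExp (s / 2) (H m)) := by
  have h1 : cartanSum n * inl u - inl u * cartanSum n =
      inl u * ((PowerSeries.C (2 * s) : Kh) • inr (H m)) := by
    have h2 : ∀ i j : Fin n, (PowerSeries.C (kappa n i j) : Kh) • tmul (H i) (H j) * inl u -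
        inl u * (PowerSeries.C (kappa n i j) : Kh) • tmul (H i) (H j) =
        inl u * ((PowerSeries.C (s * (cartan m i * kappa n i j)) : Kh) • inr (H j)) := by
      intro i j
      have h3 : inl (H i) * inl u - inl u * inl (H i) = _ • _ := (hu i).map inl
      rw [tmul_eq, smul_mul_assoc, mul_smul_comm, ← smul_sub, mul_assoc,
        ← (commute_inl_inr u (H j)).eq, ← mul_assoc, ← mul_assoc, ← sub_mul, h3, smul_mul_assoc,
        smul_smul, ← map_mul, mul_smul_comm, cartan_comm]
      congr 2
      ring
    rw [cartanSum, Finset.sum_mul, Finset.mul_sum, ← Finset.sum_sub_distrib]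
    simp only [Finset.sum_mul, Finset.mul_sum, ← Finset.sum_sub_distrib, h2]
    rw [Finset.sum_comm]
    simp only [← Finset.mul_sum, ← Finset.sum_smul, ← map_sum, sum_cartan_mul_kappa]
    rw [Finset.sum_eq_single m (fun j _ hj => by rw [if_neg hj.symm, mul_zero, map_zero, zero_smul])
      (by simp), if_pos rfl, mul_comm s]
  have h2 : SemiconjBy (inl u) (cartanSum n + (PowerSeries.C (2 * s) : Kh) • inr (H m))
      (cartanSum n) := by
    rw [SemiconjBy, mul_add, ← h1]
    abel
  have h3 : Commute (cartanSum n) ((PowerSeries.C (2 * s) : Kh) • inr (H m)) := by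
    refine Commute.smul_right (Commute.sum_left _ _ _ fun i _ => Commute.sum_left _ _ _ fun j _ =>
      Commute.smul_left ?_ _) _
    rw [tmul_eq]
    exact (commute_inl_inr _ _).mul_left ((isRep.HH j m).map inr)
  have h4 := (HCompl.hExp_semiconj (1 / 4) h2).eq
  rw [HCompl.hExp_add h3, hExp_smul_H, ← HCompl.map_hExp] at h4
  rw [cartanPart, ← h4, mul_assoc]

/-- Conjugation of an element `1 ⊗ u` by the Cartan factor, for `u` of weight `s` times a simple
root. -/
theorem cartanPart_mul_inr {u : Uh n} {m : Fin n} {s : ℂ}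
    (hu : ∀ i : Fin n, HasWeight (H i) (PowerSeries.C (s * cartan i m)) u) :
    cartanPart n * inr u = inr u * cartanPart n * inl (HCompl.hExp (s / 2) (H m)) := by
  have h1 : cartanSum n * inr u - inr u * cartanSum n =
      inr u * ((PowerSeries.C (2 * s) : Kh) • inl (H m)) := by
    have h2 : ∀ i j : Fin n, (PowerSeries.C (kappa n i j) : Kh) • tmul (H i) (H j) * inr u -
        inr u * (PowerSeries.C (kappa n i j) : Kh) • tmul (H i) (H j) =
        inr u * ((PowerSeries.C (s * (kappa n i j * cartan j m)) : Kh) • inl (H i)) := by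
      intro i j
      have h3 : inr (H j) * inr u - inr u * inr (H j) = _ • _ := (hu j).map inr
      rw [tmul_eq', smul_mul_assoc, mul_smul_comm, ← smul_sub, mul_assoc,
        (commute_inl_inr (H i) u).eq, ← mul_assoc, ← mul_assoc, ← sub_mul, h3, smul_mul_assoc,
        smul_smul, ← map_mul, mul_smul_comm]
      congr 2
      ring
    rw [cartanSum, Finset.sum_mul, Finset.mul_sum, ← Finset.sum_sub_distrib]
    simp only [Finset.sum_mul, Finset.mul_sum, ← Finset.sum_sub_distrib, h2]
    simp only [← Finset.mul_sum, ← Finset.sum_smul, ← map_sum, sum_kappa_mul_cartan]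
    rw [Finset.sum_eq_single m (fun j _ hj => by rw [if_neg hj, mul_zero, map_zero, zero_smul])
      (by simp), if_pos rfl, mul_comm s]
  have h2 : SemiconjBy (inr u) (cartanSum n + (PowerSeries.C (2 * s) : Kh) • inl (H m))
      (cartanSum n) := by
    rw [SemiconjBy, mul_add, ← h1]
    abel
  have h3 : Commute (cartanSum n) ((PowerSeries.C (2 * s) : Kh) • inl (H m)) := by
    refine Commute.smul_right (Commute.sum_left _ _ _ fun i _ => Commute.sum_left _ _ _ fun j _ =>
      Commute.smul_left ?_ _) _
    rw [tmul_eq]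
    exact ((isRep.HH i m).map inl).mul_left (commute_inl_inr _ _).symm
  have h4 := (HCompl.hExp_semiconj (1 / 4) h2).eq
  rw [HCompl.hExp_add h3, hExp_smul_H, ← HCompl.map_hExp] at h4
  rw [cartanPart, ← h4, mul_assoc]

theorem commute_cartanPart_inl {u : Uh n} (hu : ∀ i, Commute (H i) u) :
    Commute (cartanPart n) (inl u) := by
  refine (HCompl.hExp_commute _ ?_).symm
  refine Commute.sum_right _ _ _ fun i _ => Commute.sum_right _ _ _ fun j _ => ?_
  rw [tmul_eq]
  exact (((hu i).symm.map inl).mul_right (commute_inl_inr _ _)).smul_right _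

theorem commute_cartanPart_inr {u : Uh n} (hu : ∀ i, Commute (H i) u) :
    Commute (cartanPart n) (inr u) := by
  refine (HCompl.hExp_commute _ ?_).symm
  refine Commute.sum_right _ _ _ fun i _ => Commute.sum_right _ _ _ fun j _ => ?_
  rw [tmul_eq]
  exact ((commute_inl_inr _ _).symm.mul_right ((hu j).symm.map inr)).smul_right _

theorem cartanPart_E_left (i : Fin n) :
    cartanPart n * inl (E i) = inl (E i) * cartanPart n * inr (k i * k i) := by
  rw [cartanPart_mul_inl (m := i) (s := 1) (fun j => by rw [one_mul]; exact E_hasWeight j i),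
    k_mul_k]

theorem cartanPart_E_right (i : Fin n) :
    cartanPart n * inr (E i) = inr (E i) * cartanPart n * inl (k i * k i) := by
  rw [cartanPart_mul_inr (m := i) (s := 1) (fun j => by rw [one_mul]; exact E_hasWeight j i),
    k_mul_k]

theorem cartanPart_F_left (i : Fin n) :
    cartanPart n * inl (F i) = inl (F i) * cartanPart n * inr (kbar i * kbar i) := by
  rw [cartanPart_mul_inl (m := i) (s := -1) (fun j => by rw [neg_one_mul]; exact F_hasWeight j i),
    kbar_mul_kbar]

theorem cartanPart_F_right (i : Fin n) :
    cartanPart n * inr (F i) = inr (F i) * cartanPart n * inl (kbar i * kbar i) := by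
  rw [cartanPart_mul_inr (m := i) (s := -1) (fun j => by rw [neg_one_mul]; exact F_hasWeight j i),
    kbar_mul_kbar]

end Uh

namespace Uh

variable {n : ℕ}

/-! ### The coproduct and the `R`-matrix -/

/-- Here `g + κ e_i = Δ(E i)`. -/
theorem isOpposite_E (i : Fin n) : IsOpposite isQParam_qPow i (fun j => inl (extZero E j))
    (fun j => inr (extZero F j)) (inr (E i) : T2 (Uh n)) (inr (k i * k i))
    (inr (kbar i * kbar i)) where
  serre_e := isSerre_E.map inl
  serre_f := isSerre_F.map inr
  ef := commute_E_F'
  ge _ := (commute_inl_inr _ _).symm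
  gf j hj := by
    by_cases hjn : j < n
    · rw [extZero_of_lt F hjn]
      exact (commute_E_F fun h => hj (by rw [h])).map inr
    · rw [extZero_of_ge F hjn, map_zero]
      exact Commute.zero_right _
  bracket := by
    rw [extZero_val, ← map_mul, ← map_mul, ← map_sub, ← map_smul, F_mul_E, map_sub]
  κe _ := (commute_inl_inr _ _).symm
  κ'e _ := (commute_inl_inr _ _).symm
  κf j := by
    have h : ∀ j : Fin n, QComm (isQParam_qPow.pow (-cartan i j)) (k i * k i) (F j) := fun j => by
      rw [isQParam_pow, Int.cast_neg]
      exact kk_F i j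
    exact (qComm_extZero_right (c := fun j => isQParam_qPow.pow (-cartan i j)) h j).map inr
  κ'f j := by
    have h : ∀ j : Fin n, QComm (isQParam_qPow.pow (cartan i j)) (kbar i * kbar i) (F j) :=
      fun j => by
        rw [isQParam_pow]
        exact kbkb_F i j
    exact (qComm_extZero_right (c := fun j => isQParam_qPow.pow (cartan i j)) h j).map inr

/-- Here `g + κ e_i = Δ(F i)`. -/
theorem isOpposite_F (i : Fin n) : IsOpposite isQParam_qPow i (fun j => inr (extZero F j))
    (fun j => inl (extZero E j)) (inl (F i) : T2 (Uh n)) (inl (kbar i * kbar i))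
    (inl (k i * k i)) where
  serre_e := isSerre_F.map inr
  serre_f := isSerre_E.map inl
  ef j l := (commute_E_F' l j).symm
  ge _ := commute_inl_inr _ _
  gf j hj := by
    by_cases hjn : j < n
    · rw [extZero_of_lt E hjn]
      exact (commute_E_F fun h => hj (by rw [← h])).symm.map inl
    · rw [extZero_of_ge E hjn, map_zero]
      exact Commute.zero_right _
  bracket := by
    rw [extZero_val, ← map_mul, ← map_mul, ← map_sub, ← map_smul, ← neg_sub (F i * E i), smul_neg,
      F_mul_E, neg_sub, map_sub]
  κe _ := commute_inl_inr _ _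
  κ'e _ := commute_inl_inr _ _
  κf j := by
    have h : ∀ j : Fin n, QComm (isQParam_qPow.pow (-cartan i j)) (kbar i * kbar i) (E j) :=
      fun j => by
        rw [isQParam_pow, Int.cast_neg]
        exact kbkb_E i j
    exact (qComm_extZero_right (c := fun j => isQParam_qPow.pow (-cartan i j)) h j).map inl
  κ'f j := by
    have h : ∀ j : Fin n, QComm (isQParam_qPow.pow (cartan i j)) (k i * k i) (E j) := fun j => by
      rw [isQParam_pow]
      exact kk_E i j
    exact (qComm_extZero_right (c := fun j => isQParam_qPow.pow (cartan i j)) h j).map inl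

theorem kk_mul_kbkb (i : Fin n) : k i * k i * (kbar i * kbar i) = 1 := by
  rw [mul_assoc, ← mul_assoc (k i) (kbar i), k_mul_kbar, one_mul, k_mul_kbar]

theorem kbkb_mul_kk (i : Fin n) : kbar i * kbar i * (k i * k i) = 1 := by
  rw [mul_assoc, ← mul_assoc (kbar i) (k i), kbar_mul_k, one_mul, kbar_mul_k]

theorem commute_H_kk (i j : Fin n) : Commute (H i) (k j * k j) :=
  (commute_H_k i j).mul_right (commute_H_k i j)

theorem commute_H_kbkb (i j : Fin n) : Commute (H i) (kbar j * kbar j) :=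
  (commute_H_kbar i j).mul_right (commute_H_kbar i j)

theorem cartanPart_mul_kbkb_E (i : Fin n) :
    cartanPart n * (inr (kbar i * kbar i) * inl (E i)) = inl (E i) * cartanPart n := by
  rw [← (commute_inl_inr _ _).eq, ← mul_assoc, cartanPart_E_left, mul_assoc, ← map_mul,
    kk_mul_kbkb, map_one, mul_one]

theorem cartanPart_mul_kk_F (i : Fin n) :
    cartanPart n * (inl (k i * k i) * inr (F i)) = inr (F i) * cartanPart n := by
  rw [(commute_inl_inr _ _).eq, ← mul_assoc, cartanPart_F_right, mul_assoc, ← map_mul,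
    kbkb_mul_kk, map_one, mul_one]

/-- `Θ` carries `Δ(E i)` to `1 ⊗ E i + E i ⊗ kbar i ^ 2`, and the Cartan factor carries this element
to the opposite coproduct `k i ^ 2 ⊗ E i + E i ⊗ 1`. -/
theorem twist_comul_E (i : Fin n) :
    twist (comul (E i)) * rMatrix n = rMatrix n * comul (E i) := by
  have h1 := theta_mul_opposite (isOpposite_E i) i.2 (zero_add n)
  rw [if_pos (Nat.zero_le _), extZero_val] at h1
  have h2 : inr (E i) * inl (k i * k i) * cartanPart n = cartanPart n * inr (E i) := by
    rw [cartanPart_E_right, mul_assoc, mul_assoc,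
      (commute_cartanPart_inl fun j => commute_H_kk j i).eq]
  have h4 : twist (comul (E i)) * cartanPart n =
      cartanPart n * (inr (E i) + inr (kbar i * kbar i) * inl (E i)) := by
    rw [comul_E, map_add, map_mul, twist_inl, twist_inr, twist_inr, (commute_inl_inr _ _).eq,
      add_mul, h2, mul_add, cartanPart_mul_kbkb_E]
  rw [rMatrix_eq, ← mul_assoc, h4, mul_assoc, ← h1, mul_assoc, comul_E, add_comm (inr (E i))]

/-- `Θ` carries `Δ(F i)` to `F i ⊗ 1 + k i ^ 2 ⊗ F i`, and the Cartan factor carries this element to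
the opposite coproduct `F i ⊗ kbar i ^ 2 + 1 ⊗ F i`. -/
theorem twist_comul_F (i : Fin n) :
    twist (comul (F i)) * rMatrix n = rMatrix n * comul (F i) := by
  have h1 := theta_mul_opposite (isOpposite_F i) i.2 (zero_add n)
  rw [if_pos (Nat.zero_le _), extZero_val, theta_symm fun a b => (commute_E_F' b a).symm] at h1
  have h2 : inr (kbar i * kbar i) * inl (F i) * cartanPart n = cartanPart n * inl (F i) := by
    rw [cartanPart_F_left, mul_assoc]
    exact ((commute_inl_inr _ _).symm.mul_right
      (commute_cartanPart_inr fun j => commute_H_kbkb j i).symm).eq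
  have h4 : twist (comul (F i)) * cartanPart n =
      cartanPart n * (inl (F i) + inl (k i * k i) * inr (F i)) := by
    rw [comul_F, map_add, map_mul, twist_inl, twist_inr, twist_inl, add_mul, h2, mul_add,
      cartanPart_mul_kk_F, add_comm]
  rw [rMatrix_eq, ← mul_assoc, h4, mul_assoc, ← h1, mul_assoc, comul_F, add_comm (inl (F i))]

theorem twist_comul_H (i : Fin n) :
    twist (comul (H i)) * rMatrix n = rMatrix n * comul (H i) := by
  have h1 : Commute (cartanPart n) (comul (H i)) := by
    rw [comul_H]
    exact (commute_cartanPart_inl fun j => isRep.HH j i).add_right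
      (commute_cartanPart_inr fun j => isRep.HH j i)
  have h2 : Commute (comul (H i)) (theta n (fun j => inl (extZero E j))
      (fun j => inr (extZero F j)) 0 n) := by
    rw [comul_H]
    refine commute_theta (c := fun j => PowerSeries.C (cartan i j : ℂ)) (fun j => ?_)
      (fun j => ?_) _ _ _
    · by_cases hj : j < n
      · rw [extZero_of_lt E hj]
        have := ((E_hasWeight i ⟨j, hj⟩).map inl).add_left
          (HasWeight.of_commute (K := Kh) (commute_inl_inr (E ⟨j, hj⟩) (H i)).symm)
        rwa [add_zero] at this
      · rw [extZero_of_ge E hj]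
        simp [HasWeight]
    · by_cases hj : j < n
      · rw [extZero_of_lt F hj]
        have := (HasWeight.of_commute (K := Kh) (commute_inl_inr (H i) (F ⟨j, hj⟩))).add_left
          ((F_hasWeight i ⟨j, hj⟩).map inr)
        rwa [zero_add, map_neg] at this
      · rw [extZero_of_ge F hj]
        simp [HasWeight]
  have h3 : twist (comul (H i)) = comul (H i) := by
    rw [comul_H, map_add, twist_inl, twist_inr, add_comm]
  rw [h3, rMatrix_eq]
  exact (h1.symm.mul_right h2).eq

theorem isUnit_rMatrix : IsUnit (rMatrix n) := by
  rw [rMatrix_eq]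
  exact (HCompl.isUnit_hExp _ _).mul (isUnit_theta _ _ _ _ _)

/-- A homomorphism out of `U_h(sl (n + 1))` is determined by its values on the `E i`, `H i` and
`F i`. -/
theorem algHom_ext_EF {B : Type} [Ring B] [Algebra Kh B] {φ ψ : Uh n →ₐ[Kh] HCompl B}
    (hE : ∀ i, φ (E i) = ψ (E i)) (hH : ∀ i, φ (H i) = ψ (H i)) (hF : ∀ i, φ (F i) = ψ (F i)) :
    φ = ψ := by
  have hexp : ∀ c i, φ (HCompl.hExp c (H i)) = ψ (HCompl.hExp c (H i)) := fun c i => by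
    rw [HCompl.map_hExp, HCompl.map_hExp, hH]
  refine algHom_ext (fun i => ?_) hH (fun i => ?_)
  · have h : x i = kbar i * E i := by rw [E, ← mul_assoc, kbar_mul_k, one_mul]
    rw [h, map_mul, map_mul, hE, kbar, hexp]
  · have h : y i = -(k i * F i) := by rw [F, mul_neg, neg_neg, ← mul_assoc, k_mul_kbar, one_mul]
    rw [h, map_neg, map_neg, map_mul, map_mul, hF, k, hexp]

theorem twist_comul (u : (T2 (Uh n))ˣ) (hu : (u : T2 (Uh n)) = rMatrix n) (a : Uh n) :
    twist (comul a) = rMatrix n * comul a * ((u⁻¹ : (T2 (Uh n))ˣ) : T2 (Uh n)) := by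
  have h : twist.comp comul = (conjHom (K := Kh) u).comp (comul (n := n)) := by
    refine algHom_ext_EF (fun i => ?_) (fun i => ?_) (fun i => ?_)
    · exact (conjHom_eq (by rw [hu]; exact (twist_comul_E i).symm)).symm
    · exact (conjHom_eq (by rw [hu]; exact (twist_comul_H i).symm)).symm
    · exact (conjHom_eq (by rw [hu]; exact (twist_comul_F i).symm)).symm
  rw [← hu]
  exact AlgHom.congr_fun h a

/-! ### The hexagon identities -/

theorem commute_in₁_leg23 {A : Type} [Ring A] [Algebra Kh A] (a : A) (w : T2 A) :
    Commute (in₁ a) (HCompl.map (leg23 A) w) := by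
  refine (HCompl.commute_map_of (leg23 A) (leg12 A (a ⊗ₜ[Kh] 1)) (fun t => ?_) w).symm
  induction t with
  | zero => simp
  | add s t hs ht => rw [map_add]; exact hs.add_left ht
  | tmul s t => simp [leg12, leg23, Commute, SemiconjBy]

theorem commute_in₃_leg12 {A : Type} [Ring A] [Algebra Kh A] (a : A) (w : T2 A) :
    Commute (in₃ a) (HCompl.map (leg12 A) w) := by
  refine (HCompl.commute_map_of (leg12 A) (leg23 A (1 ⊗ₜ[Kh] a)) (fun t => ?_) w).symm
  simp [leg12, leg23, Commute, SemiconjBy, ← Algebra.TensorProduct.one_def]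

theorem map_tmul_H {B : Type} [Ring B] [Algebra Kh B] (f : T2 (Uh n) →ₐ[Kh] HCompl B) :
    f (cartanSum n) = ∑ i : Fin n, ∑ j : Fin n, (PowerSeries.C (kappa n i j) : Kh) •
      (f (inl (H i)) * f (inr (H j))) := by
  simp only [cartanSum, map_sum, map_smul, tmul_eq, map_mul]

theorem mapId_cartanPart : mapId comul (cartanPart n) =
    HCompl.map (leg13 (Uh n)) (cartanPart n) * HCompl.map (leg23 (Uh n)) (cartanPart n) := by
  rw [cartanPart, HCompl.map_hExp, HCompl.map_hExp, HCompl.map_hExp, ← HCompl.hExp_add]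
  · rw [map_tmul_H, map_tmul_H, map_tmul_H, ← Finset.sum_add_distrib]
    simp only [← Finset.sum_add_distrib, mapId_inl, mapId_inr, comul_H, map_add, map_leg12_inl,
      map_leg12_inr, map_leg13_inl, map_leg13_inr, map_leg23_inl, map_leg23_inr, add_mul, smul_add]
  · rw [map_tmul_H]
    refine Commute.sum_left _ _ _ fun i _ => Commute.sum_left _ _ _ fun j _ =>
      Commute.smul_left (Commute.mul_left ?_ ?_) _
    · rw [map_leg13_inl]
      exact commute_in₁_leg23 _ _
    · rw [map_leg13_inr, ← map_leg23_inr]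
      refine Commute.map ?_ (HCompl.map (leg23 (Uh n)))
      refine Commute.sum_right _ _ _ fun i _ => Commute.sum_right _ _ _ fun l _ => ?_
      rw [tmul_eq]
      exact ((commute_inl_inr _ _).symm.mul_right ((isRep.HH j l).map inr)).smul_right _

theorem idMap_cartanPart : idMap comul (cartanPart n) =
    HCompl.map (leg13 (Uh n)) (cartanPart n) * HCompl.map (leg12 (Uh n)) (cartanPart n) := by
  rw [cartanPart, HCompl.map_hExp, HCompl.map_hExp, HCompl.map_hExp, ← HCompl.hExp_add]
  · rw [add_comm, map_tmul_H, map_tmul_H, map_tmul_H, ← Finset.sum_add_distrib]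
    simp only [← Finset.sum_add_distrib, idMap_inl, idMap_inr, comul_H, map_add, map_leg12_inl,
      map_leg12_inr, map_leg13_inl, map_leg13_inr, map_leg23_inl, map_leg23_inr, mul_add, smul_add]
  · rw [map_tmul_H]
    refine Commute.sum_left _ _ _ fun i _ => Commute.sum_left _ _ _ fun j _ =>
      Commute.smul_left (Commute.mul_left ?_ ?_) _
    · rw [map_leg13_inl, ← map_leg12_inl]
      refine Commute.map ?_ (HCompl.map (leg12 (Uh n)))
      refine Commute.sum_right _ _ _ fun l _ => Commute.sum_right _ _ _ fun j _ => ?_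
      rw [tmul_eq]
      exact (((isRep.HH i l).map inl).mul_right (commute_inl_inr _ _)).smul_right _
    · rw [map_leg13_inr]
      exact commute_in₃_leg12 _ _

theorem commute_extZero_both {T : Type} [Ring T] {f g : Fin n → T}
    (h : ∀ i j, Commute (f i) (g j)) (i j : ℕ) : Commute (extZero f i) (extZero g j) :=
  commute_extZero (fun l => (commute_extZero (fun m => (h m l).symm) i).symm) j

theorem kk_extZero_E (i j : ℕ) : QComm (isQParam_qPow.pow (cartan i j))
    (extZero (fun i : Fin n => k i * k i) i) (extZero E j) :=
  qComm_extZero (c := fun i j => isQParam_qPow.pow (cartan i j))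
    (fun i j => by rw [isQParam_pow]; exact kk_E i j) i j

theorem kbkb_extZero_F (i j : ℕ) : QComm (isQParam_qPow.pow (cartan i j))
    (extZero (fun i : Fin n => kbar i * kbar i) i) (extZero F j) :=
  qComm_extZero (c := fun i j => isQParam_qPow.pow (cartan i j))
    (fun i j => by rw [isQParam_pow]; exact kbkb_F i j) i j

theorem commute_kk_extZero (i j : ℕ) : Commute (extZero (fun i : Fin n => k i * k i) i)
    (extZero (fun i : Fin n => k i * k i) j) :=
  commute_extZero_both (fun i j => by rw [k_mul_k, k_mul_k]; exact commute_hExp _ _ _ _) i j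

theorem commute_kbkb_extZero (i j : ℕ) : Commute (extZero (fun i : Fin n => kbar i * kbar i) i)
    (extZero (fun i : Fin n => kbar i * kbar i) j) :=
  commute_extZero_both (fun i j => by rw [kbar_mul_kbar, kbar_mul_kbar]; exact commute_hExp _ _ _ _)
    i j

/-- The element `(Δ ⊗ id)(E i ⊗ F i)` is `(E i ⊗ k i ^ 2 ⊗ 1 + 1 ⊗ E i ⊗ 1) (1 ⊗ 1 ⊗ F i)`, so that
`Θ` splits by `theta_add`. The factors `1 ⊗ k i ^ 2 ⊗ 1` of the first part commute with the legs 1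
and 3, so they can be moved to the elements `1 ⊗ 1 ⊗ F i`, and they disappear when the Cartan factor
in the legs 2 and 3 is moved past. -/
theorem mapId_rMatrix : mapId comul (rMatrix n) =
    HCompl.map (leg13 (Uh n)) (rMatrix n) * HCompl.map (leg23 (Uh n)) (rMatrix n) := by
  have hE : ∀ i, mapId comul (inl (extZero E i)) =
      in₂ (extZero (fun i : Fin n => k i * k i) i) * in₁ (extZero E i) + in₂ (extZero E i) := by
    intro i
    rw [mapId_inl]
    by_cases hi : i < n
    · simp only [extZero_of_lt _ hi, comul_E, map_add, map_mul, map_leg12_inl, map_leg12_inr]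
    · simp only [extZero_of_ge _ hi, map_zero, mul_zero, add_zero]
  set κ : ℕ → T3 (Uh n) := fun i => in₂ (extZero (fun i : Fin n => k i * k i) i) with hκ
  set K : T3 (Uh n) := HCompl.map (leg23 (Uh n)) (cartanPart n) with hK
  have hKu : IsUnit K := (HCompl.isUnit_hExp _ _).map _
  -- the Cartan factor in the legs 2 and 3 is moved past the `q`-exponentials in the legs 1 and 3
  have h1 := theta_semiconj (e := fun i => in₁ (extZero E i)) (e' := fun i => in₁ (extZero E i))
    (φ := fun i => κ i * in₃ (extZero F i)) (φ' := fun i => in₃ (extZero F i)) hKu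
    (fun i => (commute_in₁_leg23 _ _).eq.symm) (fun i => by
      by_cases hi : i < n
      · simp only [hκ, hK, extZero_of_lt _ hi]
        rw [← map_leg23_inl, ← map_leg23_inr, ← map_mul, ← map_mul, ← map_mul, cartanPart_mul_kk_F]
      · simp only [hκ, extZero_of_ge _ hi, map_zero, mul_zero, zero_mul]) n 0 n
  have h2 := theta_mul_left (e := fun i => in₁ (extZero E i)) (φ := fun i => in₃ (extZero F i))
    (t := κ) (fun i j => (commute_kk_extZero i j).map in₂) (fun i j => (commute_in₁_in₂ _ _).symm)
    (fun i j => commute_in₂_in₃ _ _) n 0 n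
  have h3 := theta_add (α := fun i => κ i * in₁ (extZero E i)) (ε := fun i => in₂ (extZero E i))
    (φ := fun i => in₃ (extZero F i))
    ((isSerre_E.map in₁).twist (fun _ _ => 1) (fun _ _ => rfl)
      (fun i j => (commute_kk_extZero i j).map in₂) fun i j => .of_commute (commute_in₁_in₂ _ _))
    (isSerre_F.map in₃) (fun i j => (commute_in₂_in₃ _ _).mul_left (commute_in₁_in₃ _ _))
    (fun i j => commute_in₂_in₃ _ _)
    (fun i j => (((kk_extZero_E i j).map in₂).mul_left
      (.of_commute (commute_in₁_in₂ _ _))).of_eq (mul_one _)) (zero_add n)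
  rw [rMatrix_eq, map_mul, map_mul, map_mul, map_theta, map_theta, map_theta, mapId_cartanPart]
  simp only [hE, mapId_inr, map_leg13_inl, map_leg13_inr, map_leg23_inl, map_leg23_inr]
  rw [h3, h2, mul_assoc, mul_assoc, ← mul_assoc (HCompl.map (leg23 (Uh n)) (cartanPart n)), h1,
    mul_assoc]

/-- The counterpart of `mapId_rMatrix`, with `Δ(F i) = F i ⊗ 1 + kbar i ^ 2 ⊗ F i`. Since
`theta_add` is about sums in the first family, the two families are exchanged by `theta_symm`. -/
theorem idMap_rMatrix : idMap comul (rMatrix n) =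
    HCompl.map (leg13 (Uh n)) (rMatrix n) * HCompl.map (leg12 (Uh n)) (rMatrix n) := by
  have hF : ∀ i, idMap comul (inr (extZero F i)) =
      in₂ (extZero (fun i : Fin n => kbar i * kbar i) i) * in₃ (extZero F i) +
        in₂ (extZero F i) := by
    intro i
    rw [idMap_inr]
    by_cases hi : i < n
    · simp only [extZero_of_lt _ hi, comul_F, map_add, map_mul, map_leg23_inl, map_leg23_inr]
    · simp only [extZero_of_ge _ hi, map_zero, mul_zero, add_zero]
  set κ : ℕ → T3 (Uh n) := fun i => in₂ (extZero (fun i : Fin n => kbar i * kbar i) i) with hκ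
  set K : T3 (Uh n) := HCompl.map (leg12 (Uh n)) (cartanPart n) with hK
  have hKu : IsUnit K := (HCompl.isUnit_hExp _ _).map _
  -- the Cartan factor in the legs 1 and 2 is moved past the `q`-exponentials in the legs 1 and 3
  have h1 := theta_semiconj (e := fun i => κ i * in₁ (extZero E i))
    (e' := fun i => in₁ (extZero E i))
    (φ := fun i => in₃ (extZero F i)) (φ' := fun i => in₃ (extZero F i)) hKu
    (fun i => by
      by_cases hi : i < n
      · simp only [hκ, hK, extZero_of_lt _ hi]
        rw [← map_leg12_inl, ← map_leg12_inr, ← map_mul, ← map_mul, ← map_mul,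
          cartanPart_mul_kbkb_E]
      · simp only [hκ, extZero_of_ge _ hi, map_zero, mul_zero, zero_mul])
    (fun i => (commute_in₃_leg12 _ _).eq.symm) n 0 n
  have h2 := theta_mul_left (e := fun i => in₁ (extZero E i)) (φ := fun i => in₃ (extZero F i))
    (t := κ) (fun i j => (commute_kbkb_extZero i j).map in₂)
    (fun i j => (commute_in₁_in₂ _ _).symm) (fun i j => commute_in₂_in₃ _ _) n 0 n
  have h3 := theta_add (α := fun i => κ i * in₃ (extZero F i)) (ε := fun i => in₂ (extZero F i))
    (φ := fun i => in₁ (extZero E i))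
    ((isSerre_F.map in₃).twist (fun _ _ => 1) (fun _ _ => rfl)
      (fun i j => (commute_kbkb_extZero i j).map in₂)
      fun i j => .of_commute (commute_in₂_in₃ _ _).symm)
    (isSerre_E.map in₁)
    (fun i j => (commute_in₁_in₂ _ _).symm.mul_left (commute_in₁_in₃ _ _).symm)
    (fun i j => (commute_in₁_in₂ _ _).symm)
    (fun i j => (((kbkb_extZero_F i j).map in₂).mul_left
      (.of_commute (commute_in₂_in₃ _ _).symm)).of_eq (mul_one _)) (zero_add n)
  have c₁ : ∀ i j, Commute (κ i * in₃ (extZero F i)) (in₁ (extZero (E (n := n)) j)) := fun i j =>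
    (commute_in₁_in₂ _ _).symm.mul_left (commute_in₁_in₃ _ _).symm
  have c₂ : ∀ i j, Commute (in₂ (extZero F i)) (in₁ (extZero (E (n := n)) j)) := fun i j =>
    (commute_in₁_in₂ _ _).symm
  rw [theta_symm fun i j => (c₁ i j).add_left (c₂ i j), theta_symm c₁, theta_symm c₂, ← h2] at h3
  rw [rMatrix_eq, map_mul, map_mul, map_mul, map_theta, map_theta, map_theta, idMap_cartanPart]
  simp only [hF, idMap_inl, map_leg13_inl, map_leg13_inr, map_leg12_inl, map_leg12_inr]
  rw [h3, mul_assoc, mul_assoc, ← mul_assoc (HCompl.map (leg12 (Uh n)) (cartanPart n)), h1,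
    mul_assoc]

theorem isUniversalRMatrix : IsUniversalRMatrix (hopf n) (rMatrix n) where
  twist_comul := by
    obtain ⟨u, hu⟩ := isUnit_rMatrix (n := n)
    exact ⟨u, hu, twist_comul u hu⟩
  comul_id := mapId_rMatrix
  id_comul := idMap_rMatrix

end Uh

end QuantumSl

end

open QuantumSl in
theorem mainTheorem9 (n : ℕ) (hn : 1 ≤ n) :
    ∃ S : HopfStructure (Uh n),
      (∀ i : Fin n,
        S.comul (Uh.x i) = tmul (Uh.x i) (Uh.k i) + tmul (Uh.kbar i) (Uh.x i) ∧
        S.comul (Uh.y i) = tmul (Uh.y i) (Uh.k i) + tmul (Uh.kbar i) (Uh.y i) ∧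
        S.comul (Uh.H i) = tmul (Uh.H i) 1 + tmul 1 (Uh.H i) ∧
        S.antipode (Uh.x i) = MulOpposite.op (-(qPow 1 • Uh.x i)) ∧
        S.antipode (Uh.y i) = MulOpposite.op (-(qPow (-1) • Uh.y i)) ∧
        S.antipode (Uh.H i) = MulOpposite.op (-Uh.H i) ∧
        S.counit (Uh.x i) = 0 ∧ S.counit (Uh.y i) = 0 ∧ S.counit (Uh.H i) = 0) ∧
      IsUniversalRMatrix S (Uh.rMatrix n) := by
  refine ⟨Uh.hopf n, fun i => ⟨?_, ?_, Uh.comul_H i, Uh.antipode_x i, Uh.antipode_y i,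
    Uh.antipode_H i, Uh.counit_x i, Uh.counit_y i, Uh.counit_H i⟩, Uh.isUniversalRMatrix⟩
  · rw [tmul_eq', tmul_eq]
    exact Uh.comul_x i
  · rw [tmul_eq', tmul_eq, add_comm]
    exact Uh.comul_y i
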